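/- **Setting.** Let $\mathcal G=\mathbb R\times\mathbb R^3\times\mathbb R^3\times SO(3)$ be the Galileian group; $g=(c_g,\mathbf c_g,\mathbf v_g,R_g)$ acts on space-time by $g(t,\mathbf x)=(t+c_g,\ \mathbf c_g+t\mathbf v_g+R_g\mathbf x)$, and the product is composition. Fix an arbitrary function $\gamma:\mathcal G\to\mathbb R$ and put $$\varphi_g(t,\mathbf x)=\mathbf v_g\cdot\mathbf x-\tfrac12\mathbf v_g^2t+\gamma_g .$$ The number $\xi(g',g)=\varphi_g(g'^{-1}(t,\mathbf x))+\varphi_{g'}(t,\mathbf x)-\varphi_{g'g}(t,\mathbf x)$ does not depend on $(t,\mathbf x)$ and is a 2-cocycle. Let $\mathbb R\times_\xi\mathcal G$ be the central extension with product $(r',g')(r,g)=(r+r'+\xi(g',g),g'g)$. Let $N\ge1$, and let $V=V(\{m_k\},\{\mathbf x_k\})$ be a real (Borel) potential, possibly depending on the masses, that is invariant under simultaneous translations and rotations of the $\mathbf x_k\in\mathbb R^3$, $k=1,\dots,N$. Assume that for almost all $m=(m_1,\dots,m_N)\in\mathbb R^N$ the operator $-\sum_k\frac{1}{2m_k}\Delta_{\mathbf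 x_k}+V(m,\cdot)$ is defined (with values in $L^2(\mathbb R^{3N})$) and essentially self-adjoint on $C_0^\infty(\mathbb R^{3N})$; let $H_m$ be its closure and $U_t(m)=e^{-itH_m}$. Let $$\mathsf H=L^2(\mathbb R^N\times\mathbb R^{3N},d^Nm\otimes d^{3N}x)\simeq\int^\oplus_{\mathbb R^N}\mathsf H_m\,d^Nm,\qquad \mathsf H_m=L^2(\mathbb R^{3N},d^{3N}x),$$ and, for $(r,g)\in\mathbb R\times_\xi\mathcal G$, $$(U_{(r,g)}\Psi)(m,\{\mathbf x_k\})=e^{i\sum_{j=1}^N(\mathbf v_g\cdot\mathbf x_j+\gamma_g+r)m_j}\,U_{-c_g}(m)\,\Psi\big(m,\{R_g^{-1}(\mathbf x_k+c_g\mathbf v_g-\mathbf c_g)\}\big).$$ **Proposition.** (i) The operators $U_{(r,g)}$ are well-defined decomposable operators on $\mathsf H$, and $(r,g)\mapsto U_{(r,g)}$ is a unitary representation of $\mathbb R\times_\xi\mathcal G$ (a homomorphism into the unitary group of $\mathsf H$). For $r=0$ it reduces in the fibres to a unitary projective representation of $\mathcal G$: for every $m$ such that all $m_k\ne0$ and the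 operator above is essentially self-adjoint, the fibre operators $U^{(m)}_g$ of $U_{(0,g)}$ are unitary on $\mathsf H_m$ and, with $M=\sum_jm_j$, $$U^{(m)}_{g'}U^{(m)}_g=e^{iM\xi(g',g)}\,U^{(m)}_{g'g}.$$ Moreover, suppose in addition that all tail sums $\sum_{j\ge k}m_j$ ($k=1,\dots,N$) are nonzero. Put $\mathbf X=M^{-1}\sum_jm_j\mathbf x_j$, $\mathbf y_k=\mathbf x_k-(\sum_{j>k}m_j\mathbf x_j)/(\sum_{j>k}m_j)$ for $k<N$, and $\mu_k=m_k(\sum_{j>k}m_j)/(\sum_{j\ge k}m_j)$, and write $V$ at these masses as a function $v$ of $y=\{\mathbf y_k\}$. If also the internal operator $-\sum_{k<N}\frac1{2\mu_k}\Delta_{\mathbf y_k}+v$ is essentially self-adjoint on $C_0^\infty(\mathbb R^{3(N-1)})$, with closure $h$, then in the coordinates $(\mathbf X,y)$ one has $U^{(m)}_g=Z^{(M)}_g\otimes T_{(c_g,R_g)}$. Here $(T_{(c,R)}b)(y)=e^{ich}\,b(R^{-1}y)$, and $Z^{(M)}_g$ on $L^2(\mathbb R^3)$ is given in momentum picture (Fourier–Plancherel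 transform with kernel $(2\pi)^{-3/2}e^{-i\mathbf P\cdot\mathbf X}$) by $$\widetilde\psi(\mathbf P)\mapsto e^{i(c_g\mathbf v_g-\mathbf c_g)\cdot(\mathbf P-M\mathbf v_g)}\,e^{i\frac{c_g}{2M}(\mathbf P-M\mathbf v_g)^2+iM\gamma_g}\,\widetilde\psi\big(R_g^{-1}(\mathbf P-M\mathbf v_g)\big).$$ (ii) For $\Psi\in\mathsf H$ let $$\check\Psi(t,\{\zeta_k\},\{\mathbf x_k\})=(2\pi)^{-N/2}\int_{\mathbb R^N}e^{i\sum_km_k\zeta_k}\,\big(U_t(m)\Psi(m,\cdot)\big)(\{\mathbf x_k\})\,d^Nm$$ (in the Fourier–Plancherel sense) be the time-evolved state in the $\zeta$-picture; time evolution and passage to the $\zeta$-picture are unitary. Let $\check\Psi'$ be obtained in the same way from $\Psi'=U_{(r,g)}\Psi$, and let $$\check F_{(r,g)}(t,\{\zeta_k\},\{\mathbf x_k\})=\big(t+c_g,\ \{\zeta_k+\varphi_{g^{-1}}(t,\mathbf x_k)-r-\xi(g^{-1},g)\},\ \{\mathbf c_g+t\mathbf v_g+R_g\mathbf x_k\}\big).$$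 Then for all $(r,g)$, all $\Psi\in\mathsf H$ and all $t$, for almost all $(\{\zeta_k\},\{\mathbf x_k\})$, $$\check\Psi'(t,\{\zeta_k\},\{\mathbf x_k\})=\check\Psi\big(\check F_{(-r-\xi(g^{-1},g),\,g^{-1})}(t,\{\zeta_k\},\{\mathbf x_k\})\big).$$ If the constants are normalised by $\gamma_e=0$ at the unit element $e$, then $(-r-\xi(g^{-1},g),g^{-1})=(r,g)^{-1}$ and $\check F_{(r,g)^{-1}}$ is the two-sided inverse of $\check F_{(r,g)}$, so that $\check\Psi'(t,\cdot)=\check\Psi(\check F_{(r,g)^{-1}}(t,\cdot))=\check\Psi(\check F_{(r,g)}^{-1}(t,\cdot))$. -/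

import Mathlib

open MeasureTheory
open scoped FourierTransform ContDiff RealInnerProductSpace

namespace GalileiMass

/-! ### The Galileian group -/

/-- Euclidean three-space. -/
abbrev E3 : Type := EuclideanSpace ℝ (Fin 3)

/-- The rotation group `SO(3)`. -/
abbrev SO3 : Type := Matrix.specialOrthogonalGroup (Fin 3) ℝ

/-- The action of a rotation on a vector of three-space. -/
noncomputable def rot (R : SO3) (x : E3) : E3 := Matrix.toEuclideanLin (R : Matrix (Fin 3) (Fin 3) ℝ) x

/-- Galileian transformations `g = (c, 𝐜, 𝐯, R)`: time translation `c`, space translation `𝐜`,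
boost `𝐯`, rotation `R`. -/
@[ext] structure Galilei : Type where
  time : ℝ
  shift : E3
  boost : E3
  R : SO3

theorem rot_one (x : E3) : rot 1 x = x := by
  simp [rot]

theorem rot_mul (R S : SO3) (x : E3) : rot (R * S) x = rot R (rot S x) := by
  simp [rot]

theorem rot_add (R : SO3) (x y : E3) : rot R (x + y) = rot R x + rot R y := by
  simp [rot]

theorem rot_sub (R : SO3) (x y : E3) : rot R (x - y) = rot R x - rot R y := by
  simp [rot]

theorem rot_neg (R : SO3) (x : E3) : rot R (-x) = -rot R x := by
  simp [rot]

theorem rot_zero (R : SO3) : rot R 0 = 0 := by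
  simp [rot]

theorem rot_smul (R : SO3) (a : ℝ) (x : E3) : rot R (a • x) = a • rot R x := by
  simp [rot]

theorem rot_inv_rot (R : SO3) (x : E3) : rot R⁻¹ (rot R x) = x := by
  rw [← rot_mul, inv_mul_cancel, rot_one]

theorem rot_rot_inv (R : SO3) (x : E3) : rot R (rot R⁻¹ x) = x := by
  rw [← rot_mul, mul_inv_cancel, rot_one]

theorem inner_rot_left (R : SO3) (x y : E3) : ⟪rot R x, y⟫ = ⟪x, rot R⁻¹ y⟫ := by
  have h : ((R⁻¹ : SO3) : Matrix (Fin 3) (Fin 3) ℝ)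
      = (R : Matrix (Fin 3) (Fin 3) ℝ).conjTranspose := rfl
  unfold rot
  rw [h, Matrix.toEuclideanLin_conjTranspose_eq_adjoint, LinearMap.adjoint_inner_right]

theorem inner_rot_rot (R : SO3) (x y : E3) : ⟪rot R x, rot R y⟫ = ⟪x, y⟫ := by
  rw [inner_rot_left, rot_inv_rot]

namespace Galilei

noncomputable instance : Mul Galilei :=
  ⟨fun g₂ g₁ => ⟨g₁.time + g₂.time, rot g₂.R g₁.shift + g₁.time • g₂.boost + g₂.shift,
    rot g₂.R g₁.boost + g₂.boost, g₂.R * g₁.R⟩⟩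

noncomputable instance : One Galilei := ⟨⟨0, 0, 0, 1⟩⟩

noncomputable instance : Inv Galilei :=
  ⟨fun g => ⟨-g.time, rot g.R⁻¹ (g.time • g.boost - g.shift), -rot g.R⁻¹ g.boost, g.R⁻¹⟩⟩

theorem mul_def (g₂ g₁ : Galilei) : g₂ * g₁ =
    ⟨g₁.time + g₂.time, rot g₂.R g₁.shift + g₁.time • g₂.boost + g₂.shift,
      rot g₂.R g₁.boost + g₂.boost, g₂.R * g₁.R⟩ := rfl

theorem one_def : (1 : Galilei) = ⟨0, 0, 0, 1⟩ := rfl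

theorem inv_def (g : Galilei) : g⁻¹ =
    ⟨-g.time, rot g.R⁻¹ (g.time • g.boost - g.shift), -rot g.R⁻¹ g.boost, g.R⁻¹⟩ := rfl

noncomputable instance : Group Galilei :=
  Group.ofLeftAxioms
    (by
      intro a b c
      simp only [mul_def, rot_mul, rot_add, rot_smul, Galilei.mk.injEq, mul_assoc, and_true]
      refine ⟨by ring, ?_, by abel⟩
      module)
    (by
      intro a
      simp [mul_def, one_def, rot_one])
    (by
      intro a
      simp only [mul_def, one_def, inv_def, rot_sub, rot_smul, inv_mul_cancel, add_neg_cancel,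
        Galilei.mk.injEq, and_true, true_and]
      module)

/-- The action of the Galileian group on space-time:
`g (t, x) = (t + c, 𝐜 + t 𝐯 + R x)`. -/
noncomputable def act (g : Galilei) (p : ℝ × E3) : ℝ × E3 :=
  (p.1 + g.time, g.shift + p.1 • g.boost + rot g.R p.2)

theorem act_mul (g' g : Galilei) (p : ℝ × E3) : (g' * g).act p = g'.act (g.act p) := by
  simp only [act, mul_def, rot_mul, rot_add, rot_smul, Prod.mk.injEq]
  refine ⟨by ring, ?_⟩
  module

theorem act_one (p : ℝ × E3) : (1 : Galilei).act p = p := by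
  simp [act, one_def, rot_one]

end Galilei

/-! ### The phases, the cocycle, and the central extension -/

/-- `φ_g(t, x) = 𝐯 · x - 𝐯² t / 2 + γ_g`, for a choice `γ` of the constants. -/
noncomputable def phase (γ : Galilei → ℝ) (g : Galilei) (p : ℝ × E3) : ℝ :=
  ⟪g.boost, p.2⟫ - ‖g.boost‖ ^ 2 * p.1 / 2 + γ g

/-- The cocycle associated with the phases: the value of
`φ_g(g'⁻¹(t, x)) + φ_{g'}(t, x) - φ_{g'g}(t, x)`, which does not depend on `(t, x)`
(see `phase_central`). -/
noncomputable def xi (γ : Galilei → ℝ) (g' g : Galilei) : ℝ :=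
  phase γ g (g'⁻¹.act (0, 0)) + phase γ g' (0, 0) - phase γ (g' * g) (0, 0)

theorem phase_central (γ : Galilei → ℝ) (g' g : Galilei) (p : ℝ × E3) :
    phase γ g (g'⁻¹.act p) + phase γ g' p = phase γ (g' * g) p + xi γ g' g := by
  obtain ⟨t, x⟩ := p
  have key : ∀ (t : ℝ) (x : E3), phase γ g (g'⁻¹.act (t, x)) + phase γ g' (t, x)
      - phase γ (g' * g) (t, x) = γ g + γ g' - γ (g' * g)
        + g'.time * ⟪rot g'.R g.boost, g'.boost⟫ - ⟪rot g'.R g.boost, g'.shift⟫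
        + ‖g.boost‖ ^ 2 * g'.time / 2 := by
    intro t x
    have hsq : ‖rot g'.R g.boost + g'.boost‖ ^ 2
        = ‖g.boost‖ ^ 2 + 2 * ⟪rot g'.R g.boost, g'.boost⟫ + ‖g'.boost‖ ^ 2 := by
      rw [norm_add_sq_real, ← real_inner_self_eq_norm_sq (rot g'.R g.boost), inner_rot_rot,
        real_inner_self_eq_norm_sq]
    simp only [phase, Galilei.act, Galilei.inv_def, Galilei.mul_def, hsq, inner_add_right,
      smul_neg, inner_neg_right, inner_smul_right, ← inner_rot_left, inner_sub_right,
      inner_add_left]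
    ring
  have h1 := key t x
  have h2 := key 0 0
  unfold xi
  linarith

theorem xi_cocycle (γ : Galilei → ℝ) (g'' g' g : Galilei) :
    xi γ g'' g' + xi γ (g'' * g') g = xi γ g'' (g' * g) + xi γ g' g := by
  have h1 := phase_central γ g'' g' (0, 0)
  have h2 := phase_central γ (g'' * g') g (0, 0)
  have h3 := phase_central γ g'' (g' * g) (0, 0)
  have h4 := phase_central γ g' g (g''⁻¹.act (0, 0))
  rw [mul_inv_rev, Galilei.act_mul, mul_assoc] at h2
  linarith

theorem xi_one_left (γ : Galilei → ℝ) (g : Galilei) : xi γ 1 g = γ 1 := by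
  have h := phase_central γ 1 g (0, 0)
  simp only [inv_one, Galilei.act_one, one_mul] at h
  have h1 : phase γ 1 (0, 0) = γ 1 := by simp [phase, Galilei.one_def]
  linarith

theorem xi_one_right (γ : Galilei → ℝ) (g : Galilei) : xi γ g 1 = γ 1 := by
  have h := phase_central γ g 1 (0, 0)
  simp only [mul_one] at h
  have h1 : ∀ p, phase γ 1 p = γ 1 := by intro p; simp [phase, Galilei.one_def]
  rw [h1] at h
  linarith

/-- The underlying set `ℝ × 𝒢` of the central extension of the Galileian group defined by the
cocycle `ξ` of the constants `γ`. -/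
@[ext] structure Ext (γ : Galilei → ℝ) : Type where
  r : ℝ
  g : Galilei

namespace Ext

variable {γ : Galilei → ℝ}

noncomputable instance : Mul (Ext γ) := ⟨fun a b => ⟨b.r + a.r + xi γ a.g b.g, a.g * b.g⟩⟩

noncomputable instance : One (Ext γ) := ⟨⟨-γ 1, 1⟩⟩

noncomputable instance : Inv (Ext γ) := ⟨fun a => ⟨-a.r - xi γ a.g⁻¹ a.g - γ 1, a.g⁻¹⟩⟩

theorem mul_def (a b : Ext γ) : a * b = ⟨b.r + a.r + xi γ a.g b.g, a.g * b.g⟩ := rfl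

theorem one_def : (1 : Ext γ) = ⟨-γ 1, 1⟩ := rfl

theorem inv_def (a : Ext γ) : a⁻¹ = ⟨-a.r - xi γ a.g⁻¹ a.g - γ 1, a.g⁻¹⟩ := rfl

noncomputable instance : Group (Ext γ) :=
  Group.ofLeftAxioms
    (by
      intro a b c
      simp only [mul_def, mul_assoc, Ext.mk.injEq, and_true]
      linarith [xi_cocycle γ a.g b.g c.g])
    (by
      intro a
      simp [mul_def, one_def, xi_one_left])
    (by
      intro a
      simp only [mul_def, one_def, inv_def, inv_mul_cancel, Ext.mk.injEq, and_true]
      ring)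

end Ext

/-! ### Square-integrable functions, operators, one-parameter groups -/

/-- The Hilbert space of complex square-integrable functions on a measure space. -/
abbrev L2 (α : Type*) [MeasureSpace α] : Type _ := Lp ℂ 2 (volume : Measure α)

open Classical in
/-- The class in `L²` of a square-integrable function (`0` if it is not square-integrable). -/
noncomputable def toL2 {α : Type*} [MeasureSpace α] (f : α → ℂ) : L2 α :=
  if h : MemLp f 2 (volume : Measure α) then h.toLp f else 0

/-- `U` is the strongly continuous one-parameter unitary group `t ↦ e^{-itA}`, that is, `-iA` is
its infinitesimal generator (domain included). -/
def IsUnitaryGroupOf {E : Type*} [NormedAddCommGroup E] [InnerProductSpace ℂ E]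
    (A : E →ₗ.[ℂ] E) (U : ℝ → (E ≃ₗᵢ[ℂ] E)) : Prop :=
  (∀ s t : ℝ, U (s + t) = U s * U t) ∧
  (∀ ψ : E, Continuous fun t : ℝ => U t ψ) ∧
  (∀ ψ χ : E, (ψ, χ) ∈ A.graph ↔ HasDerivAt (fun t : ℝ => U t ψ) (-Complex.I • χ) 0)

open Classical in
/-- The unitary group `t ↦ e^{-itA}` of a self-adjoint operator `A`
(the trivial one if there is none). -/
noncomputable def unitaryGroup {E : Type*} [NormedAddCommGroup E] [InnerProductSpace ℂ E]
    (A : E →ₗ.[ℂ] E) : ℝ → (E ≃ₗᵢ[ℂ] E) :=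
  if h : ∃ U : ℝ → (E ≃ₗᵢ[ℂ] E), IsUnitaryGroupOf A U then h.choose else fun _ => 1

/-- Configurations of `n` particles in three-space. -/
abbrev Config (n : ℕ) : Type := Fin n → E3

/-- The space `ℝ^N` of masses `{m_k}`, and of the conjugated coordinates `{ζ_k}`. -/
abbrev Mass (N : ℕ) : Type := EuclideanSpace ℝ (Fin N)

/-- Test functions: smooth and compactly supported. -/
def IsTest {n : ℕ} (f : Config n → ℂ) : Prop := ContDiff ℝ ∞ f ∧ HasCompactSupport f

/-- The Laplacian in the variable `x_k ∈ ℝ³`. -/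
noncomputable def partialLaplacian {n : ℕ} (k : Fin n) (f : Config n → ℂ) (x : Config n) : ℂ :=
  Laplacian.laplacian (fun y : E3 => f (Function.update x k y)) (x k)

/-- The differential expression `-∑_k Δ_k / (2 m_k) + V` (with `ħ = 1`). -/
noncomputable def schrodingerFun {n : ℕ} (m : Fin n → ℝ) (V : Config n → ℝ)
    (f : Config n → ℂ) (x : Config n) : ℂ :=
  -(∑ k, (1 / (2 * (m k : ℂ))) * partialLaplacian k f x) + (V x : ℂ) * f x

theorem two_le_infty : (2 : WithTop ℕ∞) ≤ ∞ :=
  WithTop.coe_le_coe.2 (le_top : (2 : ℕ∞) ≤ ⊤)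

theorem partialLaplacian_add {n : ℕ} (k : Fin n) {f g : Config n → ℂ} (hf : ContDiff ℝ ∞ f)
    (hg : ContDiff ℝ ∞ g) (x : Config n) :
    partialLaplacian k (f + g) x = partialLaplacian k f x + partialLaplacian k g x := by
  have hu : ContDiff ℝ ∞ (fun y : E3 => Function.update x k y) := contDiff_update _ x k
  have h1 : ContDiffAt ℝ 2 (fun y : E3 => f (Function.update x k y)) (x k) :=
    ((hf.comp hu).of_le two_le_infty).contDiffAt
  have h2 : ContDiffAt ℝ 2 (fun y : E3 => g (Function.update x k y)) (x k) :=
    ((hg.comp hu).of_le two_le_infty).contDiffAt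
  exact h1.laplacian_add h2

theorem partialLaplacian_smul {n : ℕ} (k : Fin n) (a : ℂ) {f : Config n → ℂ}
    (hf : ContDiff ℝ ∞ f) (x : Config n) :
    partialLaplacian k (a • f) x = a * partialLaplacian k f x := by
  have hu : ContDiff ℝ ∞ (fun y : E3 => Function.update x k y) := contDiff_update _ x k
  have h1 : ContDiffAt ℝ 2 (fun y : E3 => f (Function.update x k y)) (x k) :=
    ((hf.comp hu).of_le two_le_infty).contDiffAt
  exact InnerProductSpace.laplacian_smul a h1

theorem schrodingerFun_add {n : ℕ} (m : Fin n → ℝ) (V : Config n → ℝ) {f g : Config n → ℂ}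
    (hf : ContDiff ℝ ∞ f) (hg : ContDiff ℝ ∞ g) (x : Config n) :
    schrodingerFun m V (f + g) x = schrodingerFun m V f x + schrodingerFun m V g x := by
  simp only [schrodingerFun, partialLaplacian_add _ hf hg, mul_add, Finset.sum_add_distrib,
    Pi.add_apply]
  ring

theorem schrodingerFun_smul {n : ℕ} (m : Fin n → ℝ) (V : Config n → ℝ) (a : ℂ)
    {f : Config n → ℂ} (hf : ContDiff ℝ ∞ f) (x : Config n) :
    schrodingerFun m V (a • f) x = a * schrodingerFun m V f x := by
  simp only [schrodingerFun, partialLaplacian_smul _ _ hf, Pi.smul_apply, smul_eq_mul, mul_add,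
    mul_neg, Finset.mul_sum]
  congr 1
  · congr 1
    refine Finset.sum_congr rfl fun k _ => ?_
    ring
  · ring

/-- The graph of `-∑_k Δ_k / (2 m_k) + V` on the test functions, in `L² × L²`. -/
noncomputable def schrodingerGraph {n : ℕ} (m : Fin n → ℝ) (V : Config n → ℝ) :
    Submodule ℂ (L2 (Config n) × L2 (Config n)) where
  carrier := {p | ∃ f : Config n → ℂ, IsTest f ∧ p.1 =ᵐ[volume] f ∧
    p.2 =ᵐ[volume] schrodingerFun m V f}
  zero_mem' := by
    refine ⟨0, ⟨contDiff_const, HasCompactSupport.zero⟩, Lp.coeFn_zero _ _ _, ?_⟩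
    have h : schrodingerFun m V 0 = 0 := by
      funext x
      simpa using schrodingerFun_smul m V 0 (f := 0) contDiff_const x
    rw [h]
    exact Lp.coeFn_zero _ _ _
  add_mem' := by
    rintro ⟨a, b⟩ ⟨a', b'⟩ ⟨f, hf, haf, hbf⟩ ⟨g, hg, hag, hbg⟩
    refine ⟨f + g, ⟨hf.1.add hg.1, hf.2.add hg.2⟩, (Lp.coeFn_add a a').trans (haf.add hag),
      (Lp.coeFn_add b b').trans ((hbf.add hbg).trans ?_)⟩
    exact Filter.Eventually.of_forall fun x => (schrodingerFun_add m V hf.1 hg.1 x).symm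
  smul_mem' := by
    rintro c ⟨a, b⟩ ⟨f, hf, haf, hbf⟩
    refine ⟨c • f, ⟨hf.1.const_smul c, hf.2.smul_left (f := fun _ => c)⟩,
      (Lp.coeFn_smul c a).trans (haf.const_smul c),
      (Lp.coeFn_smul c b).trans ((hbf.const_smul c).trans ?_)⟩
    exact Filter.Eventually.of_forall fun x => (schrodingerFun_smul m V c hf.1 x).symm

/-- The operator `-∑_k Δ_k / (2 m_k) + V` in `L²`, with the test functions as domain. -/
noncomputable def schrodinger {n : ℕ} (m : Fin n → ℝ) (V : Config n → ℝ) :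
    L2 (Config n) →ₗ.[ℂ] L2 (Config n) :=
  (schrodingerGraph m V).toLinearPMap

/-- `-∑_k Δ_k / (2 m_k) + V` maps all test functions into `L²` and is essentially self-adjoint
on them. -/
def IsEssSelfAdjoint {n : ℕ} (m : Fin n → ℝ) (V : Config n → ℝ) : Prop :=
  (∀ f : Config n → ℂ, IsTest f → MemLp (schrodingerFun m V f) 2 (volume : Measure (Config n))) ∧
  IsSelfAdjoint (schrodinger m V).closure

/-- The time evolution `U_t = e^{-itH}`, where `H` is the closure of `-∑_k Δ_k / (2 m_k) + V` on
the test functions. -/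
noncomputable def evolution {n : ℕ} (m : Fin n → ℝ) (V : Config n → ℝ) (t : ℝ) :
    L2 (Config n) ≃ₗᵢ[ℂ] L2 (Config n) :=
  unitaryGroup (schrodinger m V).closure t

/-- The Fourier-Plancherel transform
`ψ ↦ (2π)^{-d/2} ∫ e^{-i P·x} ψ(x) dx` of `L²(ℝ^d)`. -/
noncomputable def fourierL2 {d : ℕ} (ψ : L2 (EuclideanSpace ℝ (Fin d))) :
    L2 (EuclideanSpace ℝ (Fin d)) :=
  toL2 fun P => (((2 * Real.pi) ^ (-(d : ℝ) / 2) : ℝ) : ℂ) *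
    (𝓕 ψ : L2 (EuclideanSpace ℝ (Fin d))) ((2 * Real.pi)⁻¹ • P)

/-- The inverse Fourier-Plancherel transform
`χ ↦ (2π)^{-d/2} ∫ e^{i x·P} χ(P) dP` of `L²(ℝ^d)`. -/
noncomputable def fourierInvL2 {d : ℕ} (χ : L2 (EuclideanSpace ℝ (Fin d))) :
    L2 (EuclideanSpace ℝ (Fin d)) :=
  toL2 fun x => (((2 * Real.pi) ^ (-(d : ℝ) / 2) : ℝ) : ℂ) *
    (𝓕⁻ χ : L2 (EuclideanSpace ℝ (Fin d))) ((2 * Real.pi)⁻¹ • x)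

/-! ### The fibre at fixed masses -/

/-- The operator
`ψ ↦ e^{i ∑_j (𝐯·x_j + γ_g + r) m_j} U_{-c} [ψ({R⁻¹(x_k + c 𝐯 - 𝐜)})]`
on the fibre `L²(ℝ^{3N})` at the masses `m`, for the potential `V`. -/
noncomputable def fibreOp {N : ℕ} (V : Config N → ℝ) (γ : Galilei → ℝ) (m : Mass N)
    (r : ℝ) (g : Galilei) (ψ : L2 (Config N)) : L2 (Config N) :=
  toL2 fun x =>
    Complex.exp (Complex.I * ((∑ j, (⟪g.boost, x j⟫ + γ g + r) * m j : ℝ) : ℂ)) *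
      evolution m V (-g.time)
        (toL2 fun y => ψ fun k => rot g.R⁻¹ (y k + g.time • g.boost - g.shift)) x

/-- `m_k + m_{k+1} + ⋯ + m_{N-1}` (particles are numbered from `0`). -/
noncomputable def tailMass {N : ℕ} (m : Mass N) (k : ℕ) : ℝ :=
  ∑ j : Fin N, if k ≤ (j : ℕ) then m j else 0

/-- The centre of mass of the particles with index at least `k`. -/
noncomputable def tailCentre {N : ℕ} (m : Mass N) (k : ℕ) (x : Config N) : E3 :=
  (tailMass m k)⁻¹ • ∑ j : Fin N, if k ≤ (j : ℕ) then m j • x j else 0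

/-- A particle index below the last one. -/
def idx {N : ℕ} (k : Fin (N - 1)) : Fin N := ⟨k, by omega⟩

/-- The Jacobi coordinates `y_k`: the position of particle `k` relative to the centre of mass of
the particles that follow it. -/
noncomputable def jacobi {N : ℕ} (m : Mass N) (x : Config N) : Config (N - 1) :=
  fun k => x (idx k) - tailCentre m (k + 1) x

/-- The reduced masses `μ_k` of the Jacobi coordinates. -/
noncomputable def reducedMass {N : ℕ} (m : Mass N) (k : Fin (N - 1)) : ℝ :=
  m (idx k) * tailMass m (k + 1) / (m (idx k) + tailMass m (k + 1))

/-- The operator `Z_g^{(M)}` of the centre of mass; it is given in momentum picture by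
`χ(P) ↦ e^{i(c𝐯 - 𝐜)·(P - M𝐯)} e^{i (c/2M)(P - M𝐯)² + i M γ_g} χ(R⁻¹(P - M𝐯))`. -/
noncomputable def centreOp (γ : Galilei → ℝ) (M : ℝ) (g : Galilei) (a : L2 E3) : L2 E3 :=
  fourierInvL2 <| toL2 fun P =>
    Complex.exp (Complex.I * ((⟪g.time • g.boost - g.shift, P - M • g.boost⟫ : ℝ) : ℂ)) *
    Complex.exp (Complex.I *
      ((g.time / (2 * M) * ‖P - M • g.boost‖ ^ 2 + M * γ g : ℝ) : ℂ)) *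
    fourierL2 a (rot g.R⁻¹ (P - M • g.boost))

/-- The operator `T_{(c,R)}` of time translations and rotations on the internal orbital degrees
of freedom; `v` is the potential in Jacobi coordinates. -/
noncomputable def internalOp {N : ℕ} (m : Mass N) (v : Config (N - 1) → ℝ) (c : ℝ) (R : SO3)
    (b : L2 (Config (N - 1))) : L2 (Config (N - 1)) :=
  evolution (reducedMass m) v (-c) (toL2 fun y => b fun k => rot R⁻¹ (y k))

/-! ### The extended Hilbert space -/

/-- The extended Hilbert space `L²(ℝ^N × ℝ^{3N})`, of functions of masses (or `ζ`-variables) and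
positions. -/
abbrev ExtendedSpace (N : ℕ) : Type := L2 (Mass N × Config N)

/-- The component at the masses `m` of an element of the direct integral
`L²(ℝ^N × ℝ^{3N}) ≃ ∫^⊕ L²(ℝ^{3N}) d^N m`. -/
noncomputable def fibre {N : ℕ} (Ψ : ExtendedSpace N) (m : Mass N) : L2 (Config N) :=
  toL2 fun x => Ψ (m, x)

/-- `A` is the decomposable operator `∫^⊕ W_m d^N m`. -/
def IsDirectIntegral {N : ℕ} (W : Mass N → L2 (Config N) → L2 (Config N))
    (A : ExtendedSpace N → ExtendedSpace N) : Prop :=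
  ∀ Ψ : ExtendedSpace N, ∀ᵐ m : Mass N, fibre (A Ψ) m = W m (fibre Ψ m)

/-- `Z` is the passage from the mass picture to the `ζ`-picture,
`(Z Ψ)(ζ, x) = (2π)^{-N/2} ∫ e^{i ∑_k m_k ζ_k} Ψ(m, x) d^N m`, as a Fourier-Plancherel transform
in the variables `m` for almost all `x`. -/
def IsZetaPicture {N : ℕ} (Z : ExtendedSpace N → ExtendedSpace N) : Prop :=
  ∀ Ψ : ExtendedSpace N, ∀ᵐ x : Config N,
    (toL2 fun ζ : Mass N => Z Ψ (ζ, x)) = fourierInvL2 (toL2 fun m : Mass N => Ψ (m, x))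

/-- The classical map `F̌_{(r,g)}`,
`(t, ζ, x) ↦ (t + c, ζ_k + φ_{g⁻¹}(t, x_k) - r - ξ(g⁻¹, g), 𝐜 + t 𝐯 + R x_k)`. -/
noncomputable def classicalMap {N : ℕ} {γ : Galilei → ℝ} (ρ : Ext γ)
    (w : ℝ × Mass N × Config N) : ℝ × Mass N × Config N :=
  (w.1 + ρ.g.time,
    WithLp.toLp 2 fun k => w.2.1 k + phase γ ρ.g⁻¹ (w.1, w.2.2 k) - ρ.r - xi γ ρ.g⁻¹ ρ.g,
    fun k => (ρ.g.act (w.1, w.2.2 k)).2)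

end GalileiMass

open GalileiMass

namespace GalileiMass

/-! ### Self-adjoint operators and their unitary groups -/

section Stone

open Filter Topology

variable {E : Type*} [NormedAddCommGroup E] [InnerProductSpace ℂ E]

/-! Everything is decided at fixed masses. Write G(r,g,t) for the operator `galOp`, which sends ψ to
e^{i∑ m_j(φ_g(t,x_j)+r)} ψ(g⁻¹(t,x_k)), and c, c' for the time parts of g, g'. Two facts carry the
proposition. Multiplying the cocycle identity `phase_central` by m_j and summing gives G(r',g',t)
G(r,g,t-c') = G(r+r'+ξ(g',g),g'g,t) (`galOp_mul`). Galilean covariance of the dynamics is U_t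
G(r,g,0) = G(r,g,t) U_t (`evolution_galOp`). The fibre operator equals G(r,g,0) U_{-c}
(`fibreOp_eq`), so the two facts yield the multiplication law, hence the projective law with
multiplier e^{iMξ}. They also yield U_t U_{(r,g)} = G(r,g,t) U_{t-c}, which is (ii) before the
Fourier transform in the masses.

Covariance is proved by uniqueness. A one-parameter unitary group with derivative -iHf on every test
function f is the evolution (`eq_evolution`). Conjugating U_t by a rigid motion leaves this
derivative unchanged because V is invariant (`evolution_moveOp`). For a boost one conjugates U_t
combined with a translation by t𝐯 and a scalar phase. The terms linear in the gradient cancel, and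
so do the constants, provided that no mass vanishes (`evolution_boostOp`).

To integrate over the masses, U_t(m) must depend measurably on m. Stone's theorem is therefore
proved by Yosida approximation, which exhibits U_t(m) as a strong limit of exponentials of
resolvents (`tendsto_yosidaGroup`). Resolvents are measurable because one countable family of test
functions is a core for all admissible masses simultaneously (`schrodingerGraph_subset_closure`,
`dist_resolv_lt_iff`). The identification of L²(α×β) with L²(α;L²(β)) then produces the decomposable
operators.

For the factorisation Z ⊗ T, the rows of the Jacobi matrix are orthogonal for the form ∑ 1/m_k
(`sum_jacobiCoeff`), so the kinetic energy splits without cross terms. Product states of a free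
packet and an internal solution lie in the graph of H, which by self-adjointness need only be tested
weakly against test functions (`tens_mem_graph`). Uniqueness for the Schrödinger equation and
density finish the argument (`evolution_tens`).

For (ii), at fixed positions G(r,g,t) multiplies by a character e^{i m·α} in the masses. The inverse
Fourier transform turns it into the translation ζ ↦ ζ + α, which is the ζ-component of the classical
map of (-r-ξ(g⁻¹,g), g⁻¹). -/

theorem norm_sub_le_of_norm_deriv_eq {f f' : ℝ → E} {C : ℝ}
    (hf : ∀ t, HasDerivAt f (f' t) t) (hC : ∀ t, ‖f' t‖ ≤ C) (s t : ℝ) :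
    ‖f t - f s‖ ≤ C * |t - s| := by
  have := convex_univ.norm_image_sub_le_of_norm_hasDerivWithin_le (f := f) (f' := f') (C := C)
    (x := s) (y := t) (fun x _ => (hf x).hasDerivWithinAt) (fun x _ => hC x) trivial trivial
  simpa using this

/-- A strongly differentiable orbit of a one-parameter group is differentiable at all times. -/
theorem hasDerivAt_group {U : ℝ → (E ≃ₗᵢ[ℂ] E)} (hU : ∀ s t : ℝ, U (s + t) = U s * U t)
    {ψ χ : E} (h : HasDerivAt (fun t => U t ψ) χ 0) (t : ℝ) :
    HasDerivAt (fun t => U t ψ) (U t χ) t := by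
  have h1 : HasDerivAt (fun s => U t (U (s - t) ψ)) (U t χ) t := by
    have h2 : HasDerivAt (fun s => U (s - t) ψ) χ t := by
      have h3 : HasDerivAt (fun t => U t ψ) χ (t - t) := by simpa using h
      simpa using HasDerivAt.comp_sub_const t t h3
    have h4 := ((U t).toContinuousLinearEquiv.toContinuousLinearMap.restrictScalars ℝ).hasFDerivAt.comp_hasDerivAt t h2
    exact h4
  refine h1.congr_of_eventuallyEq (Eventually.of_forall fun s => ?_)
  have := hU t (s - t)
  simp only [add_sub_cancel] at this
  simp [this]

theorem group_zero {U : ℝ → (E ≃ₗᵢ[ℂ] E)} (hU : ∀ s t : ℝ, U (s + t) = U s * U t) : U 0 = 1 := by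
  have := hU 0 0
  simp only [add_zero] at this
  exact (left_eq_mul).1 this

theorem group_neg {U : ℝ → (E ≃ₗᵢ[ℂ] E)} (hU : ∀ s t : ℝ, U (s + t) = U s * U t) (t : ℝ) (ψ : E) :
    U (-t) (U t ψ) = ψ := by
  have := hU (-t) t
  rw [neg_add_cancel, group_zero hU] at this
  exact (DFunLike.congr_fun this ψ).symm

/-- The orbit has derivative U_t χ, of constant norm ‖χ‖. This Lipschitz bound drives both the
closedness of the generator and strong continuity. -/
theorem norm_group_sub_le {U : ℝ → (E ≃ₗᵢ[ℂ] E)} (hU : ∀ s t : ℝ, U (s + t) = U s * U t)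
    {ψ χ : E} (h : HasDerivAt (fun t => U t ψ) χ 0) (s t : ℝ) :
    ‖U t ψ - U s ψ‖ ≤ ‖χ‖ * |t - s| :=
  norm_sub_le_of_norm_deriv_eq (hasDerivAt_group hU h) (fun t => ((U t).norm_map χ).le) s t

/-- The generator of a one-parameter group of isometries is closed. -/
theorem hasDerivAt_group_of_tendsto {U : ℝ → (E ≃ₗᵢ[ℂ] E)}
    (hU : ∀ s t : ℝ, U (s + t) = U s * U t) {G : Set (E × E)}
    (hG : ∀ p ∈ G, ∀ q ∈ G, p - q ∈ G)
    (h : ∀ p ∈ G, HasDerivAt (fun t => U t p.1) p.2 0) {p : E × E} (hp : p ∈ closure G) :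
    HasDerivAt (fun t => U t p.1) p.2 0 := by
  obtain ⟨u, hu, hlim⟩ := mem_closure_iff_seq_limit.1 hp
  have hlim1 : Tendsto (fun n => (u n).1) atTop (𝓝 p.1) := (continuous_fst.tendsto _).comp hlim
  have hlim2 : Tendsto (fun n => (u n).2) atTop (𝓝 p.2) := (continuous_snd.tendsto _).comp hlim
  -- The Lipschitz bound is applied to the differences u_k - u_n and then k → ∞. The resulting
  -- estimate is linear in t, so it survives division by t.
  have hb : ∀ n t, ‖(U t p.1 - p.1) - (U t (u n).1 - (u n).1)‖ ≤ ‖p.2 - (u n).2‖ * |t| := by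
    intro n t
    have h1 : ∀ k, ‖(U t (u k).1 - (u k).1) - (U t (u n).1 - (u n).1)‖
        ≤ ‖(u k).2 - (u n).2‖ * |t| := by
      intro k
      have h2 := norm_group_sub_le hU (h _ (hG _ (hu k) _ (hu n))) 0 t
      simp only [group_zero hU, Prod.fst_sub, Prod.snd_sub, map_sub, sub_zero,
        LinearIsometryEquiv.coe_one, id] at h2
      refine le_trans (le_of_eq ?_) h2
      congr 1
      abel
    refine le_of_tendsto_of_tendsto' (b := atTop) ?_ ?_ h1
    · exact (((((U t).continuous.tendsto _).comp hlim1).sub hlim1).sub_const _).norm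
    · exact ((hlim2.sub_const _).norm).mul_const _
  rw [hasDerivAt_iff_isLittleO, Asymptotics.isLittleO_iff]
  intro ε hε
  obtain ⟨n, hn⟩ : ∃ n, ‖p.2 - (u n).2‖ < ε / 3 := by
    have : Tendsto (fun n => ‖p.2 - (u n).2‖) atTop (𝓝 0) := by
      simpa using (hlim2.const_sub p.2).norm
    exact (this.eventually (gt_mem_nhds (by positivity))).exists
  have h1 := h _ (hu n)
  rw [hasDerivAt_iff_isLittleO, Asymptotics.isLittleO_iff] at h1
  filter_upwards [h1 (c := ε / 3) (by positivity)] with t ht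
  simp only [group_zero hU, sub_zero, LinearIsometryEquiv.coe_one, id] at ht ⊢
  have e : U t p.1 - p.1 - t • p.2 = ((U t p.1 - p.1) - (U t (u n).1 - (u n).1))
      + (U t (u n).1 - (u n).1 - t • (u n).2) - t • (p.2 - (u n).2) := by
    rw [smul_sub]; abel
  rw [e]
  have h3 := hb n t
  have h4 : ‖t • (p.2 - (u n).2)‖ = ‖p.2 - (u n).2‖ * |t| := by
    rw [norm_smul, Real.norm_eq_abs, mul_comm]
  have h5 := norm_sub_le ((U t p.1 - p.1) - (U t (u n).1 - (u n).1)
      + (U t (u n).1 - (u n).1 - t • (u n).2)) (t • (p.2 - (u n).2))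
  have h6 := norm_add_le ((U t p.1 - p.1) - (U t (u n).1 - (u n).1))
    (U t (u n).1 - (u n).1 - t • (u n).2)
  have h7 : ‖p.2 - (u n).2‖ * |t| ≤ ε / 3 * |t| := by gcongr
  rw [Real.norm_eq_abs] at *
  linarith

/-- Isometries make the approximation of ψ by elements of `D` uniform in t, and a uniform limit of
Lipschitz orbits is continuous. -/
theorem continuous_orbit {U : ℝ → (E ≃ₗᵢ[ℂ] E)} {D : Set E} (hD : Dense D)
    (h : ∀ ψ ∈ D, ∃ C, ∀ s t : ℝ, ‖U t ψ - U s ψ‖ ≤ C * |t - s|) (ψ : E) :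
    Continuous fun t => U t ψ := by
  refine continuous_of_uniform_approx_of_continuous fun u hu => ?_
  obtain ⟨ε, hε, hu⟩ := Metric.mem_uniformity_dist.1 hu
  obtain ⟨φ, hφD, hφ⟩ := hD.exists_dist_lt ψ hε
  obtain ⟨C, hC⟩ := h φ hφD
  refine ⟨fun t => U t φ, ?_, fun t => hu ?_⟩
  · have : LipschitzWith (Real.toNNReal C) fun t => U t φ := by
      refine LipschitzWith.of_dist_le_mul fun s t => ?_
      rw [dist_eq_norm, Real.dist_eq]
      refine (hC t s).trans ?_
      gcongr
      exact Real.le_coe_toNNReal C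
    exact this.continuous
  · rwa [(U t).dist_map]

variable [CompleteSpace E] {A : E →ₗ.[ℂ] E}

/-- This is A = A* read on graphs. It makes membership in the graph a weak condition, the form in
which domains are recognised below. -/
theorem mem_graph_iff_inner (hA : IsSelfAdjoint A) (ψ χ : E) :
    (ψ, χ) ∈ A.graph ↔ ∀ φ η, (φ, η) ∈ A.graph → inner ℂ η ψ = inner ℂ φ χ := by
  conv_lhs => rw [← (LinearPMap.isSelfAdjoint_def.1 hA),
    LinearPMap.adjoint_graph_eq_graph_adjoint hA.dense_domain, Submodule.mem_adjoint_iff]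
  simp only [sub_eq_zero]

theorem inner_graph (hA : IsSelfAdjoint A) {ψ χ φ η : E} (h : (ψ, χ) ∈ A.graph)
    (h' : (φ, η) ∈ A.graph) : inner ℂ η ψ = inner ℂ φ χ :=
  (mem_graph_iff_inner hA ψ χ).1 h φ η h'

theorem dense_graph_fst (hA : IsSelfAdjoint A) : Dense {ψ : E | ∃ χ, (ψ, χ) ∈ A.graph} := by
  refine hA.dense_domain.mono fun ψ hψ => ?_
  exact ⟨A ⟨ψ, hψ⟩, (A.mem_graph_iff).2 ⟨⟨ψ, hψ⟩, rfl, rfl⟩⟩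

/-- A one-parameter unitary group whose generator extends `-iA` on a core of the self-adjoint
operator `A` is the one generated by `A`. -/
theorem isUnitaryGroupOf_of_core (hA : IsSelfAdjoint A) {U : ℝ → (E ≃ₗᵢ[ℂ] E)}
    (hU : ∀ s t : ℝ, U (s + t) = U s * U t) {G : Submodule ℂ (E × E)}
    (hG : (A.graph : Set (E × E)) ⊆ closure (G : Set (E × E)))
    (h : ∀ ψ χ, (ψ, χ) ∈ G → HasDerivAt (fun t => U t ψ) (-Complex.I • χ) 0) :
    IsUnitaryGroupOf A U := by
  have hgen : ∀ ψ χ, (ψ, χ) ∈ A.graph → HasDerivAt (fun t => U t ψ) (-Complex.I • χ) 0 := by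
    intro ψ χ hψ
    let L : E × E → E × E := fun p => (p.1, -Complex.I • p.2)
    have hL : Continuous L := by fun_prop
    refine hasDerivAt_group_of_tendsto hU (G := L '' (G : Set (E × E))) ?_ ?_
      (p := (ψ, -Complex.I • χ)) ?_
    · rintro _ ⟨p, hp, rfl⟩ _ ⟨q, hq, rfl⟩
      exact ⟨p - q, G.sub_mem hp hq, by simp [L, smul_sub, neg_add_eq_sub]⟩
    · rintro _ ⟨p, hp, rfl⟩
      exact h _ _ hp
    · exact image_closure_subset_closure_image hL ⟨(ψ, χ), hG hψ, rfl⟩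
  refine ⟨hU, continuous_orbit (dense_graph_fst hA) fun ψ ⟨χ, hψ⟩ =>
    ⟨_, norm_group_sub_le hU (hgen ψ χ hψ)⟩, fun ψ χ => ⟨hgen ψ χ, fun hd => ?_⟩⟩
  -- For the converse inclusion, the inner product of two orbits is constant. Its derivative at 0
  -- shows that any generator pair (ψ, χ) is adjoint to all pairs of A, hence lies in the graph of
  -- A* = A.
  rw [mem_graph_iff_inner hA]
  intro φ η hφ
  have h1 := (hgen φ η hφ).inner ℂ hd
  simp only [LinearIsometryEquiv.inner_map_map] at h1
  have h2 := h1.unique (hasDerivAt_const _ _)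
  simp only [group_zero hU, LinearIsometryEquiv.coe_one, id, inner_smul_right, inner_smul_left,
    map_neg, Complex.conj_I, neg_neg] at h2
  have h3 : Complex.I * (inner ℂ η ψ - inner ℂ φ χ) = 0 := by linear_combination h2
  simpa [sub_eq_zero] using h3

omit [CompleteSpace E] in
theorem IsUnitaryGroupOf.graph_map {U : ℝ → (E ≃ₗᵢ[ℂ] E)} (hU : IsUnitaryGroupOf A U)
    {ψ χ : E} (h : (ψ, χ) ∈ A.graph) (s : ℝ) : (U s ψ, U s χ) ∈ A.graph := by
  rw [hU.2.2]
  have h1 := hasDerivAt_group hU.1 ((hU.2.2 _ _).1 h) s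
  have h2 : HasDerivAt (fun t => U (t + s) ψ) (U s (-Complex.I • χ)) 0 :=
    HasDerivAt.comp_add_const 0 s (by rw [zero_add]; exact h1)
  rw [map_smul] at h2
  simpa [hU.1] using h2

/-- Uniqueness of the solutions of the Schrödinger equation. -/
theorem IsUnitaryGroupOf.eq_of_hasDerivAt (hA : IsSelfAdjoint A) {U : ℝ → (E ≃ₗᵢ[ℂ] E)}
    (hU : IsUnitaryGroupOf A U) {Φ η : ℝ → E}
    (hΦ : ∀ t, HasDerivAt Φ (-Complex.I • η t) t) (hη : ∀ t, (Φ t, η t) ∈ A.graph) (t : ℝ) :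
    Φ t = U t (Φ 0) := by
  set D : ℝ → E := fun t => Φ t - U t (Φ 0)
  have hD : ∀ t, HasDerivAt D (-Complex.I • (η t - U t (η 0))) t := by
    intro t
    have h2 := hasDerivAt_group hU.1 ((hU.2.2 _ _).1 (hη 0)) t
    have h3 := (hΦ t).sub h2
    rw [map_smul, ← smul_sub] at h3
    exact h3
  have hg : ∀ t, (D t, η t - U t (η 0)) ∈ A.graph := fun t =>
    A.graph.sub_mem (hη t) (hU.graph_map (hη 0) t)
  -- The difference of the two solutions again solves the equation inside the graph. By symmetry of
  -- A its squared norm is constant, and it vanishes at time 0.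
  have h0 : ∀ t, HasDerivAt (fun t => inner ℂ (D t) (D t)) 0 t := by
    intro t
    have h1 := (hD t).inner ℂ (hD t)
    have e : inner ℂ (D t) (-Complex.I • (η t - U t (η 0)))
        + inner ℂ (-Complex.I • (η t - U t (η 0))) (D t) = 0 := by
      rw [inner_smul_right, inner_smul_left, inner_graph hA (hg t) (hg t), map_neg,
        Complex.conj_I]
      ring
    rw [e] at h1
    exact h1
  have h1 : inner ℂ (D t) (D t) = inner ℂ (D 0) (D 0) :=
    is_const_of_deriv_eq_zero (fun t => (h0 t).differentiableAt) (fun t => (h0 t).deriv) t 0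
  have h2 : D 0 = 0 := by simp [D, group_zero hU.1]
  rw [h2, inner_zero_left, inner_self_eq_zero] at h1
  exact sub_eq_zero.1 h1

/-- On the dense domain both orbits solve the same Schrödinger equation; continuity of the unitaries
extends the equality. -/
theorem IsUnitaryGroupOf.unique (hA : IsSelfAdjoint A) {U U' : ℝ → (E ≃ₗᵢ[ℂ] E)}
    (hU : IsUnitaryGroupOf A U) (hU' : IsUnitaryGroupOf A U') : U' = U := by
  funext t
  refine LinearIsometryEquiv.ext fun ψ => ?_
  have hset : {ψ : E | ∃ χ, (ψ, χ) ∈ A.graph} ⊆ {ψ | U' t ψ = U t ψ} := by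
    rintro ψ ⟨χ, h⟩
    have := hU.eq_of_hasDerivAt hA (Φ := fun t => U' t ψ) (η := fun t => U' t χ)
      (fun t => by
        rw [← map_smul]
        exact hasDerivAt_group hU'.1 ((hU'.2.2 _ _).1 h) t) (fun t => hU'.graph_map h t) t
    simpa [group_zero hU'.1] using this
  have hcl : IsClosed {ψ | U' t ψ = U t ψ} := isClosed_eq (U' t).continuous (U t).continuous
  exact closure_minimal hset hcl (dense_graph_fst hA ψ)

/-! ### Resolvents -/

/-- Symmetry makes ⟨Aφ, φ⟩ real, so the cross term of the expanded square, being the real part of an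
imaginary number, vanishes. -/
theorem norm_sq_graph (hA : IsSelfAdjoint A) {φ η : E} (h : (φ, η) ∈ A.graph) (l : ℝ) :
    ‖η + (Complex.I * l) • φ‖ ^ 2 = ‖η‖ ^ 2 + l ^ 2 * ‖φ‖ ^ 2 := by
  have hs := inner_graph hA h h
  rw [@norm_add_sq ℂ, inner_smul_right, norm_smul, mul_pow]
  have him : (inner ℂ η φ).im = 0 := by
    have := inner_conj_symm (𝕜 := ℂ) η φ
    rw [← hs] at this
    exact Complex.conj_eq_iff_im.1 this
  simp [him]

/-- The map `(φ, Aφ) ↦ (A + il) φ` on the graph of `A`. -/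
noncomputable def graphShift (A : E →ₗ.[ℂ] E) (l : ℝ) : A.graph →L[ℂ] E :=
  (ContinuousLinearMap.snd ℂ E E + (Complex.I * l) • ContinuousLinearMap.fst ℂ E E).comp
    A.graph.subtypeL

omit [CompleteSpace E] in
theorem graphShift_apply (l : ℝ) (p : A.graph) :
    graphShift A l p = p.1.2 + (Complex.I * l) • p.1.1 := by
  simp [graphShift]

/-- The range is closed, because A + il is bounded below on the complete graph. A vector y
orthogonal to it satisfies Ay = ily by self-adjointness; orthogonality to (A + il)y = 2ily then
forces y = 0. -/
theorem range_graphShift (hA : IsSelfAdjoint A) {l : ℝ} (hl : l ≠ 0) :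
    LinearMap.range (graphShift A l).toLinearMap = ⊤ := by
  have hl' : 0 < |l| := abs_pos.2 hl
  have : CompleteSpace A.graph := hA.isClosed.completeSpace_coe
  have hb : ∀ p : A.graph, ‖p‖ ≤ (max 1 |l|⁻¹ : ℝ) * ‖graphShift A l p‖ := by
    rintro ⟨⟨φ, η⟩, hp⟩
    have h1 := norm_sq_graph hA hp l
    rw [graphShift_apply]
    set c := ‖η + (Complex.I * l) • φ‖
    have h2 : ‖η‖ ≤ c := by
      refine (sq_le_sq₀ (norm_nonneg _) (norm_nonneg _)).1 ?_
      rw [h1]; nlinarith [sq_nonneg (l * ‖φ‖)]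
    have h3 : |l| * ‖φ‖ ≤ c := by
      refine (sq_le_sq₀ (by positivity) (norm_nonneg _)).1 ?_
      rw [h1, mul_pow, sq_abs]; nlinarith [sq_nonneg ‖η‖]
    have h4 : ‖φ‖ ≤ |l|⁻¹ * c := by
      rw [inv_mul_eq_div, le_div_iff₀ hl']; linarith
    change max ‖φ‖ ‖η‖ ≤ _
    refine max_le (h4.trans ?_) (h2.trans ?_)
    · exact mul_le_mul_of_nonneg_right (le_max_right _ _) (norm_nonneg _)
    · exact le_mul_of_one_le_left (norm_nonneg _) (le_max_left _ _)
  have hanti : AntilipschitzWith (Real.toNNReal (max 1 |l|⁻¹)) (graphShift A l) :=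
    ContinuousLinearMap.antilipschitz_of_bound _ fun p => by
      rw [Real.coe_toNNReal _ (by positivity)]; exact hb p
  have hcl : IsClosed (LinearMap.range (graphShift A l).toLinearMap : Set E) := by
    exact hanti.isClosed_range (graphShift A l).uniformContinuous
  rw [← hcl.submodule_topologicalClosure_eq, Submodule.topologicalClosure_eq_top_iff,
    Submodule.eq_bot_iff]
  intro y hy
  rw [Submodule.mem_orthogonal] at hy
  have hg : (y, (Complex.I * l) • y) ∈ A.graph := by
    rw [mem_graph_iff_inner hA]
    intro φ η hφ
    have h1 := hy _ ⟨⟨(φ, η), hφ⟩, rfl⟩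
    change inner ℂ (graphShift A l ⟨(φ, η), hφ⟩) y = 0 at h1
    rw [graphShift_apply, inner_add_left, inner_smul_left] at h1
    rw [inner_smul_right]
    simp only [map_mul, Complex.conj_I, Complex.conj_ofReal] at h1
    linear_combination h1
  have h2 := hy _ ⟨⟨_, hg⟩, rfl⟩
  change inner ℂ (graphShift A l ⟨(y, (Complex.I * l) • y), hg⟩) y = 0 at h2
  rw [graphShift_apply, ← two_smul ℂ, inner_smul_left, inner_smul_left] at h2
  simpa [hl] using h2

theorem norm_le_of_mem_graph (hA : IsSelfAdjoint A) {l : ℝ} (hl : l ≠ 0) {φ η : E}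
    (h : (φ, η) ∈ A.graph) : ‖φ‖ ≤ |l|⁻¹ * ‖η + (Complex.I * l) • φ‖ := by
  have h1 := norm_sq_graph hA h l
  have h3 : |l| * ‖φ‖ ≤ ‖η + (Complex.I * l) • φ‖ := by
    refine (sq_le_sq₀ (by positivity) (norm_nonneg _)).1 ?_
    rw [h1, mul_pow, sq_abs]; nlinarith [sq_nonneg ‖η‖]
  rw [inv_mul_eq_div, le_div_iff₀ (abs_pos.2 hl)]; linarith

theorem exists_resolvent (hA : IsSelfAdjoint A) {l : ℝ} (hl : l ≠ 0) :
    ∃ R : E →L[ℂ] E, ∀ ψ, (R ψ, ψ - (Complex.I * l) • R ψ) ∈ A.graph := by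
  have hsurj : ∀ ψ, ∃ φ, (φ, ψ - (Complex.I * l) • φ) ∈ A.graph := by
    intro ψ
    have : ψ ∈ LinearMap.range (graphShift A l).toLinearMap := by
      rw [range_graphShift hA hl]; trivial
    obtain ⟨⟨⟨φ, η⟩, hp⟩, h⟩ := this
    change graphShift A l _ = ψ at h
    rw [graphShift_apply] at h
    refine ⟨φ, ?_⟩
    rw [← h]
    simpa using hp
  choose R hR using hsurj
  -- Injectivity of A + il identifies the arbitrary preimages chosen above, and is what makes `R`
  -- linear.
  have huniq : ∀ φ η, (φ, η) ∈ A.graph → ∀ ψ, η + (Complex.I * l) • φ = ψ → φ = R ψ := by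
    rintro φ η h ψ rfl
    have h1 := norm_le_of_mem_graph hA hl (A.graph.sub_mem h (hR (η + (Complex.I * l) • φ)))
    have h2 : η - (η + (Complex.I * l) • φ - (Complex.I * l) • R (η + (Complex.I * l) • φ)) +
      (Complex.I * l) • (φ - R (η + (Complex.I * l) • φ)) = 0 := by
      rw [smul_sub]; abel
    rw [h2, norm_zero, mul_zero, norm_le_zero_iff] at h1
    exact sub_eq_zero.1 h1
  let Rl : E →ₗ[ℂ] E :=
    { toFun := R
      map_add' := fun x y => (huniq _ _ (A.graph.add_mem (hR x) (hR y)) _ (by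
        dsimp only; rw [smul_add]; abel)).symm
      map_smul' := fun c x => (huniq _ _ (A.graph.smul_mem c (hR x)) _ (by
        dsimp only; rw [smul_sub, smul_comm c]; simp)).symm }
  refine ⟨Rl.mkContinuous |l|⁻¹ fun ψ => ?_, fun ψ => hR ψ⟩
  simpa using! norm_le_of_mem_graph hA hl (hR ψ)

open Classical in
/-- The resolvent `(A + il)⁻¹` of a self-adjoint operator. -/
noncomputable def resolv (A : E →ₗ.[ℂ] E) (l : ℝ) : E →L[ℂ] E :=
  if h : ∃ R : E →L[ℂ] E, ∀ ψ, (R ψ, ψ - (Complex.I * l) • R ψ) ∈ A.graph then h.choose else 0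

theorem resolv_mem (hA : IsSelfAdjoint A) {l : ℝ} (hl : l ≠ 0) (ψ : E) :
    (resolv A l ψ, ψ - (Complex.I * l) • resolv A l ψ) ∈ A.graph := by
  have h := exists_resolvent hA hl
  rw [resolv, dif_pos h]
  exact h.choose_spec ψ

theorem resolv_eq (hA : IsSelfAdjoint A) {l : ℝ} (hl : l ≠ 0) {φ η : E} (h : (φ, η) ∈ A.graph) :
    resolv A l (η + (Complex.I * l) • φ) = φ := by
  have h1 := norm_le_of_mem_graph hA hl
    (A.graph.sub_mem h (resolv_mem hA hl (η + (Complex.I * l) • φ)))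
  have h2 : η - (η + (Complex.I * l) • φ - (Complex.I * l) • resolv A l (η + (Complex.I * l) • φ)) +
    (Complex.I * l) • (φ - resolv A l (η + (Complex.I * l) • φ)) = 0 := by
    rw [smul_sub]; abel
  rw [h2, norm_zero, mul_zero, norm_le_zero_iff] at h1
  exact (sub_eq_zero.1 h1).symm

theorem norm_resolv_le (hA : IsSelfAdjoint A) {l : ℝ} (hl : l ≠ 0) (ψ : E) :
    ‖resolv A l ψ‖ ≤ |l|⁻¹ * ‖ψ‖ := by
  simpa using norm_le_of_mem_graph hA hl (resolv_mem hA hl ψ)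

theorem inner_resolv (hA : IsSelfAdjoint A) {l : ℝ} (hl : l ≠ 0) (ψ χ : E) :
    inner ℂ (resolv A l ψ) χ = inner ℂ ψ (resolv A (-l) χ) := by
  have h := inner_graph hA (resolv_mem hA (neg_ne_zero.2 hl) χ) (resolv_mem hA hl ψ)
  simp only [inner_sub_left, inner_sub_right, inner_smul_left, inner_smul_right, map_mul,
    Complex.conj_I, Complex.conj_ofReal, Complex.ofReal_neg] at h
  linear_combination -h

theorem resolv_sub (hA : IsSelfAdjoint A) {l k : ℝ} (hl : l ≠ 0) (hk : k ≠ 0) (ψ : E) :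
    resolv A l ψ + (Complex.I * (l - k)) • resolv A l (resolv A k ψ) = resolv A k ψ := by
  have h := resolv_eq hA hl (resolv_mem hA hk ψ)
  rw [map_add, map_sub, map_smul, map_smul] at h
  linear_combination (norm := module) h

/-- Adding the resolvent identity to the one with l and k exchanged leaves a nonzero multiple of the
commutator. -/
theorem resolv_comm (hA : IsSelfAdjoint A) {l k : ℝ} (hl : l ≠ 0) (hk : k ≠ 0) :
    Commute (resolv A l) (resolv A k) := by
  rcases eq_or_ne l k with rfl | hne
  · exact Commute.refl _
  ext ψ
  have h1 := resolv_sub hA hl hk ψ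
  have h2 := resolv_sub hA hk hl ψ
  have h3 : (Complex.I * (l - k)) • (resolv A l (resolv A k ψ) - resolv A k (resolv A l ψ)) = 0 := by
    linear_combination (norm := module) h1 + h2
  have h4 : (Complex.I * ((l : ℂ) - k)) ≠ 0 :=
    mul_ne_zero Complex.I_ne_zero (sub_ne_zero.2 (by exact_mod_cast hne))
  exact sub_eq_zero.1 ((smul_eq_zero.1 h3).resolve_left h4)

/-! ### Yosida approximation and Stone's theorem -/

/-- The bounded approximations `l² A (A² + l²)⁻¹` of a self-adjoint operator, for `l = n + 1`. -/
noncomputable def yosida (A : E →ₗ.[ℂ] E) (n : ℕ) : E →L[ℂ] E :=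
  (((n : ℂ) + 1) ^ 2 / 2) • (resolv A (n + 1) + resolv A (-(n + 1)))

theorem isSelfAdjoint_yosida (hA : IsSelfAdjoint A) (n : ℕ) : IsSelfAdjoint (yosida A n) := by
  have hn : (n + 1 : ℝ) ≠ 0 := by positivity
  rw [ContinuousLinearMap.isSelfAdjoint_iff_isSymmetric]
  intro ψ χ
  have h1 := inner_resolv hA hn ψ χ
  have h2 := inner_resolv hA (neg_ne_zero.2 hn) ψ χ
  rw [neg_neg] at h2
  simp only [yosida, ContinuousLinearMap.coe_coe, smul_apply,
    add_apply, inner_smul_left, inner_smul_right, inner_add_left,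
    inner_add_right, h1, h2, map_div₀, map_pow, map_add, map_one, Complex.conj_natCast,
    Complex.conj_ofNat]
  ring

theorem yosida_comm (hA : IsSelfAdjoint A) (n k : ℕ) : Commute (yosida A n) (yosida A k) := by
  have hn : (n + 1 : ℝ) ≠ 0 := by positivity
  have hk : (k + 1 : ℝ) ≠ 0 := by positivity
  refine ((Commute.add_left ?_ ?_).smul_left _).smul_right _ <;>
    exact (resolv_comm hA (by simpa [-neg_add_rev] using hn) (by simpa using hk)).add_right
      (resolv_comm hA (by simpa [-neg_add_rev] using hn) (neg_ne_zero.2 hk))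

/-- On the domain, il R(l)φ = φ - R(l)Aφ, and the last term is at most ‖Aφ‖/|l|. The operators il
R(l) are contractions, so the limit extends from the dense domain to every vector. -/
theorem tendsto_resolv (hA : IsSelfAdjoint A) {l : ℕ → ℝ} (hl : ∀ n, l n ≠ 0)
    (hlim : Tendsto (fun n => |l n|⁻¹) atTop (𝓝 0)) (χ : E) :
    Tendsto (fun n => (Complex.I * l n) • resolv A (l n) χ) atTop (𝓝 χ) := by
  rw [Metric.tendsto_atTop]
  intro ε hε
  obtain ⟨φ, ⟨η, hφ⟩, hd⟩ := (dense_graph_fst hA).exists_dist_lt χ (ε := ε / 3) (by positivity)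
  have h1 : Tendsto (fun n => |l n|⁻¹ * ‖η‖) atTop (𝓝 0) := by simpa using hlim.mul_const ‖η‖
  obtain ⟨K, hK⟩ := eventually_atTop.1 (h1.eventually (gt_mem_nhds (show 0 < ε / 3 by positivity)))
  refine ⟨K, fun n hn => ?_⟩
  have e : (Complex.I * l n) • resolv A (l n) φ = φ - resolv A (l n) η := by
    have := resolv_eq hA (hl n) hφ
    rw [map_add, map_smul] at this
    linear_combination (norm := module) this
  have h2 : ∀ ψ, ‖(Complex.I * l n) • resolv A (l n) ψ‖ ≤ ‖ψ‖ := by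
    intro ψ
    have := norm_resolv_le hA (hl n) ψ
    rw [inv_mul_eq_div, le_div_iff₀ (abs_pos.2 (hl n))] at this
    rw [norm_smul]
    simp
    linarith
  have h3 : (Complex.I * l n) • resolv A (l n) χ - χ =
      (Complex.I * l n) • resolv A (l n) (χ - φ) - resolv A (l n) η - (χ - φ) := by
    rw [map_sub, smul_sub, e]; abel
  rw [dist_eq_norm] at hd ⊢
  rw [h3]
  have h4 := norm_sub_le ((Complex.I * l n) • resolv A (l n) (χ - φ) - resolv A (l n) η) (χ - φ)
  have h5 := norm_sub_le ((Complex.I * l n) • resolv A (l n) (χ - φ)) (resolv A (l n) η)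
  have h6 := h2 (χ - φ)
  have h7 := (norm_resolv_le hA (hl n) η).trans_lt (hK n hn)
  linarith

/-- The approximant at ψ is the mean of il R(l)χ over l = ±(n+1): in il R(l)Aψ = ilψ + l² R(l)ψ the
terms ilψ cancel between the two signs. -/
theorem tendsto_yosida (hA : IsSelfAdjoint A) {ψ χ : E} (h : (ψ, χ) ∈ A.graph) :
    Tendsto (fun n => yosida A n ψ) atTop (𝓝 χ) := by
  have hn : ∀ n : ℕ, (n + 1 : ℝ) ≠ 0 := fun n => by positivity
  have hlim : Tendsto (fun n : ℕ => |(n + 1 : ℝ)|⁻¹) atTop (𝓝 0) := by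
    have := tendsto_one_div_add_atTop_nhds_zero_nat (𝕜 := ℝ)
    refine this.congr fun n => ?_
    rw [abs_of_pos (by positivity), one_div]
  have h1 := tendsto_resolv hA hn hlim χ
  have h2 := tendsto_resolv hA (l := fun n => -(n + 1 : ℝ)) (fun n => neg_ne_zero.2 (hn n))
    (by simpa only [abs_neg] using hlim) χ
  have h3 := (h1.add h2).const_smul (1 / 2 : ℂ)
  rw [← two_smul ℂ, smul_smul, one_div, inv_mul_cancel₀ two_ne_zero, one_smul] at h3
  refine h3.congr fun n => ?_
  have e1 := resolv_eq hA (hn n) h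
  have e2 := resolv_eq hA (neg_ne_zero.2 (hn n)) h
  rw [map_add, map_smul] at e1 e2
  simp only [yosida, smul_apply, add_apply]
  rw [eq_sub_of_add_eq e1, eq_sub_of_add_eq e2, Complex.ofReal_neg, Complex.ofReal_add,
    Complex.ofReal_natCast, Complex.ofReal_one]
  have hI := Complex.I_mul_I
  match_scalars
  · ring
  · linear_combination (-(((n : ℂ) + 1) ^ 2) / 2) * hI
  · linear_combination (-(((n : ℂ) + 1) ^ 2) / 2) * hI

/-- The unitary groups of the Yosida approximations. -/
noncomputable def yosidaGroup (A : E →ₗ.[ℂ] E) (n : ℕ) (t : ℝ) : E →L[ℂ] E :=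
  NormedSpace.exp (t • (-Complex.I • yosida A n))

theorem yosidaGroup_mem_unitary (hA : IsSelfAdjoint A) (n : ℕ) (t : ℝ) :
    yosidaGroup A n t ∈ unitary (E →L[ℂ] E) := by
  let _ : NormedAlgebra ℚ (E →L[ℂ] E) := .restrictScalars ℚ ℂ _
  refine NormedSpace.exp_mem_unitary_of_mem_skewAdjoint ?_
  rw [skewAdjoint.mem_iff, star_smul, star_smul, (isSelfAdjoint_yosida hA n).star_eq]
  simp

theorem norm_yosidaGroup (hA : IsSelfAdjoint A) (n : ℕ) (t : ℝ) (ψ : E) :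
    ‖yosidaGroup A n t ψ‖ = ‖ψ‖ :=
  ContinuousLinearMap.norm_map_of_mem_unitary (yosidaGroup_mem_unitary hA n t) ψ

theorem yosidaGroup_add (n : ℕ) (s t : ℝ) :
    yosidaGroup A n (s + t) = yosidaGroup A n s * yosidaGroup A n t := by
  let _ : NormedAlgebra ℚ (E →L[ℂ] E) := .restrictScalars ℚ ℂ _
  rw [yosidaGroup, add_smul, NormedSpace.exp_add_of_commute]
  · rfl
  · exact ((Commute.refl _).smul_left _).smul_right _

/-- For skew-adjoint `B` the exponential is unitary and commutes with B, so the orbit of ψ moves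
with constant speed ‖Bψ‖. -/
theorem norm_exp_sub_le {B : E →L[ℂ] E} (hB : B ∈ skewAdjoint (E →L[ℂ] E)) (t : ℝ) (ψ : E) :
    ‖NormedSpace.exp (t • B) ψ - ψ‖ ≤ ‖B ψ‖ * |t| := by
  let _ : NormedAlgebra ℚ (E →L[ℂ] E) := .restrictScalars ℚ ℂ _
  have hu : ∀ t : ℝ, NormedSpace.exp (t • B) ∈ unitary (E →L[ℂ] E) := fun t =>
    NormedSpace.exp_mem_unitary_of_mem_skewAdjoint (skewAdjoint.smul_mem t hB)
  have hd : ∀ t : ℝ, HasDerivAt (fun t : ℝ => NormedSpace.exp (t • B) ψ)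
      ((NormedSpace.exp (t • B) * B) ψ) t := by
    intro t
    have h1 := hasDerivAt_exp_smul_const (𝕂 := ℝ) B t
    exact ((ContinuousLinearMap.apply ℂ E ψ).restrictScalars ℝ).hasFDerivAt.comp_hasDerivAt t h1
  have := norm_sub_le_of_norm_deriv_eq (C := ‖B ψ‖) hd (fun t => by
    rw [mul_apply_eq_comp, ContinuousLinearMap.norm_map_of_mem_unitary (hu t)]) 0 t
  simpa using this

/-- The approximants commute, so one group is the other times the exponential of the difference of
the generators. Unitarity removes the common factor. -/
theorem norm_yosidaGroup_sub_le (hA : IsSelfAdjoint A) (n k : ℕ) (t : ℝ) (ψ : E) :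
    ‖yosidaGroup A n t ψ - yosidaGroup A k t ψ‖ ≤ ‖yosida A n ψ - yosida A k ψ‖ * |t| := by
  let _ : NormedAlgebra ℚ (E →L[ℂ] E) := .restrictScalars ℚ ℂ _
  set B := -Complex.I • yosida A n
  set C := -Complex.I • yosida A k
  have hc : Commute C (B - C) :=
    ((((yosida_comm hA k n).smul_left _).smul_right _)).sub_right (Commute.refl C)
  have hskew : B - C ∈ skewAdjoint (E →L[ℂ] E) := by
    rw [skewAdjoint.mem_iff, star_sub, star_smul, star_smul,
      (isSelfAdjoint_yosida hA n).star_eq, (isSelfAdjoint_yosida hA k).star_eq]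
    simp [B, C, neg_add_eq_sub]
  have h1 : yosidaGroup A n t = yosidaGroup A k t * NormedSpace.exp (t • (B - C)) := by
    rw [yosidaGroup, yosidaGroup, ← NormedSpace.exp_add_of_commute, ← smul_add, add_sub_cancel]
    exact (hc.smul_left _).smul_right _
  have h2 := norm_exp_sub_le hskew t ψ
  rw [h1, mul_apply_eq_comp, ← map_sub, norm_yosidaGroup hA]
  refine h2.trans (le_of_eq ?_)
  rw [sub_apply, smul_apply, smul_apply, ← smul_sub, norm_smul]
  simp

theorem cauchySeq_yosidaGroup (hA : IsSelfAdjoint A) (t : ℝ) (ψ : E) :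
    CauchySeq fun n => yosidaGroup A n t ψ := by
  rw [Metric.cauchySeq_iff']
  intro ε hε
  obtain ⟨φ, ⟨χ, hφ⟩, hd⟩ := (dense_graph_fst hA).exists_dist_lt ψ (ε := ε / 3) (by positivity)
  have h1 := (tendsto_yosida hA hφ).cauchySeq
  rw [Metric.cauchySeq_iff'] at h1
  obtain ⟨K, hK⟩ := h1 (ε / 3 / (|t| + 1)) (by positivity)
  refine ⟨K, fun n hn => ?_⟩
  have h2 := norm_yosidaGroup_sub_le hA n K t φ
  have h3 := hK n hn
  rw [dist_eq_norm, lt_div_iff₀ (by positivity)] at h3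
  have h4 := norm_yosidaGroup hA n t (ψ - φ)
  have h5 := norm_yosidaGroup hA K t (ψ - φ)
  rw [map_sub] at h4 h5
  rw [dist_eq_norm] at hd ⊢
  have e : yosidaGroup A n t ψ - yosidaGroup A K t ψ =
      (yosidaGroup A n t ψ - yosidaGroup A n t φ) +
      (yosidaGroup A n t φ - yosidaGroup A K t φ) -
      (yosidaGroup A K t ψ - yosidaGroup A K t φ) := by abel
  rw [e]
  have h6 := norm_sub_le ((yosidaGroup A n t ψ - yosidaGroup A n t φ) +
      (yosidaGroup A n t φ - yosidaGroup A K t φ)) (yosidaGroup A K t ψ - yosidaGroup A K t φ)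
  have h7 := norm_add_le (yosidaGroup A n t ψ - yosidaGroup A n t φ)
      (yosidaGroup A n t φ - yosidaGroup A K t φ)
  nlinarith [norm_nonneg (yosida A n φ - yosida A K φ)]

/-- Stone's theorem: a self-adjoint operator generates a one-parameter unitary group, the limit of
the groups of its Yosida approximations. -/
theorem exists_unitaryGroup (hA : IsSelfAdjoint A) :
    ∃ U : ℝ → (E ≃ₗᵢ[ℂ] E), IsUnitaryGroupOf A U ∧
      ∀ t ψ, Tendsto (fun n => yosidaGroup A n t ψ) atTop (𝓝 (U t ψ)) := by
  have hlim : ∀ t ψ, ∃ χ, Tendsto (fun n => yosidaGroup A n t ψ) atTop (𝓝 χ) := fun t ψ =>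
    cauchySeq_tendsto_of_complete (cauchySeq_yosidaGroup hA t ψ)
  choose W hW using hlim
  have hnorm : ∀ t ψ, ‖W t ψ‖ = ‖ψ‖ := fun t ψ =>
    tendsto_nhds_unique (hW t ψ).norm (by simp only [norm_yosidaGroup hA]; exact tendsto_const_nhds)
  have hsub : ∀ t ψ χ, W t (ψ - χ) = W t ψ - W t χ := fun t ψ χ =>
    tendsto_nhds_unique (hW t _) (by simpa only [map_sub] using (hW t ψ).sub (hW t χ))
  have hmul : ∀ s t ψ, W (s + t) ψ = W s (W t ψ) := by
    intro s t ψ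
    refine tendsto_nhds_unique (hW (s + t) ψ) ?_
    have h1 : Tendsto (fun n => yosidaGroup A n s (yosidaGroup A n t ψ - W t ψ)) atTop (𝓝 0) := by
      rw [tendsto_zero_iff_norm_tendsto_zero]
      simp only [norm_yosidaGroup hA]
      rw [← tendsto_zero_iff_norm_tendsto_zero]
      simpa using (hW t ψ).sub_const (W t ψ)
    have h2 := h1.add (hW s (W t ψ))
    rw [zero_add] at h2
    refine h2.congr fun n => ?_
    rw [yosidaGroup_add, mul_apply_eq_comp, map_sub, sub_add_cancel]
  have hzero : ∀ ψ, W 0 ψ = ψ := fun ψ =>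
    tendsto_nhds_unique (hW 0 ψ) (by simp [yosidaGroup])
  let U : ℝ → (E ≃ₗᵢ[ℂ] E) := fun t =>
    { toFun := W t
      invFun := W (-t)
      left_inv := fun ψ => by rw [← hmul, neg_add_cancel, hzero]
      right_inv := fun ψ => by rw [← hmul, add_neg_cancel, hzero]
      map_add' := fun ψ χ =>
        tendsto_nhds_unique (hW t _) (by simpa only [map_add] using (hW t ψ).add (hW t χ))
      map_smul' := fun c ψ =>
        tendsto_nhds_unique (hW t _) (by
          simpa only [map_smul, RingHom.id_apply] using (hW t ψ).const_smul c)
      norm_map' := hnorm t }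
  have hU : ∀ s t : ℝ, U (s + t) = U s * U t := fun s t =>
    LinearIsometryEquiv.ext fun ψ => hmul s t ψ
  refine ⟨U, isUnitaryGroupOf_of_core hA hU (G := A.graph) subset_closure fun ψ χ h => ?_, hW⟩
  -- Letting k → ∞ in the comparison of two approximants gives an error linear in t. This transfers
  -- the derivative at 0 from the bounded groups to the limit group.
  have hb : ∀ n t, ‖U t ψ - yosidaGroup A n t ψ‖ ≤ ‖χ - yosida A n ψ‖ * |t| := fun n t =>
    le_of_tendsto_of_tendsto' (b := atTop) ((hW t ψ).sub_const _).norm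
      ((((tendsto_yosida hA h).sub_const _).norm).mul_const _)
      fun k => norm_yosidaGroup_sub_le hA k n t ψ
  rw [hasDerivAt_iff_isLittleO, Asymptotics.isLittleO_iff]
  intro ε hε
  obtain ⟨n, hn⟩ : ∃ n, ‖χ - yosida A n ψ‖ < ε / 3 := by
    have : Tendsto (fun n => ‖χ - yosida A n ψ‖) atTop (𝓝 0) := by
      simpa using ((tendsto_yosida hA h).const_sub χ).norm
    exact (this.eventually (gt_mem_nhds (by positivity))).exists
  have hd : HasDerivAt (fun t : ℝ => yosidaGroup A n t ψ) (-Complex.I • yosida A n ψ) 0 := by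
    have h1 := hasDerivAt_exp_smul_const (𝕂 := ℝ) (-Complex.I • yosida A n) 0
    have h2 := ((ContinuousLinearMap.apply ℂ E ψ).restrictScalars ℝ).hasFDerivAt.comp_hasDerivAt
      (0 : ℝ) h1
    simpa [yosidaGroup] using! h2
  rw [hasDerivAt_iff_isLittleO, Asymptotics.isLittleO_iff] at hd
  filter_upwards [hd (c := ε / 3) (by positivity)] with t ht
  have e0 : yosidaGroup A n 0 ψ = ψ := by simp [yosidaGroup]
  have e1 : U 0 ψ = ψ := hzero ψ
  rw [e0, sub_zero] at ht
  rw [e1, sub_zero]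
  have e : U t ψ - ψ - t • (-Complex.I • χ) = (U t ψ - yosidaGroup A n t ψ)
      + (yosidaGroup A n t ψ - ψ - t • (-Complex.I • yosida A n ψ))
      - t • (-Complex.I • (χ - yosida A n ψ)) := by
    rw [smul_sub, smul_sub]; abel
  rw [e]
  have h4 : ‖t • (-Complex.I • (χ - yosida A n ψ))‖ = ‖χ - yosida A n ψ‖ * |t| := by
    rw [norm_smul, norm_smul, Real.norm_eq_abs, mul_comm]; simp
  have h5 := norm_sub_le ((U t ψ - yosidaGroup A n t ψ)
      + (yosidaGroup A n t ψ - ψ - t • (-Complex.I • yosida A n ψ)))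
      (t • (-Complex.I • (χ - yosida A n ψ)))
  have h6 := norm_add_le (U t ψ - yosidaGroup A n t ψ)
      (yosidaGroup A n t ψ - ψ - t • (-Complex.I • yosida A n ψ))
  have h7 : ‖χ - yosida A n ψ‖ * |t| ≤ ε / 3 * |t| := by gcongr
  have h8 := hb n t
  rw [Real.norm_eq_abs] at *
  linarith

theorem isUnitaryGroupOf_unitaryGroup (hA : IsSelfAdjoint A) :
    IsUnitaryGroupOf A (unitaryGroup A) := by
  obtain ⟨U, hU, -⟩ := exists_unitaryGroup hA
  have h : ∃ U : ℝ → (E ≃ₗᵢ[ℂ] E), IsUnitaryGroupOf A U := ⟨U, hU⟩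
  rw [unitaryGroup, dif_pos h]
  exact h.choose_spec

/-- By uniqueness the chosen group is the Yosida limit. This explicit description is what later
gives measurability in the masses, which an abstract choice would not. -/
theorem tendsto_yosidaGroup (hA : IsSelfAdjoint A) (t : ℝ) (ψ : E) :
    Tendsto (fun n => yosidaGroup A n t ψ) atTop (𝓝 (unitaryGroup A t ψ)) := by
  obtain ⟨U, hU, hlim⟩ := exists_unitaryGroup hA
  rw [(hU.unique hA (isUnitaryGroupOf_unitaryGroup hA))]
  exact hlim t ψ

end Stone

/-! ### Square-integrable functions -/

section L2

open Filter Topology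
open scoped ENNReal

variable {α β : Type*} [MeasureSpace α] [MeasureSpace β]

theorem toL2_of_memLp {f : α → ℂ} (h : MemLp f 2 (volume : Measure α)) : toL2 f = h.toLp f :=
  dif_pos h

theorem coeFn_toL2 {f : α → ℂ} (h : MemLp f 2 (volume : Measure α)) : toL2 f =ᵐ[volume] f := by
  rw [toL2_of_memLp h]
  exact h.coeFn_toLp

theorem toL2_congr {f g : α → ℂ} (h : f =ᵐ[volume] g) : toL2 f = toL2 g := by
  by_cases hf : MemLp f 2 (volume : Measure α)
  · have hg := (memLp_congr_ae h).1 hf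
    rw [toL2_of_memLp hf, toL2_of_memLp hg, MemLp.toLp_eq_toLp_iff]
    exact h
  · have hg : ¬ MemLp g 2 (volume : Measure α) := fun hg => hf ((memLp_congr_ae h).2 hg)
    rw [toL2, toL2, dif_neg hf, dif_neg hg]

theorem toL2_coe (ψ : L2 α) : toL2 ψ = ψ := by
  rw [toL2_of_memLp (Lp.memLp ψ), Lp.toLp_coeFn]

theorem toL2_eq_of_ae {f : α → ℂ} {ψ : L2 α} (h : f =ᵐ[volume] ψ) : toL2 f = ψ := by
  rw [toL2_congr h, toL2_coe]

theorem eLpNorm_two_sq {E : Type*} [NormedAddCommGroup E] (μ : Measure α) (f : α → E) :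
    eLpNorm f 2 μ ^ 2 = ∫⁻ x, ‖f x‖ₑ ^ 2 ∂μ := by
  have := eLpNorm_nnreal_pow_eq_lintegral (μ := μ) (f := f) (p := 2) two_ne_zero
  simpa using this

theorem memLp_two_iff {E : Type*} [NormedAddCommGroup E] {μ : Measure α} {f : α → E}
    (hf : AEStronglyMeasurable f μ) : MemLp f 2 μ ↔ ∫⁻ x, ‖f x‖ₑ ^ 2 ∂μ < ⊤ := by
  rw [← eLpNorm_two_sq]
  simp [MemLp, hf, lt_top_iff_ne_top]

theorem enorm_L2_sq {E : Type*} [NormedAddCommGroup E] {μ : Measure α} (ψ : Lp E 2 μ) :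
    ‖ψ‖ₑ ^ 2 = ∫⁻ x, ‖ψ x‖ₑ ^ 2 ∂μ := by
  rw [Lp.enorm_def, eLpNorm_two_sq]

theorem enorm_toL2_sub_sq {f : α → ℂ} (h : MemLp f 2 (volume : Measure α)) (ψ : L2 α) :
    ‖toL2 f - ψ‖ₑ ^ 2 = ∫⁻ x, ‖f x - ψ x‖ₑ ^ 2 := by
  rw [enorm_L2_sq]
  refine lintegral_congr_ae ?_
  filter_upwards [Lp.coeFn_sub (toL2 f) ψ, coeFn_toL2 h] with x h1 h2
  rw [h1, Pi.sub_apply, h2]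

/-- In a second countable metric space every open set is a countable union of balls, and preimages
of balls are sublevel sets of distance functions. -/
theorem measurable_of_measurable_dist {Y X : Type*} [MeasurableSpace Y] [PseudoMetricSpace X]
    [SecondCountableTopology X] [MeasurableSpace X] [BorelSpace X] {f : Y → X}
    (h : ∀ x, Measurable fun a => dist (f a) x) : Measurable f := by
  refine measurable_of_isOpen fun U hU => ?_
  have hx : ∀ x : U, ∃ r > 0, Metric.ball (x : X) r ⊆ U := fun x => Metric.isOpen_iff.1 hU x x.2
  choose r hr hrU using hx
  obtain ⟨T, hT, hTU⟩ := TopologicalSpace.isOpen_iUnion_countable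
    (fun x : U => Metric.ball (x : X) (r x)) fun x => Metric.isOpen_ball
  have e : U = ⋃ x ∈ T, Metric.ball (x : X) (r x) := by
    rw [hTU]
    refine Set.Subset.antisymm (fun x hx => ?_) (Set.iUnion_subset hrU)
    exact Set.mem_iUnion.2 ⟨⟨x, hx⟩, Metric.mem_ball_self (hr _)⟩
  rw [e, Set.preimage_iUnion₂]
  exact MeasurableSet.biUnion hT fun x _ => measurableSet_lt (h x) measurable_const

/-! ### Multiplication operators and changes of variables -/

theorem memLp_phase_mul {θ : α → ℝ} (hθ : Measurable θ) {f : α → ℂ}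
    (hf : MemLp f 2 (volume : Measure α)) :
    MemLp (fun x => Complex.exp (Complex.I * (θ x : ℂ)) * f x) 2 (volume : Measure α) := by
  refine hf.of_le ?_ (ae_of_all _ fun x => ?_)
  · have : Measurable fun x => Complex.exp (Complex.I * (θ x : ℂ)) := by fun_prop
    exact this.aestronglyMeasurable.mul hf.1
  · rw [norm_mul, mul_comm Complex.I, Complex.norm_exp_ofReal_mul_I, one_mul]

/-- Multiplication by `e^{iθ}`. -/
noncomputable def phaseMul (θ : α → ℝ) (hθ : Measurable θ) : L2 α ≃ₗᵢ[ℂ] L2 α where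
  toFun ψ := toL2 fun x => Complex.exp (Complex.I * (θ x : ℂ)) * ψ x
  invFun ψ := toL2 fun x => Complex.exp (Complex.I * ((-θ x : ℝ) : ℂ)) * ψ x
  left_inv ψ := by
    refine toL2_eq_of_ae ?_
    filter_upwards [coeFn_toL2 (memLp_phase_mul hθ (Lp.memLp ψ))] with x hx
    rw [hx, ← mul_assoc, ← Complex.exp_add]
    simp
  right_inv ψ := by
    refine toL2_eq_of_ae ?_
    filter_upwards [coeFn_toL2 (memLp_phase_mul (θ := fun x => -θ x) hθ.neg (Lp.memLp ψ))]
      with x hx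
    rw [hx, ← mul_assoc, ← Complex.exp_add]
    simp
  map_add' ψ χ := by
    refine toL2_eq_of_ae ?_
    filter_upwards [Lp.coeFn_add ψ χ, Lp.coeFn_add (toL2 _) (toL2 _),
      coeFn_toL2 (memLp_phase_mul hθ (Lp.memLp ψ)),
      coeFn_toL2 (memLp_phase_mul hθ (Lp.memLp χ))] with x h1 h2 h3 h4
    rw [h1, h2, Pi.add_apply, Pi.add_apply, h3, h4, mul_add]
  map_smul' c ψ := by
    refine toL2_eq_of_ae ?_
    filter_upwards [Lp.coeFn_smul c ψ, Lp.coeFn_smul c (toL2 _),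
      coeFn_toL2 (memLp_phase_mul hθ (Lp.memLp ψ))] with x h1 h2 h3
    rw [h1, RingHom.id_apply, h2, Pi.smul_apply, Pi.smul_apply, h3, smul_eq_mul, smul_eq_mul]
    ring
  norm_map' ψ := by
    change ‖toL2 fun x => Complex.exp (Complex.I * (θ x : ℂ)) * ψ x‖ = ‖ψ‖
    refine le_antisymm (Lp.norm_le_norm_of_ae_le ?_) (Lp.norm_le_norm_of_ae_le ?_) <;>
    · filter_upwards [coeFn_toL2 (memLp_phase_mul hθ (Lp.memLp ψ))] with x hx
      rw [hx, norm_mul, mul_comm Complex.I, Complex.norm_exp_ofReal_mul_I, one_mul]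

theorem phaseMul_ae (θ : α → ℝ) (hθ : Measurable θ) (ψ : L2 α) :
    phaseMul θ hθ ψ =ᵐ[volume] fun x => Complex.exp (Complex.I * (θ x : ℂ)) * ψ x :=
  coeFn_toL2 (memLp_phase_mul hθ (Lp.memLp ψ))

/-- Change of variables by a measure-preserving equivalence. -/
noncomputable def compEquiv (e : α ≃ᵐ β) (he : MeasurePreserving e) : L2 β ≃ₗᵢ[ℂ] L2 α where
  toFun ψ := toL2 fun x => ψ (e x)
  invFun ψ := toL2 fun y => ψ (e.symm y)
  left_inv ψ := by
    refine toL2_eq_of_ae ?_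
    filter_upwards [(he.symm e).quasiMeasurePreserving.ae
      (coeFn_toL2 ((Lp.memLp ψ).comp_measurePreserving he))] with y hy
    simpa using! hy
  right_inv ψ := by
    refine toL2_eq_of_ae ?_
    filter_upwards [he.quasiMeasurePreserving.ae
      (coeFn_toL2 ((Lp.memLp ψ).comp_measurePreserving (he.symm e)))] with y hy
    simpa using! hy
  map_add' ψ χ := by
    refine toL2_eq_of_ae ?_
    filter_upwards [he.quasiMeasurePreserving.ae (Lp.coeFn_add ψ χ), Lp.coeFn_add (toL2 _) (toL2 _),
      coeFn_toL2 ((Lp.memLp ψ).comp_measurePreserving he),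
      coeFn_toL2 ((Lp.memLp χ).comp_measurePreserving he)] with x h1 h2 h3 h4
    refine h1.trans (h2.trans ?_).symm
    rw [Pi.add_apply, Pi.add_apply]
    exact congrArg₂ (· + ·) h3 h4
  map_smul' c ψ := by
    refine toL2_eq_of_ae ?_
    filter_upwards [he.quasiMeasurePreserving.ae (Lp.coeFn_smul c ψ), Lp.coeFn_smul c (toL2 _),
      coeFn_toL2 ((Lp.memLp ψ).comp_measurePreserving he)] with x h1 h2 h3
    exact h1.trans (h2.trans (congrArg (c • ·) h3)).symm
  norm_map' ψ := by
    change ‖toL2 (ψ ∘ e)‖ = _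
    rw [toL2_of_memLp ((Lp.memLp ψ).comp_measurePreserving he), Lp.norm_toLp,
      eLpNorm_comp_measurePreserving (Lp.aestronglyMeasurable ψ) he, ← Lp.norm_def]

theorem compEquiv_ae (e : α ≃ᵐ β) (he : MeasurePreserving e) (ψ : L2 β) :
    compEquiv e he ψ =ᵐ[volume] fun x => ψ (e x) :=
  coeFn_toL2 ((Lp.memLp ψ).comp_measurePreserving he)

/-! ### Slices -/

/-- The component at `a` of an element of `L²(α × β) ≃ ∫^⊕ L²(β) da`. -/
noncomputable def slice (Ψ : L2 (α × β)) (a : α) : L2 β := toL2 fun b => Ψ (a, b)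

variable [SFinite (volume : Measure β)]

section
omit [SFinite (volume : Measure β)]

theorem ae_ae_of_ae_volume_prod {p : α × β → Prop} [SFinite (volume : Measure β)] (h : ∀ᵐ q, p q) :
    ∀ᵐ a : α, ∀ᵐ b : β, p (a, b) := Measure.ae_ae_of_ae_prod h
end

theorem lintegral_volume_prod {f : α × β → ℝ≥0∞} (h : AEMeasurable f) :
    ∫⁻ q, f q = ∫⁻ a, ∫⁻ b, f (a, b) := lintegral_prod f h

theorem slice_congr {Ψ : L2 (α × β)} {f : α × β → ℂ} (h : Ψ =ᵐ[volume] f) :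
    ∀ᵐ a, slice Ψ a = toL2 fun b => f (a, b) := by
  filter_upwards [ae_ae_of_ae_volume_prod h] with a ha
  exact toL2_congr ha

theorem ae_memLp_slice (Ψ : L2 (α × β)) :
    ∀ᵐ a, MemLp (fun b => Ψ (a, b)) 2 (volume : Measure β) := by
  have h1 : AEMeasurable (fun q => ‖Ψ q‖ₑ ^ 2) (volume : Measure (α × β)) :=
    (Lp.aestronglyMeasurable Ψ).enorm.pow_const 2
  have h2 : ∫⁻ q, ‖Ψ q‖ₑ ^ 2 < ⊤ := (memLp_two_iff (Lp.aestronglyMeasurable Ψ)).1 (Lp.memLp Ψ)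
  rw [lintegral_volume_prod h1] at h2
  filter_upwards [ae_lt_top' h1.lintegral_prod_right' h2.ne,
    (Lp.aestronglyMeasurable Ψ).prodMk_left] with a ha hm
  exact (memLp_two_iff hm).2 ha

theorem coeFn_slice (Ψ : L2 (α × β)) : ∀ᵐ a, slice Ψ a =ᵐ[volume] fun b => Ψ (a, b) := by
  filter_upwards [ae_memLp_slice Ψ] with a ha
  exact coeFn_toL2 ha

theorem slice_add (Ψ Φ : L2 (α × β)) : ∀ᵐ a, slice (Ψ + Φ) a = slice Ψ a + slice Φ a := by
  filter_upwards [slice_congr (Lp.coeFn_add Ψ Φ), coeFn_slice Ψ, coeFn_slice Φ] with a h1 h2 h3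
  rw [h1]
  refine toL2_eq_of_ae ?_
  filter_upwards [h2, h3, Lp.coeFn_add (slice Ψ a) (slice Φ a)] with b h2 h3 h4
  rw [h4, Pi.add_apply, Pi.add_apply, h2, h3]

theorem slice_smul (c : ℂ) (Ψ : L2 (α × β)) : ∀ᵐ a, slice (c • Ψ) a = c • slice Ψ a := by
  filter_upwards [slice_congr (Lp.coeFn_smul c Ψ), coeFn_slice Ψ] with a h1 h2
  rw [h1]
  refine toL2_eq_of_ae ?_
  filter_upwards [h2, Lp.coeFn_smul c (slice Ψ a)] with b h2 h4
  rw [h4, Pi.smul_apply, Pi.smul_apply, h2]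

theorem lintegral_enorm_slice (Ψ : L2 (α × β)) : ∫⁻ a, ‖slice Ψ a‖ₑ ^ 2 = ‖Ψ‖ₑ ^ 2 := by
  rw [enorm_L2_sq, lintegral_volume_prod]
  · refine lintegral_congr_ae ?_
    filter_upwards [coeFn_slice Ψ] with a ha
    rw [enorm_L2_sq]
    refine lintegral_congr_ae ?_
    filter_upwards [ha] with b hb
    rw [hb]
  · exact (Lp.aestronglyMeasurable Ψ).enorm.pow_const 2

/-- Distances to a fixed ψ are square roots of parameter integrals where the slice is square
integrable. Elsewhere `toL2` takes its default value 0 and the distance is the constant ‖ψ‖. -/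
theorem stronglyMeasurable_toL2_slice [SecondCountableTopology (L2 β)] {f : α × β → ℂ}
    (hf : Measurable f) : StronglyMeasurable fun a => toL2 fun b => f (a, b) := by
  borelize (L2 β)
  refine (measurable_of_measurable_dist fun ψ => ?_).stronglyMeasurable
  have hG : MeasurableSet {a : α | ∫⁻ b, ‖f (a, b)‖ₑ ^ 2 < ⊤} :=
    measurableSet_lt (hf.enorm.pow_const 2).lintegral_prod_right' measurable_const
  -- A measurable representative of ψ is needed for the integrand to be jointly measurable in (a,
  -- b).
  obtain ⟨g, hg, hψ⟩ := Lp.aestronglyMeasurable ψ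
  have hd : Measurable fun a : α => ∫⁻ b, ‖f (a, b) - g b‖ₑ ^ 2 :=
    (((hf.sub (hg.measurable.comp measurable_snd)).enorm).pow_const 2).lintegral_prod_right'
  have key : (fun a => dist (toL2 fun b => f (a, b)) ψ) = fun a =>
      if a ∈ {a : α | ∫⁻ b, ‖f (a, b)‖ₑ ^ 2 < ⊤}
      then ((∫⁻ b, ‖f (a, b) - g b‖ₑ ^ 2) ^ (1 / 2 : ℝ)).toReal else ‖ψ‖ := by
    funext a
    have hm : AEStronglyMeasurable (fun b => f (a, b)) (volume : Measure β) :=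
      (hf.comp measurable_prodMk_left).aestronglyMeasurable
    split_ifs with ha
    · have hL := (memLp_two_iff hm).2 ha
      have h1 := enorm_toL2_sub_sq hL ψ
      have h2 : ∫⁻ b, ‖f (a, b) - ψ b‖ₑ ^ 2 = ∫⁻ b, ‖f (a, b) - g b‖ₑ ^ 2 := by
        refine lintegral_congr_ae ?_
        filter_upwards [hψ] with b hb
        rw [hb]
      rw [← h2, ← h1, dist_eq_norm, ← ENNReal.rpow_natCast, ← ENNReal.rpow_mul]
      simp
    · have hL : ¬ MemLp (fun b => f (a, b)) 2 (volume : Measure β) := fun h =>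
        ha ((memLp_two_iff hm).1 h)
      rw [toL2, dif_neg hL, dist_zero_left]
  rw [key]
  exact Measurable.ite hG (hd.pow_const _).ennreal_toReal measurable_const

theorem aestronglyMeasurable_slice [SecondCountableTopology (L2 β)] (Ψ : L2 (α × β)) :
    AEStronglyMeasurable (slice Ψ) (volume : Measure α) := by
  obtain ⟨f, hf, hΨ⟩ := Lp.aestronglyMeasurable Ψ
  exact ⟨_, stronglyMeasurable_toL2_slice hf.measurable, slice_congr hΨ⟩

theorem memLp_slice [SecondCountableTopology (L2 β)] (Ψ : L2 (α × β)) :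
    MemLp (slice Ψ) 2 (volume : Measure α) := by
  rw [memLp_two_iff (aestronglyMeasurable_slice Ψ), lintegral_enorm_slice]
  exact ENNReal.pow_lt_top enorm_lt_top

/-- The embedding of `L²(α × β)` in `L²(α; L²(β))`. -/
noncomputable def sliceIsometry [SecondCountableTopology (L2 β)] :
    L2 (α × β) →ₗᵢ[ℂ] Lp (L2 β) 2 (volume : Measure α) where
  toFun Ψ := (memLp_slice Ψ).toLp _
  map_add' Ψ Φ := by
    rw [← MemLp.toLp_add, MemLp.toLp_eq_toLp_iff]
    exact slice_add Ψ Φ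
  map_smul' c Ψ := by
    rw [RingHom.id_apply, ← MemLp.toLp_const_smul, MemLp.toLp_eq_toLp_iff]
    exact slice_smul c Ψ
  norm_map' Ψ := by
    have h1 : ‖(memLp_slice Ψ).toLp (slice Ψ)‖ₑ ^ 2 = ‖Ψ‖ₑ ^ 2 := by
      rw [enorm_L2_sq, ← lintegral_enorm_slice]
      refine lintegral_congr_ae ?_
      filter_upwards [(memLp_slice Ψ).coeFn_toLp] with a ha
      rw [ha]
    simp only [← ofReal_norm, ← ENNReal.ofReal_pow (norm_nonneg _)] at h1
    exact (sq_eq_sq₀ (norm_nonneg _) (norm_nonneg _)).1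
      ((ENNReal.ofReal_eq_ofReal_iff (by positivity) (by positivity)).1 h1)

theorem coeFn_sliceIsometry [SecondCountableTopology (L2 β)] (Ψ : L2 (α × β)) :
    sliceIsometry Ψ =ᵐ[volume] slice Ψ := (memLp_slice Ψ).coeFn_toLp

/-- The range is a closed subspace and contains every indicator times a constant vector c, as the
image of the function 1_s(a) c(b). -/
theorem sliceIsometry_surjective [SecondCountableTopology (L2 β)] :
    Function.Surjective (sliceIsometry (α := α) (β := β)) := by
  intro F
  refine Lp.induction (p := 2) ENNReal.ofNat_ne_top
    (motive := fun F => F ∈ Set.range (sliceIsometry (α := α) (β := β))) ?_ ?_ ?_ F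
  · intro c s hs hμ
    have hm : AEStronglyMeasurable (fun q : α × β => s.indicator (fun _ => (1 : ℂ)) q.1 * c q.2)
        (volume : Measure (α × β)) :=
      ((measurable_const.indicator hs).comp measurable_fst).aestronglyMeasurable.mul
        ((Lp.aestronglyMeasurable c).comp_snd)
    have hL : MemLp (fun q : α × β => s.indicator (fun _ => (1 : ℂ)) q.1 * c q.2) 2
        (volume : Measure (α × β)) := by
      rw [memLp_two_iff hm, lintegral_volume_prod (hm.enorm.pow_const 2)]
      have e : ∀ a : α, ∫⁻ b, ‖s.indicator (fun _ => (1 : ℂ)) a * c b‖ₑ ^ 2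
          = s.indicator (fun _ => ‖c‖ₑ ^ 2) a := by
        intro a
        by_cases ha : a ∈ s
        · simp [ha, enorm_L2_sq]
        · simp [ha]
      simp only [e]
      rw [lintegral_indicator hs, setLIntegral_const]
      exact ENNReal.mul_lt_top (ENNReal.pow_lt_top enorm_lt_top) hμ
    refine ⟨toL2 fun q => s.indicator (fun _ => (1 : ℂ)) q.1 * c q.2, ?_⟩
    refine Lp.ext ?_
    filter_upwards [coeFn_sliceIsometry
        (toL2 fun q : α × β => s.indicator (fun _ => (1 : ℂ)) q.1 * c q.2),
      slice_congr (coeFn_toL2 hL),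
      indicatorConstLp_coeFn (p := 2) (hs := hs) (hμs := hμ.ne) (c := c)] with a h1 h2 h3
    rw [h1, h2, Lp.simpleFunc.coe_indicatorConst, h3]
    by_cases ha : a ∈ s
    · simp [ha, toL2_coe]
    · simp only [ha, not_false_eq_true, Set.indicator_of_notMem, zero_mul]
      exact toL2_eq_of_ae (Lp.coeFn_zero _ _ _).symm
  · rintro f g hf hg - ⟨Ψ, hΨ⟩ ⟨Φ, hΦ⟩
    exact ⟨Ψ + Φ, by rw [map_add, hΨ, hΦ]⟩
  · exact (sliceIsometry (α := α) (β := β)).isometry.isClosedEmbedding.isClosed_range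

/-- The identification of `L²(α × β)` with `L²(α; L²(β))`. -/
noncomputable def sliceEquiv [SecondCountableTopology (L2 β)] :
    L2 (α × β) ≃ₗᵢ[ℂ] Lp (L2 β) 2 (volume : Measure α) :=
  LinearIsometryEquiv.ofSurjective sliceIsometry sliceIsometry_surjective

theorem coeFn_sliceEquiv [SecondCountableTopology (L2 β)] (Ψ : L2 (α × β)) :
    sliceEquiv Ψ =ᵐ[volume] slice Ψ := coeFn_sliceIsometry Ψ

theorem ext_slice [SecondCountableTopology (L2 β)] {Ψ Φ : L2 (α × β)}
    (h : ∀ᵐ a, slice Ψ a = slice Φ a) : Ψ = Φ := by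
  refine sliceEquiv.injective (Lp.ext ?_)
  filter_upwards [h, coeFn_sliceEquiv Ψ, coeFn_sliceEquiv Φ] with a h1 h2 h3
  rw [h2, h3, h1]

/-! ### Decomposable operators -/

/-- A map continuous in the vector and measurable in the parameter is jointly measurable, so it may
be evaluated along a measurable field of vectors. -/
theorem stronglyMeasurable_family_comp {X : Type*} [NormedAddCommGroup X] [NormedSpace ℂ X]
    [SecondCountableTopology X] {W : α → X → X} (hW : ∀ ψ, StronglyMeasurable fun a => W a ψ)
    (hc : ∀ a, Continuous (W a)) {F : α → X} (hF : StronglyMeasurable F) :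
    StronglyMeasurable fun a => W a (F a) := by
  borelize X
  have h := stronglyMeasurable_uncurry_of_continuous_of_stronglyMeasurable
    (u := fun (ψ : X) (a : α) => W a ψ) hc hW
  exact h.comp_measurable (hF.measurable.prodMk measurable_id)

theorem memLp_family_comp {X : Type*} [NormedAddCommGroup X] [NormedSpace ℂ X]
    [SecondCountableTopology X] {W : α → (X ≃ₗᵢ[ℂ] X)}
    (hW : ∀ ψ, StronglyMeasurable fun a => W a ψ) (F : Lp X 2 (volume : Measure α)) :
    MemLp (fun a => W a (F a)) 2 (volume : Measure α) := by
  have hm : AEStronglyMeasurable (fun a => W a (F a)) (volume : Measure α) :=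
    (stronglyMeasurable_family_comp hW (fun a => (W a).continuous)
      (Lp.stronglyMeasurable F)).aestronglyMeasurable
  exact (Lp.memLp F).of_le hm (ae_of_all _ fun a => ((W a).norm_map _).le)

/-- The decomposable unitary operator with the components `W a`. -/
noncomputable def pointwiseEquiv {X : Type*} [NormedAddCommGroup X] [NormedSpace ℂ X]
    [SecondCountableTopology X] (W : α → (X ≃ₗᵢ[ℂ] X))
    (hW : ∀ ψ, StronglyMeasurable fun a => W a ψ)
    (hW' : ∀ ψ, StronglyMeasurable fun a => (W a).symm ψ) :
    Lp X 2 (volume : Measure α) ≃ₗᵢ[ℂ] Lp X 2 (volume : Measure α) where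
  toFun F := (memLp_family_comp hW F).toLp _
  invFun F := (memLp_family_comp hW' F).toLp _
  left_inv F := by
    refine Lp.ext ?_
    filter_upwards [(memLp_family_comp hW' ((memLp_family_comp hW F).toLp _)).coeFn_toLp,
      (memLp_family_comp hW F).coeFn_toLp] with a h1 h2
    rw [h1, h2, LinearIsometryEquiv.symm_apply_apply]
  right_inv F := by
    refine Lp.ext ?_
    filter_upwards [(memLp_family_comp hW ((memLp_family_comp hW' F).toLp _)).coeFn_toLp,
      (memLp_family_comp hW' F).coeFn_toLp] with a h1 h2
    rw [h1, h2, LinearIsometryEquiv.apply_symm_apply]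
  map_add' F G := by
    rw [← MemLp.toLp_add, MemLp.toLp_eq_toLp_iff]
    filter_upwards [Lp.coeFn_add F G] with a ha
    rw [ha, Pi.add_apply, map_add, Pi.add_apply]
  map_smul' c F := by
    rw [RingHom.id_apply, ← MemLp.toLp_const_smul, MemLp.toLp_eq_toLp_iff]
    filter_upwards [Lp.coeFn_smul c F] with a ha
    rw [ha, Pi.smul_apply, map_smul, Pi.smul_apply]
  norm_map' F := by
    change ‖(memLp_family_comp hW F).toLp _‖ = ‖F‖
    refine le_antisymm (Lp.norm_le_norm_of_ae_le ?_) (Lp.norm_le_norm_of_ae_le ?_) <;>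
    · filter_upwards [(memLp_family_comp hW F).coeFn_toLp] with a ha
      rw [ha, (W a).norm_map]

/-- Direct integrals of strongly measurable families of unitary operators. -/
theorem exists_directIntegral [SecondCountableTopology (L2 β)] (W : α → (L2 β ≃ₗᵢ[ℂ] L2 β))
    (hW : ∀ ψ, StronglyMeasurable fun a => W a ψ)
    (hW' : ∀ ψ, StronglyMeasurable fun a => (W a).symm ψ) :
    ∃ T : L2 (α × β) ≃ₗᵢ[ℂ] L2 (α × β), ∀ Ψ, ∀ᵐ a, slice (T Ψ) a = W a (slice Ψ a) := by
  refine ⟨(sliceEquiv.trans (pointwiseEquiv W hW hW')).trans sliceEquiv.symm, fun Ψ => ?_⟩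
  filter_upwards [coeFn_sliceEquiv Ψ, (memLp_family_comp hW (sliceEquiv Ψ)).coeFn_toLp,
    coeFn_sliceEquiv (sliceEquiv.symm (pointwiseEquiv W hW hW' (sliceEquiv Ψ)))] with a h1 h2 h3
  rw [LinearIsometryEquiv.apply_symm_apply] at h3
  rw [← h1]
  exact h3.symm.trans h2

end L2

instance instSecondCountableL2 {α : Type*} [MeasureSpace α] [IsSeparable (volume : Measure α)] :
    SecondCountableTopology (L2 α) :=
  haveI : Fact ((2 : ENNReal) ≠ ⊤) := ⟨ENNReal.ofNat_ne_top⟩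
  Lp.SecondCountableTopology

/-! ### Directional derivatives -/

section Directional

variable {X Y : Type*} [NormedAddCommGroup X] [NormedSpace ℝ X] [NormedAddCommGroup Y]
  [NormedSpace ℝ Y]

/-- The derivative in the direction of `v`. -/
noncomputable def dird (v : X) (f : X → ℂ) : X → ℂ := fun x => fderiv ℝ f x v

theorem ContDiff.dird {f : X → ℂ} (hf : ContDiff ℝ ∞ f) (v : X) : ContDiff ℝ ∞ (dird v f) :=
  (hf.fderiv_right (m := ∞) (by simp)).clm_apply contDiff_const

theorem tsupport_dird_subset (v : X) (f : X → ℂ) : tsupport (dird v f) ⊆ tsupport f :=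
  tsupport_fderiv_apply_subset ℝ v

theorem contDiff_infty_differentiable {f : X → ℂ} (hf : ContDiff ℝ ∞ f) : Differentiable ℝ f :=
  hf.differentiable (by simp)

theorem dird_mul {f g : X → ℂ} (hf : ContDiff ℝ ∞ f) (hg : ContDiff ℝ ∞ g) (v : X) :
    dird v (fun x => f x * g x) = fun x => f x * dird v g x + dird v f x * g x := by
  funext x
  rw [dird, fderiv_fun_mul (contDiff_infty_differentiable hf x)
    (contDiff_infty_differentiable hg x)]
  simp [dird, mul_comm]

theorem dird_comp_affine {f : Y → ℂ} (hf : ContDiff ℝ ∞ f) (c : Y) (L : X →L[ℝ] Y) (v : X) :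
    dird v (fun x => f (c + L x)) = fun x => dird (L v) f (c + L x) := by
  funext x
  have h1 : HasFDerivAt (fun x => c + L x) L x := (L.hasFDerivAt).const_add c
  have h2 := ((contDiff_infty_differentiable hf (c + L x)).hasFDerivAt).comp x h1
  rw [dird]
  erw [h2.fderiv]
  rfl

theorem dird_sum {ι : Type*} (s : Finset ι) (c : ι → ℝ) (v : ι → X) (f : X → ℂ) :
    dird (∑ i ∈ s, c i • v i) f = fun x => ∑ i ∈ s, (c i : ℂ) * dird (v i) f x := by
  funext x
  simp [dird]

theorem dird_finset_sum {ι : Type*} (s : Finset ι) (c : ι → ℂ) {f : ι → X → ℂ}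
    (hf : ∀ i, ContDiff ℝ ∞ (f i)) (v : X) :
    dird v (fun x => ∑ i ∈ s, c i * f i x) = fun x => ∑ i ∈ s, c i * dird v (f i) x := by
  funext x
  rw [dird, fderiv_fun_sum fun i _ => (contDiff_infty_differentiable (hf i) x).const_mul (c i)]
  simp only [sum_apply, dird]
  refine Finset.sum_congr rfl fun i _ => ?_
  rw [fderiv_const_mul (contDiff_infty_differentiable (hf i) x)]
  simp

/-- `Config n` carries the supremum norm, not an inner product, so changes of variables are computed
with directional derivatives: the Laplacian is a sum over an orthonormal basis, whose vectors the
linear part pushes forward. -/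
theorem laplacian_comp_affine {X : Type*} [NormedAddCommGroup X] [InnerProductSpace ℝ X]
    [FiniteDimensional ℝ X] {ι : Type*} [Fintype ι] (b : OrthonormalBasis ι ℝ X)
    {f : Y → ℂ} (hf : ContDiff ℝ ∞ f) (c : Y) (L : X →L[ℝ] Y) (x : X) :
    Laplacian.laplacian (fun y => f (c + L y)) x =
      ∑ i, dird (L (b i)) (dird (L (b i)) f) (c + L x) := by
  have hg : ContDiff ℝ ∞ (fun y => f (c + L y)) := by fun_prop
  rw [InnerProductSpace.laplacian_eq_iteratedFDeriv_orthonormalBasis _ b]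
  refine Finset.sum_congr rfl fun i _ => ?_
  have h1 : dird (b i) (dird (b i) fun y => f (c + L y)) x =
      dird (L (b i)) (dird (L (b i)) f) (c + L x) := by
    rw [dird_comp_affine hf, dird_comp_affine (ContDiff.dird hf _)]
  rw [← h1, iteratedFDeriv_two_apply]
  change fderiv ℝ (fderiv ℝ _) x (b i) (b i) = fderiv ℝ (fun y => fderiv ℝ _ y (b i)) x (b i)
  have h2 : DifferentiableAt ℝ (fderiv ℝ fun y => f (c + L y)) x :=
    (hg.fderiv_right (m := ∞) (by simp)).differentiable (by simp) x
  rw [fderiv_clm_apply h2 (differentiableAt_const _)]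
  simp

end Directional

/-! ### Schrödinger operators -/

section Schrodinger

open Filter Topology

variable {n : ℕ}

/-- The basis is left free so that it can be rotated when invariance under rotations is proved. -/
theorem partialLaplacian_eq {ι : Type*} [Fintype ι] (b : OrthonormalBasis ι ℝ E3) (k : Fin n)
    {f : Config n → ℂ} (hf : ContDiff ℝ ∞ f) (x : Config n) :
    partialLaplacian k f x = ∑ i, dird (Pi.single k (b i)) (dird (Pi.single k (b i)) f) x := by
  have h := laplacian_comp_affine b hf (Function.update x k 0)
    (ContinuousLinearMap.single ℝ (fun _ : Fin n => E3) k) (x k)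
  have e : ∀ y : E3, Function.update x k 0 + ContinuousLinearMap.single ℝ (fun _ : Fin n => E3) k y
      = Function.update x k y := by
    intro y
    funext j
    by_cases hj : j = k
    · subst hj; simp
    · simp [hj]
  simp only [e, Function.update_eq_self] at h
  exact h

theorem contDiff_partialLaplacian (k : Fin n) {f : Config n → ℂ} (hf : ContDiff ℝ ∞ f) :
    ContDiff ℝ ∞ (partialLaplacian k f) := by
  have e := funext fun x => partialLaplacian_eq (stdOrthonormalBasis ℝ E3) k hf x
  rw [e]
  exact ContDiff.sum fun i _ => ContDiff.dird (ContDiff.dird hf _) _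

theorem partialLaplacian_eq_zero (k : Fin n) {f : Config n → ℂ} (hf : ContDiff ℝ ∞ f)
    {x : Config n} (hx : x ∉ tsupport f) : partialLaplacian k f x = 0 := by
  rw [partialLaplacian_eq (stdOrthonormalBasis ℝ E3) k hf]
  refine Finset.sum_eq_zero fun i _ => image_eq_zero_of_notMem_tsupport fun h => hx ?_
  exact tsupport_dird_subset _ _ (tsupport_dird_subset _ _ h)

theorem IsTest.partialLaplacian {f : Config n → ℂ} (hf : IsTest f) (k : Fin n) :
    IsTest (GalileiMass.partialLaplacian k f) := by
  refine ⟨contDiff_partialLaplacian k hf.1, HasCompactSupport.intro hf.2 fun x hx => ?_⟩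
  exact partialLaplacian_eq_zero k hf.1 hx

theorem IsTest.memLp {f : Config n → ℂ} (hf : IsTest f) :
    MemLp f 2 (volume : Measure (Config n)) :=
  hf.1.continuous.memLp_of_hasCompactSupport hf.2

variable {m : Fin n → ℝ} {V : Config n → ℝ}

/-- The relation is single valued: a continuous function vanishing almost everywhere vanishes
identically, so an L² class has at most one test representative. -/
theorem schrodinger_graph : (schrodinger m V).graph = schrodingerGraph m V := by
  refine Submodule.toLinearPMap_graph_eq _ ?_
  rintro ⟨ψ, χ⟩ ⟨f, hf, h1, h2⟩ h0
  simp only at h0 h1 h2 ⊢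
  subst h0
  have h3 : f = 0 := by
    refine (hf.1.continuous.ae_eq_iff_eq volume continuous_zero).1 ?_
    exact h1.symm.trans (Lp.coeFn_zero _ _ _)
  have h4 : schrodingerFun m V f = 0 := by
    funext x
    simpa [h3] using schrodingerFun_smul m V 0 (f := 0) contDiff_const x
  rw [h4] at h2
  exact Lp.ext (h2.trans (Lp.coeFn_zero _ _ _).symm)

theorem mem_schrodingerGraph (h : IsEssSelfAdjoint m V) {f : Config n → ℂ} (hf : IsTest f) :
    (toL2 f, toL2 (schrodingerFun m V f)) ∈ schrodingerGraph m V :=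
  ⟨f, hf, coeFn_toL2 hf.memLp, coeFn_toL2 (h.1 f hf)⟩

theorem graph_closure_schrodinger (h : IsEssSelfAdjoint m V) :
    ((schrodinger m V).closure.graph : Set (L2 (Config n) × L2 (Config n))) =
      closure (schrodingerGraph m V : Set (L2 (Config n) × L2 (Config n))) := by
  have hc : (schrodinger m V).IsClosable := by
    -- For a non-closable operator `closure` is by default the operator itself. Being self-adjoint
    -- it would be closed, hence closable after all.
    by_contra hn
    have h1 := h.2.isClosed
    rw [LinearPMap.closure_def' hn] at h1
    exact hn h1.isClosable
  rw [← hc.graph_closure_eq_closure_graph, schrodinger_graph]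
  rfl

theorem mem_graph_closure (h : IsEssSelfAdjoint m V) {f : Config n → ℂ} (hf : IsTest f) :
    (toL2 f, toL2 (schrodingerFun m V f)) ∈ (schrodinger m V).closure.graph := by
  rw [← SetLike.mem_coe, graph_closure_schrodinger h]
  exact subset_closure (mem_schrodingerGraph h hf)

theorem isUnitaryGroupOf_evolution (h : IsEssSelfAdjoint m V) :
    IsUnitaryGroupOf (schrodinger m V).closure (evolution m V) :=
  isUnitaryGroupOf_unitaryGroup h.2

theorem evolution_add (h : IsEssSelfAdjoint m V) (s t : ℝ) :
    evolution m V (s + t) = evolution m V s * evolution m V t :=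
  (isUnitaryGroupOf_evolution h).1 s t

theorem hasDerivAt_evolution (h : IsEssSelfAdjoint m V) {f : Config n → ℂ} (hf : IsTest f) :
    HasDerivAt (fun t => evolution m V t (toL2 f)) (-Complex.I • toL2 (schrodingerFun m V f)) 0 :=
  ((isUnitaryGroupOf_evolution h).2.2 _ _).1 (mem_graph_closure h hf)

/-- A one-parameter unitary group with the right derivative on the test functions is the time
evolution. -/
theorem eq_evolution (h : IsEssSelfAdjoint m V) {U : ℝ → (L2 (Config n) ≃ₗᵢ[ℂ] L2 (Config n))}
    (hU : ∀ s t : ℝ, U (s + t) = U s * U t)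
    (hd : ∀ f : Config n → ℂ, IsTest f →
      HasDerivAt (fun t => U t (toL2 f)) (-Complex.I • toL2 (schrodingerFun m V f)) 0) :
    U = evolution m V := by
  refine (isUnitaryGroupOf_evolution h).unique h.2 (isUnitaryGroupOf_of_core h.2 hU
    (G := schrodingerGraph m V) (graph_closure_schrodinger h).le ?_)
  rintro ψ χ ⟨f, hf, h1, h2⟩
  have e1 : toL2 f = ψ := toL2_eq_of_ae h1.symm
  have e2 : toL2 (schrodingerFun m V f) = χ := toL2_eq_of_ae h2.symm
  rw [← e1, ← e2]
  exact hd f hf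

/-! ### A countable core -/

/-- Test functions supported in a fixed ball embed, through f and all Δ_k f, in a separable space of
continuous functions. A dense sequence in each image, over integer radii, approximates f and its
Laplacians uniformly with common support, independently of masses and potential. -/
theorem exists_countable_core (n : ℕ) : ∃ D : ℕ → Config n → ℂ, (∀ j, IsTest (D j)) ∧
    ∀ f, IsTest f → ∃ r : ℝ, ∀ ε > 0, ∃ j,
      (∀ x, x ∉ Metric.closedBall 0 r → D j x = 0 ∧ f x = 0 ∧
        ∀ k, partialLaplacian k (D j) x = 0 ∧ partialLaplacian k f x = 0) ∧
      ∀ x, ‖D j x - f x‖ ≤ ε ∧ ∀ k, ‖partialLaplacian k (D j) x - partialLaplacian k f x‖ ≤ ε := by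
  let T : ℕ → Type := fun r => {f : Config n → ℂ // IsTest f ∧
    tsupport f ⊆ Metric.closedBall 0 (r : ℝ)}
  let Φ : ∀ r : ℕ, T r → C(Metric.closedBall (0 : Config n) (r : ℝ), ℂ × (Fin n → ℂ)) := fun r f =>
    ⟨fun x => (f.1 x, fun k => partialLaplacian k f.1 x), by
      have h1 := f.2.1.1.continuous
      have h2 : ∀ k, Continuous (partialLaplacian k f.1) := fun k =>
        (contDiff_partialLaplacian k f.2.1.1).continuous
      fun_prop⟩
  have hne : ∀ r, Nonempty (Set.range (Φ r)) := fun r =>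
    ⟨⟨_, ⟨⟨0, ⟨contDiff_const, HasCompactSupport.zero⟩, by simp [tsupport]⟩, rfl⟩⟩⟩
  have hD : ∀ r j, ∃ f : T r, Φ r f = TopologicalSpace.denseSeq (Set.range (Φ r)) j := fun r j =>
    (TopologicalSpace.denseSeq (Set.range (Φ r)) j).2
  choose D hD using hD
  let D' : ℕ × ℕ → Config n → ℂ := fun p => (D p.1 p.2).1
  refine ⟨fun j => D' j.unpair, fun j => (D j.unpair.1 j.unpair.2).2.1,
    fun f hf => ?_⟩
  obtain ⟨r0, hr0⟩ := hf.2.isBounded.subset_closedBall 0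
  obtain ⟨r, hr⟩ := exists_nat_ge r0
  have hfr : tsupport f ⊆ Metric.closedBall 0 (r : ℝ) :=
    hr0.trans (Metric.closedBall_subset_closedBall hr)
  refine ⟨r, fun ε hε => ?_⟩
  obtain ⟨j, hj⟩ := (TopologicalSpace.denseRange_denseSeq (Set.range (Φ r))).exists_dist_lt
    ⟨Φ r ⟨f, hf, hfr⟩, ⟨_, rfl⟩⟩ hε
  have hj' : dist (Φ r ⟨f, hf, hfr⟩) (Φ r (D r j)) < ε := by rw [hD]; exact hj
  refine ⟨Nat.pair r j, ?_⟩
  rw [show (fun j : ℕ => D' j.unpair) (Nat.pair r j) = (D r j).1 by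
    change D' (Nat.pair r j).unpair = _
    rw [Nat.unpair_pair]]
  have hz : ∀ g : T r, ∀ x, x ∉ Metric.closedBall (0 : Config n) (r : ℝ) → g.1 x = 0 ∧
      ∀ k, partialLaplacian k g.1 x = 0 := fun g x hx =>
    have hx' : x ∉ tsupport g.1 := fun h => hx (g.2.2 h)
    ⟨image_eq_zero_of_notMem_tsupport hx', fun k => partialLaplacian_eq_zero k g.2.1.1 hx'⟩
  have hz1 := hz (D r j)
  have hz2 := hz ⟨f, hf, hfr⟩
  refine ⟨fun x hx => ⟨(hz1 x hx).1, (hz2 x hx).1, fun k => ⟨(hz1 x hx).2 k, (hz2 x hx).2 k⟩⟩,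
    fun x => ?_⟩
  by_cases hx : x ∈ Metric.closedBall (0 : Config n) (r : ℝ)
  · have h1 := ((ContinuousMap.dist_lt_iff hε).1 hj' ⟨x, hx⟩).le
    rw [dist_comm, Prod.dist_eq, max_le_iff] at h1
    refine ⟨by rw [← dist_eq_norm]; exact h1.1, fun k => ?_⟩
    rw [← dist_eq_norm]
    exact (dist_pi_le_iff hε.le).1 h1.2 k
  · have h1 := hz1 x hx
    have h2 := hz2 x hx
    simp only at h2
    refine ⟨by rw [h1.1, h2.1]; simpa using hε.le, fun k => ?_⟩
    rw [h1.2, h2.2]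
    simpa using hε.le

/-- A countable set of test functions that is a core for all the operators
`-∑_k Δ_k / (2 m_k) + V`. -/
noncomputable def coreSeq (n : ℕ) : ℕ → Config n → ℂ := (exists_countable_core n).choose

theorem isTest_coreSeq (n j : ℕ) : IsTest (coreSeq n j) := (exists_countable_core n).choose_spec.1 j

/-- The potential is locally square integrable: the Hamiltonian maps a bump function equal to 1 on
the ball into L², and its kinetic part is square integrable too. -/
theorem memLp_indicator_potential (h : IsEssSelfAdjoint m V) (r : ℝ) :
    MemLp ((Metric.closedBall (0 : Config n) r).indicator fun x => (V x : ℂ)) 2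
      (volume : Measure (Config n)) := by
  let χ : ContDiffBump (0 : Config n) := ⟨|r| + 1, |r| + 2, by positivity, by linarith⟩
  have hχ : IsTest fun x => (χ x : ℂ) := by
    refine ⟨Complex.ofRealCLM.contDiff.comp χ.contDiff, ?_⟩
    exact χ.hasCompactSupport.comp_left (g := fun r : ℝ => (r : ℂ)) Complex.ofReal_zero
  have h1 := h.1 _ hχ
  have h2 : MemLp (fun x => ∑ k, (1 / (2 * (m k : ℂ))) * partialLaplacian k (fun x => (χ x : ℂ)) x)
      2 (volume : Measure (Config n)) :=
    memLp_finsetSum _ fun k _ => (hχ.partialLaplacian k).memLp.const_mul _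
  have h3 := (h1.add h2).indicator (s := Metric.closedBall (0 : Config n) r) measurableSet_closedBall
  refine (memLp_congr_ae (Eventually.of_forall fun x => ?_)).1 h3
  by_cases hx : x ∈ Metric.closedBall (0 : Config n) r
  · have hx' : x ∈ Metric.closedBall (0 : Config n) χ.rIn :=
      Metric.closedBall_subset_closedBall ((le_abs_self r).trans (by simp [χ])) hx
    simp [hx, schrodingerFun, χ.one_of_mem_closedBall hx']
  · simp [hx]

theorem norm_toL2_sub_le {f g F : Config n → ℂ} (hf : MemLp f 2 (volume : Measure (Config n)))
    (hg : MemLp g 2 (volume : Measure (Config n))) (hF : MemLp F 2 (volume : Measure (Config n)))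
    {ε : ℝ} (h : ∀ x, ‖f x - g x‖ ≤ ε * ‖F x‖) : ‖toL2 f - toL2 g‖ ≤ ε * ‖toL2 F‖ := by
  refine Lp.norm_le_mul_norm_of_ae_le_mul ?_
  filter_upwards [Lp.coeFn_sub (toL2 f) (toL2 g), coeFn_toL2 hf, coeFn_toL2 hg, coeFn_toL2 hF]
    with x h1 h2 h3 h4
  rw [h1, Pi.sub_apply, h2, h3, h4]
  exact h x

/-- Uniform closeness on a ball becomes closeness in graph norm through the single L² majorant `F`,
which dominates the function, its Laplacians with their coefficients, and the potential term. -/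
theorem schrodingerGraph_subset_closure (h : IsEssSelfAdjoint m V) :
    ((schrodinger m V).closure.graph : Set (L2 (Config n) × L2 (Config n))) ⊆
      closure (Set.range fun j =>
        (toL2 (coreSeq n j), toL2 (schrodingerFun m V (coreSeq n j)))) := by
  rw [graph_closure_schrodinger h]
  refine closure_minimal ?_ isClosed_closure
  rintro ⟨ψ, χ⟩ ⟨f, hf, h1, h2⟩
  have e1 : toL2 f = ψ := toL2_eq_of_ae h1.symm
  have e2 : toL2 (schrodingerFun m V f) = χ := toL2_eq_of_ae h2.symm
  rw [← e1, ← e2]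
  obtain ⟨r, hr⟩ := (exists_countable_core n).choose_spec.2 f hf
  set c : ℝ := ∑ k, ‖1 / (2 * (m k : ℂ))‖
  have hc : 0 ≤ c := Finset.sum_nonneg fun k _ => norm_nonneg _
  let F : Config n → ℂ := (Metric.closedBall (0 : Config n) r).indicator fun x =>
    ((1 + c + |V x| : ℝ) : ℂ)
  have hF : MemLp F 2 (volume : Measure (Config n)) := by
    have h3 : MemLp ((Metric.closedBall (0 : Config n) r).indicator fun _ => ((1 + c : ℝ) : ℂ)) 2
        (volume : Measure (Config n)) :=
      memLp_indicator_const 2 measurableSet_closedBall _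
        (Or.inr (isCompact_closedBall _ _).measure_lt_top.ne)
    refine (memLp_congr_ae (Eventually.of_forall fun x => ?_)).1
      (h3.add (memLp_indicator_potential h r).norm.ofReal)
    by_cases hx : x ∈ Metric.closedBall (0 : Config n) r
    · simp [F, hx]
    · simp [F, hx]
  rw [Metric.mem_closure_iff]
  intro ε hε
  -- The summand 1 in the denominator covers the case of a vanishing norm of `F`.
  obtain ⟨j, hj0, hj⟩ := hr (ε / (‖toL2 F‖ + 1)) (by positivity)
  set δ := ε / (‖toL2 F‖ + 1)
  have hδ : 0 < δ := by positivity
  have hδF : δ * ‖toL2 F‖ < ε := by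
    rw [div_mul_eq_mul_div, div_lt_iff₀ (by positivity)]
    nlinarith
  refine ⟨_, ⟨j, rfl⟩, ?_⟩
  rw [Prod.dist_eq, max_lt_iff]
  have hFx : ∀ x ∈ Metric.closedBall (0 : Config n) r, ‖F x‖ = 1 + c + |V x| := by
    intro x hx
    simp only [F, Set.indicator_of_mem hx, Complex.norm_real, Real.norm_eq_abs]
    exact abs_of_nonneg (by positivity)
  have hcore : coreSeq n j = (exists_countable_core n).choose j := rfl
  rw [← hcore] at hj0 hj
  constructor
  · rw [dist_comm, dist_eq_norm]
    refine (norm_toL2_sub_le (isTest_coreSeq n j).memLp hf.memLp hF fun x => ?_).trans_lt hδF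
    by_cases hx : x ∈ Metric.closedBall (0 : Config n) r
    · rw [hFx x hx]
      refine (hj x).1.trans (le_mul_of_one_le_right hδ.le ?_)
      have := abs_nonneg (V x)
      linarith
    · rw [(hj0 x hx).1, (hj0 x hx).2.1]
      simp only [sub_self, norm_zero]
      positivity
  · rw [dist_comm, dist_eq_norm]
    refine (norm_toL2_sub_le (h.1 _ (isTest_coreSeq n j)) (h.1 _ hf) hF fun x => ?_).trans_lt hδF
    by_cases hx : x ∈ Metric.closedBall (0 : Config n) r
    · rw [hFx x hx]
      have e : schrodingerFun m V (coreSeq n j) x - schrodingerFun m V f x =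
          -(∑ k, (1 / (2 * (m k : ℂ))) *
            (partialLaplacian k (coreSeq n j) x - partialLaplacian k f x))
          + (V x : ℂ) * (coreSeq n j x - f x) := by
        simp only [schrodingerFun, mul_sub, Finset.sum_sub_distrib]
        ring
      rw [e]
      refine (norm_add_le _ _).trans ?_
      rw [norm_neg, norm_mul, Complex.norm_real, Real.norm_eq_abs]
      have h1 : ‖∑ k, (1 / (2 * (m k : ℂ))) *
            (partialLaplacian k (coreSeq n j) x - partialLaplacian k f x)‖ ≤ c * δ := by
        rw [Finset.sum_mul]
        refine (norm_sum_le _ _).trans (Finset.sum_le_sum fun k _ => ?_)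
        rw [norm_mul]
        exact mul_le_mul_of_nonneg_left ((hj x).2 k) (norm_nonneg _)
      have h2 := mul_le_mul_of_nonneg_left (hj x).1 (abs_nonneg (V x))
      nlinarith
    · have h0 := hj0 x hx
      simp only [schrodingerFun, h0.1, h0.2.1, h0.2.2]
      simp only [mul_zero, sub_self, norm_zero]
      positivity

end Schrodinger

/-! ### Measurable families of self-adjoint operators -/

section Measurability

open Filter Topology

variable {α E : Type*} [MeasurableSpace α] [NormedAddCommGroup E] [InnerProductSpace ℂ E]
  [CompleteSpace E] [SecondCountableTopology E]

open Classical in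
/-- The family `B` on the set `G`, and `0` elsewhere. -/
noncomputable def cutFamily (G : Set α) (B : α → E →L[ℂ] E) (a : α) : E →L[ℂ] E :=
  if a ∈ G then B a else 0

omit [SecondCountableTopology E] in
-- If (A + il)u_j is within ε of ψ, then u_j is within ε/|l| of the resolvent at ψ. Since the u_j
-- are dense in the graph, the inequality becomes a countable union of conditions on the u_j alone.
theorem dist_resolv_lt_iff {A : E →ₗ.[ℂ] E} (hA : IsSelfAdjoint A) {u : ℕ → E × E}
    (hu : ∀ j, u j ∈ A.graph) (hd : (A.graph : Set (E × E)) ⊆ closure (Set.range u)) {l : ℝ}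
    (hl : l ≠ 0) (ψ g : E) (r : ℝ) :
    dist (resolv A l ψ) g < r ↔ ∃ j k : ℕ,
      dist ((u j).2 + (Complex.I * l) • (u j).1) ψ < 1 / (k + 1) ∧
      dist (u j).1 g + |l|⁻¹ * (1 / (k + 1)) < r := by
  have hl' : 0 < |l| := abs_pos.2 hl
  constructor
  · intro h
    set δ := r - dist (resolv A l ψ) g
    have hδ : 0 < δ := sub_pos.2 h
    obtain ⟨k, hk⟩ := exists_nat_one_div_lt (show 0 < δ / 2 * |l| by positivity)
    -- The divisor 1 + |l| bounds how much A + il can enlarge an error measured in the graph.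
    have hd' := Metric.mem_closure_iff.1 (hd (resolv_mem hA hl ψ))
      (min (δ / 2) (1 / (k + 1) / (1 + |l|))) (by positivity)
    obtain ⟨_, ⟨j, rfl⟩, hj⟩ := hd'
    rw [Prod.dist_eq, lt_min_iff, max_lt_iff, max_lt_iff] at hj
    obtain ⟨⟨h1, -⟩, h2, h3⟩ := hj
    refine ⟨j, k, ?_, ?_⟩
    · have e : (u j).2 + (Complex.I * l) • (u j).1 - ψ =
          ((u j).2 - (ψ - (Complex.I * l) • resolv A l ψ)) +
          (Complex.I * l) • ((u j).1 - resolv A l ψ) := by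
        rw [smul_sub]; abel
      rw [dist_comm, dist_eq_norm] at h2 h3
      rw [dist_eq_norm, e]
      refine (norm_add_le _ _).trans_lt ?_
      rw [norm_smul, norm_mul, Complex.norm_I, one_mul, Complex.norm_real, Real.norm_eq_abs]
      rw [lt_div_iff₀ (by positivity)] at h2 h3
      nlinarith
    · have h4 := dist_triangle_left (u j).1 g (resolv A l ψ)
      have h5 : |l|⁻¹ * (1 / (k + 1)) < δ / 2 := by
        rw [inv_mul_lt_iff₀ hl']
        linarith
      simp only [δ] at h1 h5
      linarith
  · rintro ⟨j, k, h1, h2⟩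
    have h3 := norm_resolv_le hA hl (ψ - ((u j).2 + (Complex.I * l) • (u j).1))
    rw [map_sub, resolv_eq hA hl (show ((u j).1, (u j).2) ∈ A.graph from hu j), ← dist_eq_norm,
      ← dist_eq_norm, dist_comm ψ] at h3
    have h4 := dist_triangle (resolv A l ψ) (u j).1 g
    have h5 : |l|⁻¹ * dist ((u j).2 + (Complex.I * l) • (u j).1) ψ ≤ |l|⁻¹ * (1 / (k + 1)) := by
      gcongr
    linarith

variable {G : Set α} (hG : MeasurableSet G) {A : α → E →ₗ.[ℂ] E}
  (hA : ∀ a ∈ G, IsSelfAdjoint (A a)) {u : ℕ → α → E × E}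
  (hum1 : ∀ j, StronglyMeasurable fun a => (u j a).1)
  (hum2 : ∀ j, StronglyMeasurable fun a => (u j a).2)
  (hu : ∀ j, ∀ a ∈ G, u j a ∈ (A a).graph)
  (hd : ∀ a ∈ G, ((A a).graph : Set (E × E)) ⊆ closure (Set.range fun j => u j a))

include hG hA hum1 hum2 hu hd in
theorem stronglyMeasurable_resolv {l : ℝ} (hl : l ≠ 0) (ψ : E) :
    StronglyMeasurable fun a => cutFamily G (fun a => resolv (A a) l) a ψ := by
  borelize E
  refine Measurable.stronglyMeasurable (measurable_of_measurable_dist fun g => ?_)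
  refine measurable_of_Iio fun r => ?_
  have e : (fun a => dist (cutFamily G (fun a => resolv (A a) l) a ψ) g) ⁻¹' Set.Iio r =
      (G ∩ ⋃ (j : ℕ) (k : ℕ), {a | dist ((u j a).2 + (Complex.I * l) • (u j a).1) ψ < 1 / (k + 1) ∧
        dist (u j a).1 g + |l|⁻¹ * (1 / (k + 1)) < r}) ∪ (Gᶜ ∩ {_a | ‖g‖ < r}) := by
    ext a
    by_cases ha : a ∈ G
    · simp only [Set.mem_preimage, Set.mem_Iio, cutFamily, if_pos ha,
        dist_resolv_lt_iff (hA a ha) (fun j => hu j a ha) (hd a ha) hl]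
      simp [ha]
    · simp [cutFamily, ha]
  rw [e]
  refine (hG.inter (MeasurableSet.iUnion fun j => MeasurableSet.iUnion fun k =>
    MeasurableSet.inter ?_ ?_)).union (hG.compl.inter (MeasurableSet.const _))
  · exact measurableSet_lt ((((hum2 j).add ((hum1 j).const_smul (Complex.I * (l : ℂ)))).dist
      stronglyMeasurable_const).measurable) measurable_const
  · exact measurableSet_lt ((((hum1 j).dist stronglyMeasurable_const).measurable).add_const _)
      measurable_const

omit [CompleteSpace E] in
theorem stronglyMeasurable_clm_pow {B : α → E →L[ℂ] E}
    (hB : ∀ ψ, StronglyMeasurable fun a => B a ψ) (k : ℕ) (ψ : E) :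
    StronglyMeasurable fun a => (B a ^ k) ψ := by
  induction k with
  | zero => simpa using stronglyMeasurable_const
  | succ k ih =>
    simp only [pow_succ', mul_apply_eq_comp]
    borelize E
    have h := stronglyMeasurable_uncurry_of_continuous_of_stronglyMeasurable
      (u := fun (ψ : E) (a : α) => B a ψ) (fun a => (B a).continuous) hB
    exact h.comp_measurable (ih.measurable.prodMk measurable_id)

/-- Powers stay measurable by evaluation of measurable operator families, and the exponential is the
pointwise limit of its partial sums. -/
theorem stronglyMeasurable_exp {B : α → E →L[ℂ] E}
    (hB : ∀ ψ, StronglyMeasurable fun a => B a ψ) (ψ : E) :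
    StronglyMeasurable fun a => NormedSpace.exp (B a) ψ := by
  refine stronglyMeasurable_of_tendsto atTop (f := fun (K : ℕ) a =>
    ∑ k ∈ Finset.range K, ((k.factorial : ℂ)⁻¹) • (B a ^ k) ψ) (fun K => ?_) ?_
  · exact Finset.stronglyMeasurable_fun_sum _ fun k _ =>
      (stronglyMeasurable_clm_pow hB k ψ).const_smul _
  · rw [tendsto_pi_nhds]
    intro a
    have h := (NormedSpace.exp_series_hasSum_exp' (𝕂 := ℂ) (B a)).tendsto_sum_nat
    have h2 := ((ContinuousLinearMap.apply ℂ E ψ).continuous.tendsto _).comp h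
    refine h2.congr fun K => ?_
    simp

include hG hA hum1 hum2 hu hd in
theorem stronglyMeasurable_yosida (n : ℕ) (ψ : E) :
    StronglyMeasurable fun a => cutFamily G (fun a => yosida (A a) n) a ψ := by
  have hn : (n + 1 : ℝ) ≠ 0 := by positivity
  have h1 := stronglyMeasurable_resolv hG hA hum1 hum2 hu hd hn ψ
  have h2 := stronglyMeasurable_resolv hG hA hum1 hum2 hu hd (neg_ne_zero.2 hn) ψ
  have h3 := (h1.add h2).const_smul (((n : ℂ) + 1) ^ 2 / 2)
  convert h3 using 2 with a
  by_cases ha : a ∈ G <;> simp [cutFamily, ha, yosida]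

open Classical in
include hG hA hum1 hum2 hu hd in
/-- The unitary groups of a family of self-adjoint operators with a measurable countable core
depend measurably on the parameter. -/
theorem stronglyMeasurable_unitaryGroup (t : ℝ) (ψ : E) :
    StronglyMeasurable fun a => (if a ∈ G then unitaryGroup (A a) t else 1) ψ := by
  refine stronglyMeasurable_of_tendsto atTop (f := fun (n : ℕ) a =>
    NormedSpace.exp (t • (-Complex.I • cutFamily G (fun a => yosida (A a) n) a)) ψ) (fun n => ?_) ?_
  · refine stronglyMeasurable_exp (fun χ => ?_) ψ
    exact ((stronglyMeasurable_yosida hG hA hum1 hum2 hu hd n χ).const_smul _).const_smul _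
  · rw [tendsto_pi_nhds]
    intro a
    by_cases ha : a ∈ G
    · simp only [ha, if_true, cutFamily]
      exact tendsto_yosidaGroup (hA a ha) t ψ
    · simp [ha, cutFamily]

end Measurability

/-! ### The time evolution on the extended space -/

section Evolution

open Filter Topology

variable {N : ℕ}

theorem fibre_eq_slice (Ψ : ExtendedSpace N) (m : Mass N) : fibre Ψ m = slice Ψ m := rfl

theorem measurable_schrodingerFun {V : Mass N → Config N → ℝ}
    (hV : Measurable (Function.uncurry V)) {f : Config N → ℂ} (hf : IsTest f) :
    Measurable fun q : Mass N × Config N => schrodingerFun q.1 (V q.1) f q.2 := by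
  have h1 : Measurable f := hf.1.continuous.measurable
  have h2 : ∀ k, Measurable (partialLaplacian k f) := fun k =>
    (contDiff_partialLaplacian k hf.1).continuous.measurable
  have h3 : Measurable fun q : Mass N × Config N => V q.1 q.2 := hV
  have h4 : ∀ k : Fin N, Measurable fun q : Mass N × Config N => q.1 k := fun k => by fun_prop
  unfold schrodingerFun
  fun_prop

/-- The set of good masses is not known to be measurable; it is shrunk so that families can be cut
off measurably. -/
theorem exists_measurable_conull {p : Mass N → Prop} (h : ∀ᵐ m, p m) :
    ∃ G : Set (Mass N), MeasurableSet G ∧ (∀ m ∈ G, p m) ∧ ∀ᵐ m, m ∈ G := by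
  obtain ⟨S, hS, hSm, hS0⟩ := exists_measurable_superset_of_null (ae_iff.1 h)
  refine ⟨Sᶜ, hSm.compl, fun m hm => ?_, ?_⟩
  · by_contra hp
    exact hm (hS hp)
  · rw [ae_iff]
    simpa using hS0

/-- The time evolution is a decomposable operator. -/
theorem exists_evolution {V : Mass N → Config N → ℝ} (hV : Measurable (Function.uncurry V))
    (hH : ∀ᵐ m : Mass N, IsEssSelfAdjoint m (V m)) :
    ∃ T : ℝ → (ExtendedSpace N ≃ₗᵢ[ℂ] ExtendedSpace N),
      ∀ t, IsDirectIntegral (fun m => evolution m (V m) t) (T t) := by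
  classical
  obtain ⟨G, hG, hGp, hGae⟩ := exists_measurable_conull hH
  -- Outside `G` the evolution is replaced by the identity, giving a family that is unitary and
  -- measurable at every mass.
  let W : ℝ → Mass N → (L2 (Config N) ≃ₗᵢ[ℂ] L2 (Config N)) := fun t m =>
    if m ∈ G then evolution m (V m) t else 1
  have hW : ∀ t ψ, StronglyMeasurable fun m => W t m ψ := fun t ψ =>
    stronglyMeasurable_unitaryGroup hG (A := fun m : Mass N => (schrodinger m (V m)).closure)
      (fun m hm => (hGp m hm).2)
      (u := fun j m => (toL2 (coreSeq N j), toL2 (schrodingerFun m (V m) (coreSeq N j))))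
      (fun j => stronglyMeasurable_const)
      (fun j => stronglyMeasurable_toL2_slice (measurable_schrodingerFun hV (isTest_coreSeq N j)))
      (fun j m hm => mem_graph_closure (hGp m hm) (isTest_coreSeq N j))
      (fun m hm => schrodingerGraph_subset_closure (hGp m hm)) t ψ
  have hsymm : ∀ t m, (W t m).symm = W (-t) m := by
    intro t m
    by_cases hm : m ∈ G
    · simp only [W, hm, if_true]
      refine LinearIsometryEquiv.ext fun ψ => ?_
      rw [LinearIsometryEquiv.symm_apply_eq]
      have := group_neg (evolution_add (hGp m hm)) (-t) ψ
      rw [neg_neg] at this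
      exact this.symm
    · simp only [W, hm, if_false]
      rfl
  have h := fun t => exists_directIntegral (W t) (hW t) (fun ψ => by
    simp only [hsymm]; exact hW (-t) ψ)
  choose T hT using h
  refine ⟨T, fun t Ψ => ?_⟩
  filter_upwards [hT t Ψ, hGae] with m h1 h2
  rw [fibre_eq_slice, h1]
  simp only [W, h2, if_true]
  rfl

end Evolution

/-! ### Rigid motions -/

section Rigid

open Filter Topology

variable {α β : Type*} [MeasureSpace α] [MeasureSpace β]

theorem compEquiv_toL2 (e : α ≃ᵐ β) (he : MeasurePreserving e) {f : β → ℂ}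
    (hf : MemLp f 2 (volume : Measure β)) : compEquiv e he (toL2 f) = toL2 fun x => f (e x) :=
  toL2_congr (he.quasiMeasurePreserving.ae (coeFn_toL2 hf))

theorem phaseMul_toL2 (θ : α → ℝ) (hθ : Measurable θ) {f : α → ℂ}
    (hf : MemLp f 2 (volume : Measure α)) :
    phaseMul θ hθ (toL2 f) = toL2 fun x => Complex.exp (Complex.I * (θ x : ℂ)) * f x := by
  refine toL2_congr ?_
  filter_upwards [coeFn_toL2 hf] with x hx
  rw [hx]

theorem toL2_add {f g : α → ℂ} (hf : MemLp f 2 (volume : Measure α))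
    (hg : MemLp g 2 (volume : Measure α)) : toL2 (fun x => f x + g x) = toL2 f + toL2 g := by
  refine toL2_eq_of_ae ?_
  filter_upwards [Lp.coeFn_add (toL2 f) (toL2 g), coeFn_toL2 hf, coeFn_toL2 hg] with x h1 h2 h3
  rw [h1, Pi.add_apply, h2, h3]

theorem toL2_const_mul (c : ℂ) {f : α → ℂ} (hf : MemLp f 2 (volume : Measure α)) :
    toL2 (fun x => c * f x) = c • toL2 f := by
  refine toL2_eq_of_ae ?_
  filter_upwards [Lp.coeFn_smul c (toL2 f), coeFn_toL2 hf] with x h1 h2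
  rw [h1, Pi.smul_apply, h2, smul_eq_mul]

/-- Rotations as linear isometries. -/
noncomputable def rotE (R : SO3) : E3 ≃ₗᵢ[ℝ] E3 where
  toFun := rot R
  invFun := rot R⁻¹
  left_inv := rot_inv_rot R
  right_inv := rot_rot_inv R
  map_add' := rot_add R
  map_smul' a x := by simpa using rot_smul R a x
  norm_map' x := by
    change ‖rot R x‖ = ‖x‖
    rw [← sq_eq_sq₀ (norm_nonneg _) (norm_nonneg _), ← real_inner_self_eq_norm_sq,
      ← real_inner_self_eq_norm_sq, inner_rot_rot]

theorem rotE_apply (R : SO3) (x : E3) : rotE R x = rot R x := rfl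

variable {n : ℕ}

/-- The rigid motion `x_k ↦ R x_k + a` of a configuration. -/
noncomputable def rigid (n : ℕ) (R : SO3) (a : E3) : Config n ≃ₜ Config n :=
  Homeomorph.piCongrRight fun _ => (rotE R).toHomeomorph.trans (Homeomorph.addRight a)

theorem measurePreserving_rigid (R : SO3) (a : E3) :
    MeasurePreserving (rigid n R a).toMeasurableEquiv := by
  have h : MeasurePreserving (fun x : E3 => rot R x + a) :=
    (measurePreserving_add_right volume a).comp (rotE R).measurePreserving
  exact volume_preserving_pi fun _ => h

/-- `ψ ↦ ψ({R x_k + a})`. -/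
noncomputable def moveOp (n : ℕ) (R : SO3) (a : E3) : L2 (Config n) ≃ₗᵢ[ℂ] L2 (Config n) :=
  compEquiv (rigid n R a).toMeasurableEquiv (measurePreserving_rigid R a)

theorem moveOp_ae (R : SO3) (a : E3) (ψ : L2 (Config n)) :
    moveOp n R a ψ =ᵐ[volume] fun x => ψ fun k => rot R (x k) + a :=
  compEquiv_ae _ _ ψ

theorem moveOp_toL2 (R : SO3) (a : E3) {f : Config n → ℂ}
    (hf : MemLp f 2 (volume : Measure (Config n))) :
    moveOp n R a (toL2 f) = toL2 fun x => f fun k => rot R (x k) + a :=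
  compEquiv_toL2 _ _ hf

theorem ae_rigid (R : SO3) (a : E3) {p : Config n → Prop} (h : ∀ᵐ x, p x) :
    ∀ᵐ x : Config n, p fun k => rot R (x k) + a :=
  (measurePreserving_rigid R a).quasiMeasurePreserving.ae h

theorem moveOp_moveOp (R S : SO3) (a b : E3) (ψ : L2 (Config n)) :
    moveOp n R a (moveOp n S b ψ) = moveOp n (S * R) (rot S a + b) ψ := by
  refine Lp.ext ?_
  filter_upwards [moveOp_ae R a (moveOp n S b ψ), ae_rigid R a (moveOp_ae S b ψ),
    moveOp_ae (S * R) (rot S a + b) ψ] with x h1 h2 h3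
  rw [h1, h2, h3]
  simp only [rot_mul, rot_add, add_assoc]

/-- The linear part of a rigid motion. -/
noncomputable def rotConfig (n : ℕ) (R : SO3) : Config n →L[ℝ] Config n :=
  ContinuousLinearMap.pi fun k => ((rotE R).toContinuousLinearEquiv : E3 →L[ℝ] E3).comp
    (ContinuousLinearMap.proj k)

theorem rigid_eq_affine (R : SO3) (a : E3) (x : Config n) :
    (fun k => rot R (x k) + a) = (fun _ => a) + rotConfig n R x := by
  funext k
  exact add_comm _ _

theorem IsTest.rigid {f : Config n → ℂ} (hf : IsTest f) (R : SO3) (a : E3) :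
    IsTest fun x => f fun k => rot R (x k) + a := by
  refine ⟨?_, hf.2.comp_homeomorph (GalileiMass.rigid n R a)⟩
  simp only [rigid_eq_affine]
  have := hf.1
  fun_prop

/-- The right-hand Laplacian is evaluated in the rotated basis R b_i, to which the motion carries
b_i. -/
theorem partialLaplacian_rigid (k : Fin n) {f : Config n → ℂ} (hf : ContDiff ℝ ∞ f) (R : SO3)
    (a : E3) (x : Config n) : partialLaplacian k (fun x => f fun k => rot R (x k) + a) x =
      partialLaplacian k f fun k => rot R (x k) + a := by
  have hg : ContDiff ℝ ∞ (fun x => f ((fun _ => a) + rotConfig n R x)) := by fun_prop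
  have hL : ∀ u : E3, rotConfig n R (Pi.single k u) = Pi.single k (rot R u) := by
    intro u
    funext j
    change rot R ((Pi.single k u : Config n) j) = (Pi.single k (rot R u) : Config n) j
    by_cases hj : j = k
    · subst hj; simp
    · simp [hj, rot_zero]
  simp only [rigid_eq_affine]
  rw [partialLaplacian_eq (stdOrthonormalBasis ℝ E3) k hg,
    partialLaplacian_eq ((stdOrthonormalBasis ℝ E3).map (rotE R)) k hf]
  refine Finset.sum_congr rfl fun i _ => ?_
  rw [dird_comp_affine hf, dird_comp_affine (ContDiff.dird hf _), hL]
  rfl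

/-- The potential is invariant under rigid motions. -/
def IsInvariant (V : Config n → ℝ) : Prop :=
  ∀ (R : SO3) (a : E3) (x : Config n), V (fun k => rot R (x k) + a) = V x

variable {m : Fin n → ℝ} {V : Config n → ℝ}

theorem schrodingerFun_rigid (hV : IsInvariant V) {f : Config n → ℂ} (hf : ContDiff ℝ ∞ f)
    (R : SO3) (a : E3) (x : Config n) :
    schrodingerFun m V (fun x => f fun k => rot R (x k) + a) x =
      schrodingerFun m V f fun k => rot R (x k) + a := by
  simp only [schrodingerFun, partialLaplacian_rigid _ hf, hV R a x]

/-- Conjugation by the motion gives a one-parameter group with the same derivative on test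
functions, since V is invariant; uniqueness identifies it with the evolution. -/
theorem evolution_moveOp (h : IsEssSelfAdjoint m V) (hV : IsInvariant V) (R : SO3) (a : E3) (t : ℝ)
    (ψ : L2 (Config n)) :
    evolution m V t (moveOp n R a ψ) = moveOp n R a (evolution m V t ψ) := by
  let S := moveOp n R a
  have hU : (fun t => S⁻¹ * evolution m V t * S) = evolution m V := by
    refine eq_evolution h (fun s t => ?_) fun f hf => ?_
    · rw [evolution_add h]; group
    · have h1 : S (toL2 f) = toL2 fun x => f fun k => rot R (x k) + a := moveOp_toL2 R a hf.memLp
      have h2 : S (toL2 (schrodingerFun m V f)) =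
          toL2 (schrodingerFun m V fun x => f fun k => rot R (x k) + a) := by
        rw [funext (schrodingerFun_rigid (m := m) hV hf.1 R a)]
        exact moveOp_toL2 R a (h.1 f hf)
      have h3 := hasDerivAt_evolution h (hf.rigid R a)
      rw [← h1, ← h2, ← map_smul] at h3
      have h4 := (S.symm.toContinuousLinearEquiv.toContinuousLinearMap.restrictScalars
        ℝ).hasFDerivAt.comp_hasDerivAt (0 : ℝ) h3
      have h5 : S.symm (S (-Complex.I • toL2 (schrodingerFun m V f))) =
        -Complex.I • toL2 (schrodingerFun m V f) := S.symm_apply_apply _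
      rw [← h5]
      exact h4
  have h1 : S⁻¹ * evolution m V t * S = evolution m V t := congrFun hU t
  have h2 : evolution m V t * S = S * evolution m V t := by
    conv_rhs => rw [← h1]
    group
  exact DFunLike.congr_fun h2 ψ

end Rigid

/-! ### Boosts -/

section Boost

open Filter Topology

variable {n : ℕ}

/-- A product rule that needs U_t to be differentiable only at F(0). The remaining vectors need only
isometry and strong continuity. -/
theorem hasDerivAt_group_comp {E : Type*} [NormedAddCommGroup E] [InnerProductSpace ℂ E]
    {U : ℝ → (E ≃ₗᵢ[ℂ] E)} (hU : ∀ s t : ℝ, U (s + t) = U s * U t)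
    (hc : ∀ ψ, Continuous fun t => U t ψ) {F : ℝ → E} {F' D : E} (hF : HasDerivAt F F' 0)
    (hD : HasDerivAt (fun t => U t (F 0)) D 0) :
    HasDerivAt (fun t => U t (F t)) (D + F') 0 := by
  have h0 : U 0 = 1 := group_zero hU
  -- Both summands are o(t): the first is an isometric image of the Taylor remainder, the second is
  -- t times a quantity tending to 0.
  have h1 : HasDerivAt (fun t => U t (F t - F 0 - t • F') + t • (U t F' - F')) 0 0 := by
    rw [hasDerivAt_iff_isLittleO] at hF ⊢
    simp only [sub_zero, h0, zero_smul, sub_self, map_zero, add_zero, smul_zero] at hF ⊢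
    refine Asymptotics.IsLittleO.add ?_ ?_
    · exact (Asymptotics.IsBigO.of_bound 1 (Eventually.of_forall fun t => by
        rw [(U t).norm_map, one_mul])).trans_isLittleO hF
    · have h2 : Tendsto (fun t => U t F' - F') (𝓝 0) (𝓝 0) := by
        have := ((hc F').tendsto 0).sub_const F'
        simpa [h0] using this
      have h3 := (Asymptotics.isBigO_refl (fun t : ℝ => t) (𝓝 0)).smul_isLittleO
        ((Asymptotics.isLittleO_one_iff ℝ).2 h2)
      simpa using h3
  have h2 := (h1.add hD).add ((hasDerivAt_id (0 : ℝ)).smul_const F')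
  rw [zero_add, one_smul] at h2
  refine h2.congr_of_eventuallyEq (Eventually.of_forall fun t => ?_)
  simp only [Pi.add_apply, id, map_sub, smul_sub]
  rw [show U t (t • F') = t • U t F' from ((U t : E →ₗ[ℂ] E).restrictScalars ℝ).map_smul t F']
  abel

theorem dird_translate {g : Config n → ℂ} (hg : ContDiff ℝ ∞ g) (w x : Config n) (s : ℝ) :
    HasDerivAt (fun s : ℝ => g (x - s • w)) (-dird w g (x - s • w)) s := by
  have h1 : HasDerivAt (fun s : ℝ => x - s • w) (-w) s := by
    simpa using ((hasDerivAt_id s).smul_const w).const_sub x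
  have h2 := (contDiff_infty_differentiable hg (x - s • w)).hasFDerivAt.comp_hasDerivAt s h1
  rw [map_neg] at h2
  exact h2

/-- The second derivative along w is bounded by compact support, and two applications of the mean
value inequality give a Taylor remainder uniform in x. -/
theorem exists_translate_bound {g : Config n → ℂ} (hg : IsTest g) (w : Config n) :
    ∃ C, 0 ≤ C ∧ ∀ x, ∀ t : ℝ, ‖g (x - t • w) - (g x + (-t : ℂ) * dird w g x)‖ ≤ C * t ^ 2 := by
  have hd2 : ContDiff ℝ ∞ (dird w (dird w g)) := ContDiff.dird (ContDiff.dird hg.1 w) w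
  have hs2 : HasCompactSupport (dird w (dird w g)) :=
    (hg.2.fderiv_apply ℝ w).fderiv_apply ℝ w
  obtain ⟨C, hC⟩ := hd2.continuous.bounded_above_of_compact_support hs2
  have hC0 : 0 ≤ C := (norm_nonneg _).trans (hC 0)
  refine ⟨C, hC0, fun x t => ?_⟩
  have hq : ∀ s : ℝ, ‖dird w g (x - s • w) - dird w g x‖ ≤ C * |s| := by
    intro s
    have := norm_sub_le_of_norm_deriv_eq (fun s => dird_translate (ContDiff.dird hg.1 w) w x s)
      (fun s => by rw [norm_neg]; exact hC _) 0 s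
    simpa using this
  have hk : ∀ s : ℝ, HasDerivAt (fun s : ℝ => g (x - s • w) + s • dird w g x)
      (-dird w g (x - s • w) + dird w g x) s := by
    intro s
    have h1 := (dird_translate hg.1 w x s).add ((hasDerivAt_id s).smul_const (dird w g x))
    rw [one_smul] at h1
    exact h1
  have h := (convex_Icc (-|t|) |t|).norm_image_sub_le_of_norm_hasDerivWithin_le (x := 0) (y := t)
    (C := C * |t|) (fun s _ => (hk s).hasDerivWithinAt) (fun s hs => by
      rw [neg_add_eq_sub, norm_sub_rev]
      exact (hq s).trans (mul_le_mul_of_nonneg_left (abs_le.2 hs) hC0))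
    (by simp) ⟨neg_abs_le t, le_abs_self t⟩
  have e : g (x - t • w) - (g x + (-t : ℂ) * dird w g x) = g (x - t • w) + t • dird w g x -
      (g (x - (0 : ℝ) • w) + (0 : ℝ) • dird w g x) := by
    simp only [zero_smul, sub_zero, add_zero, Complex.real_smul]
    ring
  rw [e]
  refine h.trans (le_of_eq ?_)
  rw [sub_zero, Real.norm_eq_abs, mul_assoc, ← sq, sq_abs]

theorem IsTest.dird {f : Config n → ℂ} (hf : IsTest f) (w : Config n) :
    IsTest (GalileiMass.dird w f) :=
  ⟨ContDiff.dird hf.1 w, hf.2.fderiv_apply ℝ w⟩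

theorem IsTest.translate {f : Config n → ℂ} (hf : IsTest f) (w : Config n) :
    IsTest fun x => f (x - w) :=
  ⟨hf.1.comp (contDiff_id.sub contDiff_const),
    hf.2.comp_homeomorph (Homeomorph.subRight w)⟩

/-- For |t| ≤ 1 all translates live in one enlarged ball, so the uniform quadratic remainder is also
quadratic in L². -/
theorem hasDerivAt_translate {g : Config n → ℂ} (hg : IsTest g) (w : Config n) :
    HasDerivAt (fun t : ℝ => toL2 fun x => g (x - t • w)) (-toL2 (dird w g)) 0 := by
  obtain ⟨C, hC0, hC⟩ := exists_translate_bound hg w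
  obtain ⟨r, hr⟩ := hg.2.isBounded.subset_closedBall 0
  let F : Config n → ℂ := (Metric.closedBall (0 : Config n) (r + ‖w‖)).indicator fun _ => 1
  have hF : MemLp F 2 (volume : Measure (Config n)) :=
    memLp_indicator_const 2 measurableSet_closedBall _
      (Or.inr (isCompact_closedBall _ _).measure_lt_top.ne)
  have hz : ∀ (x : Config n) (t : ℝ), |t| ≤ 1 → x ∉ Metric.closedBall (0 : Config n) (r + ‖w‖) →
      x - t • w ∉ tsupport g := by
    intro x t ht hx hmem
    apply hx
    have h1 := hr hmem
    rw [mem_closedBall_zero_iff] at h1 ⊢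
    have h2 : ‖t • w‖ ≤ ‖w‖ := by
      rw [norm_smul, Real.norm_eq_abs]
      exact mul_le_of_le_one_left (norm_nonneg _) ht
    have h3 := norm_le_norm_sub_add x (t • w)
    linarith
  have hdm := (hg.dird w).memLp
  have hb : ∀ t : ℝ, |t| ≤ 1 → ‖toL2 (fun x => g (x - t • w)) - toL2 g - t • -toL2 (dird w g)‖
      ≤ C * t ^ 2 * ‖toL2 F‖ := by
    intro t ht
    have e : toL2 g + t • -toL2 (dird w g) = toL2 fun x => g x + (-t : ℂ) * dird w g x := by
      rw [toL2_add hg.memLp (hdm.const_mul _), toL2_const_mul _ hdm, neg_smul, smul_neg]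
      rfl
    rw [sub_sub, e]
    refine norm_toL2_sub_le (hg.translate _).memLp (hg.memLp.add (hdm.const_mul _)) hF fun x => ?_
    by_cases hx : x ∈ Metric.closedBall (0 : Config n) (r + ‖w‖)
    · simpa [F, hx] using hC x t
    · have h1 := hz x t ht hx
      have h2 := hz x 0 (by simp) hx
      rw [zero_smul, sub_zero] at h2
      have h3 : dird w g x = 0 :=
        image_eq_zero_of_notMem_tsupport fun h => h2 (tsupport_dird_subset _ _ h)
      have h4 : g (x - t • w) - (g x + (-t : ℂ) * dird w g x) = 0 := by
        rw [image_eq_zero_of_notMem_tsupport h1, image_eq_zero_of_notMem_tsupport h2, h3]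
        simp
      refine (norm_eq_zero.2 h4).le.trans ?_
      positivity
  rw [hasDerivAt_iff_isLittleO]
  simp only [zero_smul, sub_zero]
  refine Asymptotics.IsBigO.trans_isLittleO (g := fun t : ℝ => t ^ 2) ?_
    (Asymptotics.isLittleO_pow_id one_lt_two)
  refine Asymptotics.IsBigO.of_bound (C * ‖toL2 F‖) ?_
  filter_upwards [Metric.ball_mem_nhds (0 : ℝ) one_pos] with t ht
  rw [mem_ball_zero_iff, Real.norm_eq_abs] at ht
  refine (hb t ht.le).trans (le_of_eq ?_)
  rw [Real.norm_eq_abs, abs_of_nonneg (sq_nonneg t)]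
  ring

/-- The phase `∑_j m_j 𝐯·x_j` of a boost. -/
noncomputable def boostPhase (m : Fin n → ℝ) (v : E3) (x : Config n) : ℝ := ∑ j, ⟪v, x j⟫ * m j

theorem contDiff_boostPhase (m : Fin n → ℝ) (v : E3) : ContDiff ℝ ∞ (boostPhase m v) := by
  unfold boostPhase
  exact ContDiff.sum fun j _ => (contDiff_const.inner ℝ (contDiff_apply ℝ E3 j)).mul contDiff_const

/-- The factor `e^{-i∑_j m_j 𝐯·x_j}`. -/
noncomputable def boostFactor (m : Fin n → ℝ) (v : E3) (x : Config n) : ℂ :=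
  Complex.exp (Complex.I * ((-boostPhase m v x : ℝ) : ℂ))

theorem contDiff_boostFactor (m : Fin n → ℝ) (v : E3) : ContDiff ℝ ∞ (boostFactor m v) := by
  unfold boostFactor
  have h1 : ContDiff ℝ ∞ fun x : Config n => ((-boostPhase m v x : ℝ) : ℂ) :=
    Complex.ofRealCLM.contDiff.comp (contDiff_boostPhase m v).neg
  exact (contDiff_const.mul h1).cexp

theorem hasFDerivAt_boostPhase (m : Fin n → ℝ) (v : E3) (x : Config n) :
    ∃ L : Config n →L[ℝ] ℝ, HasFDerivAt (boostPhase m v) L x ∧ ∀ s, L s = boostPhase m v s := by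
  let L : Config n →L[ℝ] ℝ := ∑ j, m j • (innerSL ℝ v).comp (ContinuousLinearMap.proj j)
  have hL : ∀ s, L s = boostPhase m v s := by
    intro s
    simp [L, boostPhase, mul_comm]
  refine ⟨L, ?_, hL⟩
  have : boostPhase m v = L := funext fun s => (hL s).symm
  rw [this]
  exact L.hasFDerivAt

theorem dird_boostFactor (m : Fin n → ℝ) (v : E3) (s x : Config n) :
    dird s (boostFactor m v) x = -(Complex.I * boostPhase m v s) * boostFactor m v x := by
  obtain ⟨L, hL, hLs⟩ := hasFDerivAt_boostPhase m v x
  have h1 : HasFDerivAt (fun x => Complex.I * ((-boostPhase m v x : ℝ) : ℂ))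
      (Complex.I • Complex.ofRealCLM.comp (-L)) x :=
    (Complex.ofRealCLM.hasFDerivAt.comp x hL.neg).const_mul Complex.I
  have h2 := h1.cexp
  rw [dird]
  change fderiv ℝ (fun x => Complex.exp (Complex.I * ((-boostPhase m v x : ℝ) : ℂ))) x s = _
  rw [h2.fderiv]
  simp [hLs, boostFactor]
  ring

theorem dird_boostFactor_mul {f : Config n → ℂ} (hf : ContDiff ℝ ∞ f) (m : Fin n → ℝ) (v : E3)
    (s : Config n) : dird s (fun x => boostFactor m v x * f x) =
      fun x => boostFactor m v x * (dird s f x + -(Complex.I * boostPhase m v s) * f x) := by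
  rw [dird_mul (contDiff_boostFactor m v) hf]
  funext x
  rw [dird_boostFactor]
  ring

theorem dird_dird_boostFactor_mul {f : Config n → ℂ} (hf : ContDiff ℝ ∞ f) (m : Fin n → ℝ) (v : E3)
    (s x : Config n) : dird s (dird s (fun x => boostFactor m v x * f x)) x =
      boostFactor m v x * (dird s (dird s f) x - 2 * (Complex.I * boostPhase m v s) * dird s f x
        - (boostPhase m v s : ℂ) ^ 2 * f x) := by
  have h1 : ContDiff ℝ ∞ fun x => dird s f x + -(Complex.I * boostPhase m v s) * f x :=
    (ContDiff.dird hf s).add (contDiff_const.mul hf)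
  rw [dird_boostFactor_mul hf, dird_boostFactor_mul h1]
  have h2 : dird s (fun x => dird s f x + -(Complex.I * boostPhase m v s) * f x) x =
      dird s (dird s f) x + -(Complex.I * boostPhase m v s) * dird s f x := by
    have h3 := contDiff_infty_differentiable (ContDiff.dird hf s) x
    have h4 := contDiff_infty_differentiable hf x
    rw [dird, fderiv_fun_add h3 (h4.const_mul _), fderiv_const_mul h4]
    simp [dird]
  simp only [h2]
  linear_combination (boostFactor m v x * (boostPhase m v s : ℂ) ^ 2 * f x) * Complex.I_sq

theorem boostPhase_single (m : Fin n → ℝ) (v u : E3) (k : Fin n) :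
    boostPhase m v (Pi.single k u) = m k * ⟪v, u⟫ := by
  unfold boostPhase
  rw [Finset.sum_eq_single k]
  · simp [mul_comm]
  · intro j _ hj
    simp [hj]
  · simp

theorem partialLaplacian_boostFactor_mul {f : Config n → ℂ} (hf : ContDiff ℝ ∞ f) (m : Fin n → ℝ)
    (v : E3) (k : Fin n) (x : Config n) :
    partialLaplacian k (fun x => boostFactor m v x * f x) x = boostFactor m v x *
      (partialLaplacian k f x - 2 * Complex.I * m k * dird (Pi.single k v) f x
        - ((m k : ℂ) ^ 2 * (‖v‖ ^ 2 : ℝ)) * f x) := by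
  let b := stdOrthonormalBasis ℝ E3
  have h1 : (Pi.single k v : Config n) = ∑ i, ⟪v, b i⟫ • (Pi.single k (b i) : Config n) := by
    have h := congrArg (LinearMap.single ℝ (fun _ : Fin n => E3) k) (b.sum_repr' v)
    rw [map_sum] at h
    simp only [map_smul, LinearMap.single_apply, real_inner_comm] at h
    exact h.symm
  have h2 : ‖v‖ ^ 2 = ∑ i, ⟪v, b i⟫ ^ 2 := by
    rw [← b.sum_sq_norm_inner_left v]
    simp
  rw [partialLaplacian_eq b k ((contDiff_boostFactor m v).mul hf), partialLaplacian_eq b k hf,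
    h1, dird_sum, h2]
  simp only [dird_dird_boostFactor_mul hf, boostPhase_single]
  push_cast
  simp only [Finset.mul_sum, Finset.sum_mul, ← Finset.sum_sub_distrib]
  refine Finset.sum_congr rfl fun i _ => ?_
  ring

variable {m : Fin n → ℝ} {V : Config n → ℝ}

/-- The factors m_k and m_k² produced by the phase meet 1/(2m_k). The gradient term thus becomes
mass independent, an overall translation along v, and the constants add up to the kinetic energy of
the total mass. This is where nonzero masses are needed. -/
theorem schrodingerFun_boostFactor_mul {f : Config n → ℂ} (hf : ContDiff ℝ ∞ f)
    (hm : ∀ k, m k ≠ 0) (v : E3) (x : Config n) :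
    schrodingerFun m V (fun x => boostFactor m v x * f x) x = boostFactor m v x *
      (schrodingerFun m V f x + Complex.I * dird (fun _ => v) f x
        + ((∑ k, m k : ℝ) : ℂ) * (‖v‖ ^ 2 : ℝ) / 2 * f x) := by
  have h1 : (fun _ => v : Config n) = ∑ k, (1 : ℝ) • (Pi.single k v : Config n) := by
    simp only [one_smul]
    exact (Finset.univ_sum_single (fun _ : Fin n => v)).symm
  have h2 : ∀ k, (1 / (2 * (m k : ℂ))) *
      partialLaplacian k (fun x => boostFactor m v x * f x) x = boostFactor m v x *
      ((1 / (2 * (m k : ℂ))) * partialLaplacian k f x - Complex.I * dird (Pi.single k v) f x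
        - m k * (‖v‖ ^ 2 : ℝ) / 2 * f x) := by
    intro k
    have hk : (m k : ℂ) ≠ 0 := by exact_mod_cast hm k
    rw [partialLaplacian_boostFactor_mul hf]
    field_simp
  rw [h1, dird_sum]
  simp only [schrodingerFun, h2, ← Finset.mul_sum, Finset.sum_sub_distrib]
  push_cast
  simp only [← Finset.sum_mul, ← Finset.sum_div, one_mul]
  ring

theorem measurable_boostPhase (m : Fin n → ℝ) (v : E3) : Measurable (boostPhase m v) :=
  (contDiff_boostPhase m v).continuous.measurable

/-- The boost `ψ ↦ e^{i∑_j m_j 𝐯·x_j} ψ`. -/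
noncomputable def boostOp (m : Fin n → ℝ) (v : E3) : L2 (Config n) ≃ₗᵢ[ℂ] L2 (Config n) :=
  phaseMul (boostPhase m v) (measurable_boostPhase m v)

theorem boostOp_symm_toL2 (m : Fin n → ℝ) (v : E3) {f : Config n → ℂ}
    (hf : MemLp f 2 (volume : Measure (Config n))) :
    (boostOp m v).symm (toL2 f) = toL2 fun x => boostFactor m v x * f x := by
  refine toL2_congr ?_
  filter_upwards [coeFn_toL2 hf] with x hx
  rw [hx]
  rfl

theorem IsTest.boostFactor_mul {f : Config n → ℂ} (hf : IsTest f) (m : Fin n → ℝ) (v : E3) :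
    IsTest fun x => boostFactor m v x * f x :=
  ⟨(contDiff_boostFactor m v).mul hf.1, hf.2.mul_left⟩

/-- The scalar `e^{-iat}` as a unitary operator. -/
noncomputable def scalarOp {E : Type*} [NormedAddCommGroup E] [InnerProductSpace ℂ E] (a : ℝ) :
    E ≃ₗᵢ[ℂ] E where
  toFun ψ := Complex.exp (Complex.I * (a : ℂ)) • ψ
  invFun ψ := Complex.exp (Complex.I * ((-a : ℝ) : ℂ)) • ψ
  left_inv ψ := by
    dsimp only
    rw [smul_smul, ← Complex.exp_add]
    simp
  right_inv ψ := by
    dsimp only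
    rw [smul_smul, ← Complex.exp_add]
    simp
  map_add' ψ χ := smul_add _ _ _
  map_smul' c ψ := smul_comm _ _ _
  norm_map' ψ := by
    change ‖Complex.exp (Complex.I * (a : ℂ)) • ψ‖ = ‖ψ‖
    rw [norm_smul, mul_comm Complex.I, Complex.norm_exp_ofReal_mul_I, one_mul]

theorem scalarOp_apply {E : Type*} [NormedAddCommGroup E] [InnerProductSpace ℂ E] (a : ℝ) (ψ : E) :
    scalarOp a ψ = Complex.exp (Complex.I * (a : ℂ)) • ψ := rfl

theorem moveOp_one_toL2 (a : E3) {f : Config n → ℂ}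
    (hf : MemLp f 2 (volume : Measure (Config n))) :
    moveOp n 1 (-a) (toL2 f) = toL2 fun x => f (x - fun _ => a) := by
  rw [moveOp_toL2 _ _ hf]
  simp only [rot_one, ← sub_eq_add_neg]
  rfl

/-- Galilean covariance of the time evolution under boosts. -/
theorem evolution_boostOp (h : IsEssSelfAdjoint m V) (hV : IsInvariant V) (hm : ∀ k, m k ≠ 0)
    (v : E3) (t : ℝ) (ψ : L2 (Config n)) :
    evolution m V t (boostOp m v ψ) = scalarOp (-((∑ k, m k) * ‖v‖ ^ 2 / 2 * t))
      (boostOp m v (moveOp n 1 (-(t • v)) (evolution m V t ψ))) := by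
  set M : ℝ := (∑ k, m k) * ‖v‖ ^ 2 / 2
  let B := boostOp m v
  -- Here `M` is the kinetic energy of the boosted total mass. Evolution, translation and phase
  -- commute, so their conjugate by the boost is a one-parameter group, to be recognised as the
  -- evolution itself.
  let W : ℝ → (L2 (Config n) ≃ₗᵢ[ℂ] L2 (Config n)) := fun t =>
    scalarOp (-(M * t)) * (B * (evolution m V t * moveOp n 1 (-(t • v))) * B⁻¹)
  have hmove : ∀ s t : ℝ, moveOp n 1 (-((s + t) • v)) = moveOp n 1 (-(s • v)) * moveOp n 1 (-(t • v)) := by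
    intro s t
    refine LinearIsometryEquiv.ext fun ψ => ?_
    change _ = moveOp n 1 (-(s • v)) (moveOp n 1 (-(t • v)) ψ)
    rw [moveOp_moveOp, rot_one, mul_one, add_smul, neg_add]
  have hW : W = evolution m V := by
    refine eq_evolution h (fun s t => ?_) fun f hf => ?_
    · refine LinearIsometryEquiv.ext fun ψ => ?_
      change scalarOp _ (B (evolution m V _ (moveOp n 1 _ (B.symm ψ)))) =
        scalarOp _ (B (evolution m V _ (moveOp n 1 _ (B.symm
          (scalarOp _ (B (evolution m V _ (moveOp n 1 _ (B.symm ψ)))))))))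
      rw [hmove, evolution_add h]
      simp only [scalarOp_apply, map_smul, LinearIsometryEquiv.symm_apply_apply, smul_smul,
        ← Complex.exp_add, LinearIsometryEquiv.coe_mul, Function.comp_apply, ← evolution_moveOp h hV]
      congr 2
      push_cast
      ring
    · have hg := hf.boostFactor_mul m v
      set g : Config n → ℂ := fun x => boostFactor m v x * f x
      have h1 : ∀ t : ℝ, moveOp n 1 (-(t • v)) (toL2 g) = toL2 fun x => g (x - t • fun _ => v) :=
        fun t => moveOp_one_toL2 _ hg.memLp
      have h2 := hasDerivAt_translate hg (fun _ => v)
      have h3 := hasDerivAt_evolution h hg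
      have hF0 : (toL2 fun x => g (x - (0 : ℝ) • fun _ => v)) = toL2 g := by
        simp only [zero_smul, sub_zero]
      have h4 := hasDerivAt_group_comp (evolution_add h) (isUnitaryGroupOf_evolution h).2.1
        (F := fun t : ℝ => toL2 fun x => g (x - t • fun _ => v)) h2
        (D := -Complex.I • toL2 (schrodingerFun m V g)) (by rw [hF0]; exact h3)
      have h5 := (B.toContinuousLinearEquiv.toContinuousLinearMap.restrictScalars
        ℝ).hasFDerivAt.comp_hasDerivAt (0 : ℝ) h4
      have h6 : HasDerivAt (fun t : ℝ => Complex.exp (Complex.I * ((-(M * t) : ℝ) : ℂ)))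
          (-(Complex.I * M)) 0 := by
        have h8 : HasDerivAt (fun t : ℝ => -(M * t)) (-(M * 1)) 0 :=
          ((hasDerivAt_id (0 : ℝ)).const_mul M).neg
        have h9 := (h8.ofReal_comp.const_mul Complex.I).cexp
        simpa using h9
      have h7 := h6.smul h5
      have hMv : (boostPhase m v (fun _ => v) : ℂ) = 2 * M := by
        have : boostPhase m v (fun _ => v) = 2 * M := by
          simp only [boostPhase, real_inner_self_eq_norm_sq, ← Finset.mul_sum, M]
          ring
        exact_mod_cast this
      -- The derivative of the translation cancels the gradient term of the boosted Hamiltonian.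
      -- Only the constant iM remains, and the scalar phase removes it.
      have e : -Complex.I • toL2 (schrodingerFun m V g) + -toL2 (dird (fun _ => v) g) =
          B.symm (-Complex.I • toL2 (schrodingerFun m V f) + (Complex.I * M) • toL2 f) := by
        have hs := h.1 f hf
        have hs' := h.1 g hg
        have hd' := (hg.dird fun _ => v).memLp
        rw [← neg_one_smul ℂ (toL2 (dird _ g)), ← toL2_const_mul _ hs, ← toL2_const_mul _ hf.memLp,
          ← toL2_const_mul _ hs', ← toL2_const_mul _ hd',
          ← toL2_add (hs.const_mul _) (hf.memLp.const_mul _),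
          ← toL2_add (hs'.const_mul _) (hd'.const_mul _)]
        refine Eq.trans ?_ (boostOp_symm_toL2 m v (f := fun x => -Complex.I * schrodingerFun m V f x +
          Complex.I * M * f x) ((hs.const_mul _).add (hf.memLp.const_mul _))).symm
        congr 1
        funext x
        rw [schrodingerFun_boostFactor_mul hf.1 hm, dird_boostFactor_mul hf.1, hMv]
        have hM2 : ((∑ k, m k : ℝ) : ℂ) * (‖v‖ ^ 2 : ℝ) / 2 = M := by
          simp only [M]; push_cast; ring
        rw [hM2]
        linear_combination (-(boostFactor m v x * dird (fun _ => v) f x)) * Complex.I_sq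
      have hg0 : toL2 g = B.symm (toL2 f) := (boostOp_symm_toL2 m v hf.memLp).symm
      have h8 : HasDerivAt (fun t => W t (toL2 f))
          (Complex.exp (Complex.I * ((-(M * (0 : ℝ)) : ℝ) : ℂ)) •
            B (B.symm (-Complex.I • toL2 (schrodingerFun m V f) + (Complex.I * M) • toL2 f)) +
            (-(Complex.I * M)) • B (evolution m V 0 (toL2 g))) 0 := by
        rw [← e]
        refine HasDerivAt.congr_of_eventuallyEq (f := fun t : ℝ =>
          Complex.exp (Complex.I * ((-(M * t) : ℝ) : ℂ)) •
            B (evolution m V t (toL2 fun x => g (x - t • fun _ => v)))) ?_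
          (Eventually.of_forall fun t => ?_)
        · rw [← hF0]
          exact h7
        · change scalarOp _ (B (evolution m V t (moveOp n 1 _ (B.symm (toL2 f))))) = _
          rw [← hg0, h1, scalarOp_apply]
      rw [B.apply_symm_apply, group_zero (evolution_add h), hg0] at h8
      have e2 : Complex.exp (Complex.I * ((-(M * (0 : ℝ)) : ℝ) : ℂ)) •
            (-Complex.I • toL2 (schrodingerFun m V f) + (Complex.I * M) • toL2 f) +
            (-(Complex.I * M)) • B ((1 : L2 (Config n) ≃ₗᵢ[ℂ] L2 (Config n)) (B.symm (toL2 f))) =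
          -Complex.I • toL2 (schrodingerFun m V f) := by
        rw [LinearIsometryEquiv.coe_one, id, B.apply_symm_apply]
        simp
      rw [e2] at h8
      exact h8
  have h1 : W t = evolution m V t := congrFun hW t
  conv_lhs => rw [← h1]
  change scalarOp _ (B (evolution m V t (moveOp n 1 _ (B.symm (B ψ))))) = _
  rw [B.symm_apply_apply, evolution_moveOp h hV]

end Boost

/-! ### The Galileian operators in a fibre -/

section Fibre

open Filter Topology

variable {N : ℕ} (γ : Galilei → ℝ) (m : Fin N → ℝ)

/-- The phase `∑_j m_j (φ_g(t, x_j) + r)`. -/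
noncomputable def galPhase (r : ℝ) (g : Galilei) (t : ℝ) (x : Config N) : ℝ :=
  ∑ j, (phase γ g (t, x j) + r) * m j

theorem galPhase_eq (r : ℝ) (g : Galilei) (t : ℝ) (x : Config N) : galPhase γ m r g t x =
    boostPhase m g.boost x + (∑ j, m j) * (γ g + r - ‖g.boost‖ ^ 2 * t / 2) := by
  simp only [galPhase, boostPhase, phase, Finset.sum_mul, ← Finset.sum_add_distrib]
  exact Finset.sum_congr rfl fun j _ => by ring

theorem measurable_galPhase (r : ℝ) (g : Galilei) (t : ℝ) : Measurable (galPhase γ m r g t) := by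
  rw [funext (galPhase_eq γ m r g t)]
  exact (measurable_boostPhase m g.boost).add_const _

/-- The translation part of `g⁻¹` at time `t`. -/
noncomputable def invShift (g : Galilei) (t : ℝ) : E3 := g⁻¹.shift + t • g⁻¹.boost

theorem act_inv_snd (g : Galilei) (t : ℝ) (y : E3) :
    (g⁻¹.act (t, y)).2 = rot g.R⁻¹ y + invShift g t := add_comm _ _

theorem act_inv (g : Galilei) (t : ℝ) (y : E3) :
    g⁻¹.act (t, y) = (t - g.time, rot g.R⁻¹ y + invShift g t) :=
  Prod.ext (sub_eq_add_neg _ _).symm (act_inv_snd g t y)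

/-- `ψ ↦ e^{i ∑_j m_j (φ_g(t, x_j) + r)} ψ(g⁻¹(t, x_k))`. -/
noncomputable def galOp (r : ℝ) (g : Galilei) (t : ℝ) : L2 (Config N) ≃ₗᵢ[ℂ] L2 (Config N) :=
  phaseMul (galPhase γ m r g t) (measurable_galPhase γ m r g t) * moveOp N g.R⁻¹ (invShift g t)

theorem galOp_ae (r : ℝ) (g : Galilei) (t : ℝ) (ψ : L2 (Config N)) :
    galOp γ m r g t ψ =ᵐ[volume] fun x => Complex.exp (Complex.I * (galPhase γ m r g t x : ℂ)) *
      ψ fun k => (g⁻¹.act (t, x k)).2 := by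
  filter_upwards [phaseMul_ae (galPhase γ m r g t) (measurable_galPhase γ m r g t)
    (moveOp N g.R⁻¹ (invShift g t) ψ), moveOp_ae g.R⁻¹ (invShift g t) ψ] with x h1 h2
  have e : galOp γ m r g t ψ = phaseMul (galPhase γ m r g t) (measurable_galPhase γ m r g t)
    (moveOp N g.R⁻¹ (invShift g t) ψ) := rfl
  rw [e, h1, h2]
  simp only [act_inv_snd]

theorem galOp_eq (r : ℝ) (g : Galilei) (t : ℝ) (ψ : L2 (Config N)) : galOp γ m r g t ψ =
    scalarOp ((∑ j, m j) * (γ g + r - ‖g.boost‖ ^ 2 * t / 2))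
      (boostOp m g.boost (moveOp N g.R⁻¹ (invShift g t) ψ)) := by
  refine Lp.ext ?_
  rw [scalarOp_apply]
  filter_upwards [phaseMul_ae (galPhase γ m r g t) (measurable_galPhase γ m r g t)
    (moveOp N g.R⁻¹ (invShift g t) ψ),
    phaseMul_ae (boostPhase m g.boost) (measurable_boostPhase m g.boost)
    (moveOp N g.R⁻¹ (invShift g t) ψ),
    Lp.coeFn_smul (Complex.exp (Complex.I *
      (((∑ j, m j) * (γ g + r - ‖g.boost‖ ^ 2 * t / 2) : ℝ) : ℂ)))
      (boostOp m g.boost (moveOp N g.R⁻¹ (invShift g t) ψ))] with x h1 h2 h3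
  have e : galOp γ m r g t ψ = phaseMul (galPhase γ m r g t) (measurable_galPhase γ m r g t)
    (moveOp N g.R⁻¹ (invShift g t) ψ) := rfl
  have e' : boostOp m g.boost (moveOp N g.R⁻¹ (invShift g t) ψ) = phaseMul (boostPhase m g.boost)
    (measurable_boostPhase m g.boost) (moveOp N g.R⁻¹ (invShift g t) ψ) := rfl
  rw [h3, Pi.smul_apply, e, e', h1, h2, galPhase_eq, smul_eq_mul, ← mul_assoc, ← Complex.exp_add]
  congr 2
  push_cast
  ring

/-- The exponents add by the cocycle identity at (t, x_j) weighted with m_j. The inner operator is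
taken at time t - c' because g'⁻¹ shifts time. -/
theorem galOp_mul (r' r : ℝ) (g' g : Galilei) (t : ℝ) (ψ : L2 (Config N)) :
    galOp γ m r' g' t (galOp γ m r g (t - g'.time) ψ) =
      galOp γ m (r + r' + xi γ g' g) (g' * g) t ψ := by
  refine Lp.ext ?_
  filter_upwards [galOp_ae γ m r' g' t (galOp γ m r g (t - g'.time) ψ),
    ae_rigid g'.R⁻¹ (invShift g' t) (galOp_ae γ m r g (t - g'.time) ψ),
    galOp_ae γ m (r + r' + xi γ g' g) (g' * g) t ψ] with x h1 h2 h3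
  rw [h1, h3]
  simp only [act_inv_snd g' t]
  rw [h2, ← mul_assoc, ← Complex.exp_add]
  have e1 : ∀ k, (((g' * g)⁻¹).act (t, x k)).2 =
      (g⁻¹.act (t - g'.time, rot g'.R⁻¹ (x k) + invShift g' t)).2 := by
    intro k
    rw [mul_inv_rev, Galilei.act_mul, act_inv g' t]
  simp only [e1]
  congr 2
  rw [← mul_add, ← Complex.ofReal_add]
  congr 2
  simp only [galPhase, ← Finset.sum_add_distrib, ← add_mul]
  refine Finset.sum_congr rfl fun j _ => ?_
  have := phase_central γ g' g (t, x j)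
  rw [act_inv g' t] at this
  congr 1
  linarith

variable {m} {V : Config N → ℝ}

/-- Passing the evolution through the boost produces a translation by t𝐯 and the phase -M𝐯²t/2,
exactly the time dependence of the phase and of the space-time action. -/
theorem evolution_galOp (h : IsEssSelfAdjoint m V) (hV : IsInvariant V) (hm : ∀ k, m k ≠ 0)
    (r : ℝ) (g : Galilei) (t : ℝ) (ψ : L2 (Config N)) :
    evolution m V t (galOp γ m r g 0 ψ) = galOp γ m r g t (evolution m V t ψ) := by
  have e : rot g.R⁻¹ (-(t • g.boost)) + invShift g 0 = invShift g t := by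
    simp only [invShift, Galilei.inv_def, zero_smul, rot_neg, rot_smul, smul_neg]
    abel
  rw [galOp_eq, galOp_eq, scalarOp_apply, scalarOp_apply, map_smul,
    evolution_boostOp h hV hm, scalarOp_apply, smul_smul, ← Complex.exp_add,
    evolution_moveOp h hV, moveOp_moveOp, mul_one, e]
  congr 2
  push_cast
  ring_nf

/-- The rigid motion commutes with the dynamics and can be moved outside. Covariance under boosts is
not involved, so zero masses are harmless. -/
theorem fibreOp_eq {m : Mass N} (h : IsEssSelfAdjoint m V) (hV : IsInvariant V) (r : ℝ)
    (g : Galilei) (ψ : L2 (Config N)) :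
    fibreOp V γ m r g ψ = galOp γ m r g 0 (evolution m V (-g.time) ψ) := by
  have e1 : (toL2 fun y : Config N => ψ fun k => rot g.R⁻¹ (y k + g.time • g.boost - g.shift)) =
      moveOp N g.R⁻¹ (invShift g 0) ψ := by
    refine toL2_eq_of_ae ?_
    filter_upwards [moveOp_ae g.R⁻¹ (invShift g 0) ψ] with y hy
    rw [hy]
    congr 1
    funext k
    simp only [invShift, Galilei.inv_def, zero_smul, add_zero, ← rot_add]
    congr 1
    abel
  unfold fibreOp
  rw [e1, evolution_moveOp h hV]
  refine toL2_eq_of_ae ?_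
  filter_upwards [phaseMul_ae (galPhase γ m r g 0) (measurable_galPhase γ m r g 0)
    (moveOp N g.R⁻¹ (invShift g 0) (evolution m V (-g.time) ψ))] with x hx
  have e : galOp γ m r g 0 (evolution m V (-g.time) ψ) = phaseMul (galPhase γ m r g 0)
    (measurable_galPhase γ m r g 0)
    (moveOp N g.R⁻¹ (invShift g 0) (evolution m V (-g.time) ψ)) := rfl
  rw [e, hx]
  simp [galPhase, phase]

/-- This gives both statements: time -c' yields the composition law, and arbitrary time yields the
transformation of the evolved state. -/
theorem evolution_fibreOp {m : Mass N} (h : IsEssSelfAdjoint m V) (hV : IsInvariant V)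
    (hm : ∀ k, m k ≠ 0) (r : ℝ) (g : Galilei) (t : ℝ) (ψ : L2 (Config N)) :
    evolution m V t (fibreOp V γ m r g ψ) = galOp γ m r g t (evolution m V (t - g.time) ψ) := by
  rw [fibreOp_eq γ h hV, evolution_galOp γ h hV hm, sub_eq_add_neg, evolution_add h]
  rfl

theorem fibreOp_fibreOp {m : Mass N} (h : IsEssSelfAdjoint m V) (hV : IsInvariant V)
    (hm : ∀ k, m k ≠ 0) (r' r : ℝ) (g' g : Galilei) (ψ : L2 (Config N)) :
    fibreOp V γ m r' g' (fibreOp V γ m r g ψ) =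
      fibreOp V γ m (r + r' + xi γ g' g) (g' * g) ψ := by
  rw [fibreOp_eq γ h hV, evolution_fibreOp γ h hV hm, ← zero_sub, galOp_mul, fibreOp_eq γ h hV]
  congr 3
  simp only [Galilei.mul_def]
  ring

theorem fibreOp_eq_smul {m : Mass N} (h : IsEssSelfAdjoint m V) (hV : IsInvariant V) (r : ℝ)
    (g : Galilei) (ψ : L2 (Config N)) : fibreOp V γ m r g ψ =
      Complex.exp (Complex.I * (((∑ j, m j) * r : ℝ) : ℂ)) • fibreOp V γ m 0 g ψ := by
  rw [fibreOp_eq γ h hV, fibreOp_eq γ h hV, galOp_eq, galOp_eq, scalarOp_apply, scalarOp_apply,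
    smul_smul, ← Complex.exp_add]
  congr 2
  push_cast
  ring

theorem fibreOp_projective {m : Mass N} (h : IsEssSelfAdjoint m V) (hV : IsInvariant V)
    (hm : ∀ k, m k ≠ 0) (g' g : Galilei) (ψ : L2 (Config N)) :
    fibreOp V γ m 0 g' (fibreOp V γ m 0 g ψ) =
      Complex.exp (Complex.I * (((∑ j, m j) * xi γ g' g : ℝ) : ℂ)) •
        fibreOp V γ m 0 (g' * g) ψ := by
  rw [fibreOp_fibreOp γ h hV hm, fibreOp_eq_smul γ h hV]
  simp only [add_zero, zero_add]

end Fibre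

/-! ### Changes of variables with constant Jacobian, products -/

section Scaled

variable {α β : Type*} [MeasureSpace α] [MeasureSpace β]

theorem ae_comp_of_map_eq_smul (e : α ≃ᵐ β) {κ : ℝ}
    (he : Measure.map e volume = ENNReal.ofReal (κ ^ 2) • (volume : Measure β)) {p : β → Prop}
    (h : ∀ᵐ y, p y) : ∀ᵐ x, p (e x) := by
  refine ae_of_ae_map e.measurable.aemeasurable ?_
  rw [he]
  exact Measure.ae_smul_measure h _

/-- The scale of the measure is written κ² so that the L² norm scales by κ. -/
theorem eLpNorm_comp_of_map_eq_smul (e : α ≃ᵐ β) {κ : ℝ} (hκ : 0 < κ)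
    (he : Measure.map e volume = ENNReal.ofReal (κ ^ 2) • (volume : Measure β)) (f : β → ℂ) :
    eLpNorm (fun x => f (e x)) 2 volume = ENNReal.ofReal κ * eLpNorm f 2 volume := by
  change eLpNorm (f ∘ e) 2 volume = _
  rw [← e.measurableEmbedding.eLpNorm_map_measure, he, eLpNorm_smul_measure_of_ne_top (by simp)]
  congr 1
  rw [ENNReal.ofReal_rpow_of_pos (by positivity)]
  congr 1
  rw [← Real.rpow_natCast, ← Real.rpow_mul hκ.le]
  norm_num

theorem memLp_comp_iff_of_map_eq_smul (e : α ≃ᵐ β) {κ : ℝ} (hκ : 0 < κ)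
    (he : Measure.map e volume = ENNReal.ofReal (κ ^ 2) • (volume : Measure β)) {f : β → ℂ} :
    MemLp (fun x => f (e x)) 2 (volume : Measure α) ↔ MemLp f 2 (volume : Measure β) := by
  change MemLp (f ∘ e) 2 volume ↔ _
  rw [← e.memLp_map_measure_iff, he]
  refine ⟨fun h => h.of_measure_le_smul (c := (ENNReal.ofReal (κ ^ 2))⁻¹) (by simp [hκ.ne']) ?_,
    fun h => h.smul_measure (by simp)⟩
  rw [smul_smul, ENNReal.inv_mul_cancel (by simp [hκ.ne']) (by simp), one_smul]

theorem eLpNorm_const_mul_comp (e : α ≃ᵐ β) {κ : ℝ} (hκ : 0 < κ)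
    (he : Measure.map e volume = ENNReal.ofReal (κ ^ 2) • (volume : Measure β)) (f : β → ℂ) :
    eLpNorm (fun x => ((κ⁻¹ : ℝ) : ℂ) * f (e x)) 2 volume = eLpNorm f 2 volume := by
  have h := eLpNorm_const_smul ((κ⁻¹ : ℝ) : ℂ) (fun x => f (e x)) 2 (volume : Measure α)
  rw [eLpNorm_comp_of_map_eq_smul e hκ he] at h
  refine h.trans ?_
  rw [← mul_assoc, ← ofReal_norm, Complex.norm_real, Real.norm_of_nonneg (by positivity),
    ← ENNReal.ofReal_mul (by positivity), inv_mul_cancel₀ hκ.ne', ENNReal.ofReal_one, one_mul]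

/-- The unitary operator `ψ ↦ κ⁻¹ ψ ∘ e`, for `e` with constant Jacobian `κ⁻²`. -/
noncomputable def scaledCompEquiv (e : α ≃ᵐ β) {κ : ℝ} (hκ : 0 < κ)
    (he : Measure.map e volume = ENNReal.ofReal (κ ^ 2) • (volume : Measure β)) :
    L2 β ≃ₗᵢ[ℂ] L2 α :=
  have hm : ∀ ψ : L2 β, MemLp (fun x => ((κ⁻¹ : ℝ) : ℂ) * ψ (e x)) 2 (volume : Measure α) :=
    fun ψ => ((memLp_comp_iff_of_map_eq_smul e hκ he).2 (Lp.memLp ψ)).const_mul _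
  LinearIsometryEquiv.ofSurjective
    { toFun := fun ψ => toL2 fun x => ((κ⁻¹ : ℝ) : ℂ) * ψ (e x)
      map_add' := fun ψ χ => by
        rw [← toL2_add (hm ψ) (hm χ)]
        refine toL2_congr ?_
        filter_upwards [ae_comp_of_map_eq_smul e he (Lp.coeFn_add ψ χ)] with x h1
        rw [h1, Pi.add_apply, mul_add]
      map_smul' := fun c ψ => by
        refine Eq.trans (toL2_congr ?_) (toL2_const_mul c (hm ψ))
        filter_upwards [ae_comp_of_map_eq_smul e he (Lp.coeFn_smul c ψ)] with x h1
        rw [h1, Pi.smul_apply, smul_eq_mul]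
        ring
      norm_map' := fun ψ => by
        change ‖toL2 fun x => ((κ⁻¹ : ℝ) : ℂ) * ψ (e x)‖ = _
        rw [toL2_of_memLp (hm ψ), Lp.norm_toLp, eLpNorm_const_mul_comp e hκ he, ← Lp.norm_def] }
    (by
      intro χ
      have h : MemLp (fun y => (κ : ℂ) * χ (e.symm y)) 2 (volume : Measure β) := by
        rw [← memLp_comp_iff_of_map_eq_smul e hκ he]
        simpa using (Lp.memLp χ).const_mul (κ : ℂ)
      refine ⟨toL2 fun y => (κ : ℂ) * χ (e.symm y), toL2_eq_of_ae ?_⟩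
      filter_upwards [ae_comp_of_map_eq_smul e he (coeFn_toL2 h)] with x hx
      have hκ' : (κ : ℂ) ≠ 0 := by exact_mod_cast hκ.ne'
      rw [hx, e.symm_apply_apply]
      push_cast
      field_simp)

theorem scaledCompEquiv_apply (e : α ≃ᵐ β) {κ : ℝ} (hκ : 0 < κ)
    (he : Measure.map e volume = ENNReal.ofReal (κ ^ 2) • (volume : Measure β)) (ψ : L2 β) :
    scaledCompEquiv e hκ he ψ = toL2 fun x => ((κ⁻¹ : ℝ) : ℂ) * ψ (e x) := rfl

theorem scaledCompEquiv_ae (e : α ≃ᵐ β) {κ : ℝ} (hκ : 0 < κ)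
    (he : Measure.map e volume = ENNReal.ofReal (κ ^ 2) • (volume : Measure β)) (ψ : L2 β) :
    scaledCompEquiv e hκ he ψ =ᵐ[volume] fun x => ((κ⁻¹ : ℝ) : ℂ) * ψ (e x) :=
  coeFn_toL2 (((memLp_comp_iff_of_map_eq_smul e hκ he).2 (Lp.memLp ψ)).const_mul _)

end Scaled

/-! ### The Fourier-Plancherel transform -/

section Fourier

open SchwartzMap

variable {d : ℕ}

local notation "𝔼" => EuclideanSpace ℝ (Fin d)

/-- Multiplication by `(2π)⁻¹`. -/
noncomputable def dilation (d : ℕ) :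
    EuclideanSpace ℝ (Fin d) ≃ₜ EuclideanSpace ℝ (Fin d) :=
  Homeomorph.smulOfNeZero ((2 * Real.pi)⁻¹ : ℝ) (by positivity)

/-- The kernel of `𝓕` has frequency 2π, so passing to e^{-iP·x} rescales by 2π; the normalising
factor (2π)^{d/2} is the square root of the Jacobian. -/
theorem map_dilation : Measure.map (dilation d).toMeasurableEquiv volume =
    ENNReal.ofReal (((2 * Real.pi) ^ ((d : ℝ) / 2)) ^ 2) • (volume : Measure 𝔼) := by
  have h := Measure.map_addHaar_smul (volume : Measure 𝔼)
    (r := ((2 * Real.pi)⁻¹ : ℝ)) (by positivity)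
  refine Eq.trans h ?_
  congr 2
  rw [finrank_euclideanSpace_fin, abs_of_pos (by positivity), ← Real.rpow_natCast (_ ^ _) 2,
    ← Real.rpow_mul (by positivity), inv_pow, inv_inv, ← Real.rpow_natCast]
  congr 1
  push_cast
  ring

theorem two_pi_rpow_pos (d : ℕ) : 0 < (2 * Real.pi) ^ ((d : ℝ) / 2) := by positivity

theorem two_pi_rpow_neg (d : ℕ) :
    (2 * Real.pi) ^ (-(d : ℝ) / 2) = ((2 * Real.pi) ^ ((d : ℝ) / 2))⁻¹ := by
  rw [neg_div, Real.rpow_neg (by positivity)]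

/-- The inverse Fourier-Plancherel transform as a unitary operator. -/
noncomputable def fourierInvE (d : ℕ) :
    L2 (EuclideanSpace ℝ (Fin d)) ≃ₗᵢ[ℂ] L2 (EuclideanSpace ℝ (Fin d)) :=
  (Lp.fourierTransformₗᵢ (EuclideanSpace ℝ (Fin d)) ℂ).symm.trans
    (scaledCompEquiv (dilation d).toMeasurableEquiv (two_pi_rpow_pos d) map_dilation)

/-- The Fourier-Plancherel transform as a unitary operator. -/
noncomputable def fourierE (d : ℕ) :
    L2 (EuclideanSpace ℝ (Fin d)) ≃ₗᵢ[ℂ] L2 (EuclideanSpace ℝ (Fin d)) :=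
  (Lp.fourierTransformₗᵢ (EuclideanSpace ℝ (Fin d)) ℂ).trans
    (scaledCompEquiv (dilation d).toMeasurableEquiv (two_pi_rpow_pos d) map_dilation)

theorem fourierE_apply (ψ : L2 𝔼) : fourierE d ψ = fourierL2 ψ := by
  unfold fourierL2
  rw [two_pi_rpow_neg]
  rfl

theorem fourierInvE_apply (ψ : L2 𝔼) : fourierInvE d ψ = fourierInvL2 ψ := by
  unfold fourierInvL2
  rw [two_pi_rpow_neg]
  rfl

/-- Identities between unitary operators are checked on Schwartz functions only, where the transform
is a pointwise integral. -/
theorem dense_schwartz : Dense (Set.range fun f : 𝓢(𝔼, ℂ) => (toL2 f : L2 𝔼)) := by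
  have h := denseRange_toLpCLM (E := 𝔼) (F := ℂ) (p := 2) (μ := volume) (by simp)
  have e : (fun f : 𝓢(𝔼, ℂ) => (toL2 f : L2 𝔼)) = toLpCLM ℝ ℂ 2 volume :=
    funext fun f => toL2_of_memLp (f.memLp 2)
  rw [e]
  exact h

theorem fourierE_schwartz (f : 𝓢(𝔼, ℂ)) : fourierE d (toL2 f) =
    toL2 fun P => (((2 * Real.pi) ^ ((d : ℝ) / 2))⁻¹ : ℝ) *
      (𝓕 (f : 𝔼 → ℂ) ((2 * Real.pi)⁻¹ • P)) := by
  rw [toL2_of_memLp (f.memLp 2)]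
  refine toL2_congr ?_
  have e : Lp.fourierTransformₗᵢ 𝔼 ℂ ((f.memLp 2 volume).toLp f) = (𝓕 f).toLp 2 :=
    f.toLp_fourier_eq
  filter_upwards [ae_comp_of_map_eq_smul (dilation d).toMeasurableEquiv map_dilation
    ((𝓕 f).coeFn_toLp 2 volume)] with x hx
  rw [← fourier_coe]
  refine congrArg (_ * ·) (Eq.trans ?_ hx)
  exact congrArg (fun g : L2 𝔼 => g ((dilation d).toMeasurableEquiv x)) e

theorem fourierInvE_schwartz (f : 𝓢(𝔼, ℂ)) : fourierInvE d (toL2 f) =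
    toL2 fun P => (((2 * Real.pi) ^ ((d : ℝ) / 2))⁻¹ : ℝ) *
      (𝓕⁻ (f : 𝔼 → ℂ) ((2 * Real.pi)⁻¹ • P)) := by
  rw [toL2_of_memLp (f.memLp 2)]
  refine toL2_congr ?_
  have e : (Lp.fourierTransformₗᵢ 𝔼 ℂ).symm ((f.memLp 2 volume).toLp f) = (𝓕⁻ f).toLp 2 :=
    f.toLp_fourierInv_eq
  filter_upwards [ae_comp_of_map_eq_smul (dilation d).toMeasurableEquiv map_dilation
    ((𝓕⁻ f).coeFn_toLp 2 volume)] with x hx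
  rw [← fourierInv_coe]
  refine congrArg (_ * ·) (Eq.trans ?_ hx)
  exact congrArg (fun g : L2 𝔼 => g ((dilation d).toMeasurableEquiv x)) e

/-- The Schwartz function `P ↦ (2π)^{-d/2} f(P / 2π)`. -/
noncomputable def dilateSchwartz (f : 𝓢(𝔼, ℂ)) : 𝓢(𝔼, ℂ) :=
  (((2 * Real.pi) ^ ((d : ℝ) / 2))⁻¹ : ℝ) •
    compCLMOfContinuousLinearEquiv ℝ (ContinuousLinearEquiv.smulLeft
      (Units.mk0 ((2 * Real.pi)⁻¹ : ℝ) (by positivity))) f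

theorem dilateSchwartz_apply (f : 𝓢(𝔼, ℂ)) (P : 𝔼) : dilateSchwartz f P =
    (((2 * Real.pi) ^ ((d : ℝ) / 2))⁻¹ : ℝ) * f ((2 * Real.pi)⁻¹ • P) := by
  unfold dilateSchwartz
  rw [smul_apply, Complex.real_smul]
  rfl

theorem memLp_dilate_fourier (f : 𝓢(𝔼, ℂ)) :
    MemLp (fun P => ((((2 * Real.pi) ^ ((d : ℝ) / 2))⁻¹ : ℝ) : ℂ) *
      (𝓕 (f : 𝔼 → ℂ) ((2 * Real.pi)⁻¹ • P))) 2 (volume : Measure 𝔼) := by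
  have := (dilateSchwartz (𝓕 f)).memLp 2 (volume : Measure 𝔼)
  rw [funext (dilateSchwartz_apply (𝓕 f))] at this
  exact this

theorem fourier_const_smul (c : ℂ) (h : 𝔼 → ℂ) (w : 𝔼) : 𝓕 (c • h) w = c * 𝓕 h w := by
  rw [Real.fourier_eq', Real.fourier_eq', ← integral_const_mul]
  congr 1
  funext v
  rw [Pi.smul_apply, smul_comm, smul_eq_mul]

theorem fourier_comp_dilation (h : 𝔼 → ℂ) (w : 𝔼) :
    𝓕 (fun v => h ((2 * Real.pi)⁻¹ • v)) w =
      (((2 * Real.pi) ^ (d : ℝ) : ℝ) : ℂ) * 𝓕 h ((2 * Real.pi) • w) := by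
  rw [Real.fourier_eq, Real.fourier_eq]
  have e := Measure.integral_comp_inv_smul (volume : Measure 𝔼)
    (fun u => Real.fourierChar (-⟪u, (2 * Real.pi) • w⟫) • h u) (2 * Real.pi)
  rw [finrank_euclideanSpace_fin, abs_of_pos (by positivity), Complex.real_smul] at e
  rw [Real.rpow_natCast, ← e]
  congr 1
  funext v
  rw [inner_smul_left, inner_smul_right]
  congr 3
  simp only [conj_trivial]
  field_simp

theorem ext_of_dense {S T : L2 𝔼 ≃ₗᵢ[ℂ] L2 𝔼} (h : ∀ f : 𝓢(𝔼, ℂ), S (toL2 f) = T (toL2 f))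
    (ψ : L2 𝔼) : S ψ = T ψ := by
  have := Continuous.ext_on dense_schwartz S.continuous T.continuous (by
    rintro _ ⟨f, rfl⟩
    exact h f)
  exact congrFun this ψ

/-- The two transforms are dilated separately, so inversion is not immediate: the dilation inside
the second contributes (2π)^d, which cancels the two normalising constants. -/
theorem fourierE_fourierInvE (ψ : L2 𝔼) : fourierE d (fourierInvE d ψ) = ψ := by
  refine ext_of_dense (S := (fourierInvE d).trans (fourierE d)) (T := 1) (fun f => ?_) ψ
  change fourierE d (fourierInvE d (toL2 f)) = toL2 f
  have e1 : fourierInvE d (toL2 f) = toL2 (dilateSchwartz (𝓕⁻ f)) := by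
    rw [fourierInvE_schwartz]
    congr 1
    funext P
    rw [dilateSchwartz_apply, fourierInv_coe]
  rw [e1, fourierE_schwartz]
  congr 1
  funext P
  have e2 : (dilateSchwartz (𝓕⁻ f) : 𝔼 → ℂ) = ((((2 * Real.pi) ^ ((d : ℝ) / 2))⁻¹ : ℝ) : ℂ) •
      fun v => (𝓕⁻ f) ((2 * Real.pi)⁻¹ • v) := funext fun v => dilateSchwartz_apply _ v
  have e3 : 𝓕 (dilateSchwartz (𝓕⁻ f) : 𝔼 → ℂ) ((2 * Real.pi)⁻¹ • P) =
      ((((2 * Real.pi) ^ ((d : ℝ) / 2))⁻¹ : ℝ) : ℂ) *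
        ((((2 * Real.pi) ^ (d : ℝ) : ℝ) : ℂ) * f P) := by
    rw [e2, fourier_const_smul, fourier_comp_dilation,
      smul_inv_smul₀ (by positivity : (2 * Real.pi) ≠ 0), ← fourier_coe,
      FourierTransform.fourier_fourierInv_eq]
  rw [e3, ← mul_assoc, ← mul_assoc, ← Complex.ofReal_mul, ← Complex.ofReal_mul]
  have e4 : ((2 * Real.pi) ^ ((d : ℝ) / 2))⁻¹ * ((2 * Real.pi) ^ ((d : ℝ) / 2))⁻¹ *
      (2 * Real.pi) ^ (d : ℝ) = 1 := by
    have : (2 * Real.pi) ^ (d : ℝ) =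
        (2 * Real.pi) ^ ((d : ℝ) / 2) * (2 * Real.pi) ^ ((d : ℝ) / 2) := by
      rw [← Real.rpow_add (by positivity)]
      congr 1
      ring
    rw [this]
    have := two_pi_rpow_pos d
    field_simp
  rw [e4, Complex.ofReal_one, one_mul]

theorem fourierInvE_fourierE (ψ : L2 𝔼) : fourierInvE d (fourierE d ψ) = ψ :=
  (fourierE d).injective (fourierE_fourierInvE _)

/-- The translation `ψ ↦ ψ(· + β)`. -/
noncomputable def shiftOp (β : 𝔼) : L2 𝔼 ≃ₗᵢ[ℂ] L2 𝔼 :=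
  compEquiv (Homeomorph.addRight β).toMeasurableEquiv (measurePreserving_add_right volume β)

theorem shiftOp_ae (β : 𝔼) (ψ : L2 𝔼) : shiftOp β ψ =ᵐ[volume] fun x => ψ (x + β) :=
  compEquiv_ae _ _ ψ

/-- Multiplication by `e^{i x·α}`. -/
noncomputable def modOp (α : 𝔼) : L2 𝔼 ≃ₗᵢ[ℂ] L2 𝔼 :=
  phaseMul (fun x => ⟪x, α⟫) (by fun_prop)

theorem modOp_ae (α : 𝔼) (ψ : L2 𝔼) :
    modOp α ψ =ᵐ[volume] fun x => Complex.exp (Complex.I * ((⟪x, α⟫ : ℝ) : ℂ)) * ψ x :=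
  phaseMul_ae _ _ ψ

/-- The orthogonal change of variables `ψ ↦ ψ ∘ A`. -/
noncomputable def orthOp (A : 𝔼 ≃ₗᵢ[ℝ] 𝔼) : L2 𝔼 ≃ₗᵢ[ℂ] L2 𝔼 :=
  compEquiv A.toHomeomorph.toMeasurableEquiv A.measurePreserving

theorem orthOp_ae (A : 𝔼 ≃ₗᵢ[ℝ] 𝔼) (ψ : L2 𝔼) : orthOp A ψ =ᵐ[volume] fun x => ψ (A x) :=
  compEquiv_ae _ _ ψ

theorem fourier_comp_add_right (h : 𝔼 → ℂ) (β w : 𝔼) : 𝓕 (fun v => h (v + β)) w =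
    Complex.exp (Complex.I * ((2 * Real.pi * ⟪w, β⟫ : ℝ) : ℂ)) * 𝓕 h w := by
  rw [Real.fourier_eq', Real.fourier_eq', ← integral_const_mul]
  rw [← integral_add_right_eq_self (fun v => Complex.exp (Complex.I *
    ((2 * Real.pi * ⟪w, β⟫ : ℝ) : ℂ)) *
      (Complex.exp (((-2 * Real.pi * ⟪v, w⟫ : ℝ) : ℂ) * Complex.I) • h v)) β]
  congr 1
  funext v
  rw [smul_eq_mul, smul_eq_mul, ← mul_assoc, ← Complex.exp_add, inner_add_left,
    real_inner_comm w β]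
  congr 2
  push_cast
  ring

theorem fourierE_shiftOp (β : 𝔼) (ψ : L2 𝔼) :
    fourierE d (shiftOp β ψ) = modOp β (fourierE d ψ) := by
  refine ext_of_dense (S := (shiftOp β).trans (fourierE d))
    (T := (fourierE d).trans (modOp β)) (fun f => ?_) ψ
  change fourierE d (shiftOp β (toL2 f)) = modOp β (fourierE d (toL2 f))
  have e : shiftOp β (toL2 f) = toL2 (compSubConstCLM ℝ (-β) f) := by
    refine (compEquiv_toL2 _ _ (f.memLp 2 volume)).trans ?_
    congr 1
    funext x
    rw [compSubConstCLM_apply, sub_neg_eq_add]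
    rfl
  have e' : (compSubConstCLM ℝ (-β) f : 𝔼 → ℂ) = fun v => f (v + β) := by
    funext x
    rw [compSubConstCLM_apply, sub_neg_eq_add]
  rw [e, fourierE_schwartz, e']
  refine toL2_eq_of_ae ?_
  have hm := memLp_dilate_fourier f
  rw [fourierE_schwartz, modOp, phaseMul_toL2 _ _ hm]
  refine .trans ?_ (coeFn_toL2 (memLp_phase_mul ?_ hm)).symm
  · refine .of_forall fun P => ?_
    simp only
    rw [fourier_comp_add_right, inner_smul_left, conj_trivial,
      mul_inv_cancel_left₀ (by positivity : (2 * Real.pi) ≠ 0), mul_left_comm]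
  · fun_prop

theorem fourierE_orthOp (A : 𝔼 ≃ₗᵢ[ℝ] 𝔼) (ψ : L2 𝔼) :
    fourierE d (orthOp A ψ) = orthOp A (fourierE d ψ) := by
  refine ext_of_dense (S := (orthOp A).trans (fourierE d))
    (T := (fourierE d).trans (orthOp A)) (fun f => ?_) ψ
  change fourierE d (orthOp A (toL2 f)) = orthOp A (fourierE d (toL2 f))
  have e : orthOp A (toL2 f) =
      toL2 (compCLMOfContinuousLinearEquiv ℝ A.toContinuousLinearEquiv f) :=
    compEquiv_toL2 _ _ (f.memLp 2 volume)
  rw [e, fourierE_schwartz, fourierE_schwartz]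
  have hm := memLp_dilate_fourier f
  refine Eq.trans ?_ (compEquiv_toL2 _ _ hm).symm
  congr 1
  funext P
  have := Real.fourier_comp_linearIsometry A (f : 𝔼 → ℂ) ((2 * Real.pi)⁻¹ • P)
  rw [map_smul] at this
  exact congrArg (_ * ·) this

theorem fourierInvE_modOp (α : 𝔼) (ψ : L2 𝔼) :
    fourierInvE d (modOp α ψ) = shiftOp α (fourierInvE d ψ) := by
  apply (fourierE d).injective
  rw [fourierE_shiftOp, fourierE_fourierInvE, fourierE_fourierInvE]

/-- The inverse transform is the reflected direct one, which carries the translation law over. -/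
theorem fourierInvE_neg (ψ : L2 𝔼) :
    fourierInvE d ψ = orthOp (LinearIsometryEquiv.neg ℝ) (fourierE d ψ) := by
  refine ext_of_dense (S := fourierInvE d)
    (T := (fourierE d).trans (orthOp (LinearIsometryEquiv.neg ℝ))) (fun f => ?_) ψ
  change fourierInvE d (toL2 f) = orthOp _ (fourierE d (toL2 f))
  have hm := memLp_dilate_fourier f
  rw [fourierE_schwartz, fourierInvE_schwartz]
  refine Eq.trans ?_ (compEquiv_toL2 _ _ hm).symm
  congr 1
  funext P
  refine congrArg (_ * ·) ?_
  rw [Real.fourierInv_eq_fourier_neg, ← smul_neg]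
  rfl

theorem fourierInvE_shiftOp (β : 𝔼) (ψ : L2 𝔼) :
    fourierInvE d (shiftOp β ψ) = modOp (-β) (fourierInvE d ψ) := by
  rw [fourierInvE_neg, fourierE_shiftOp, fourierInvE_neg]
  refine Lp.ext ?_
  have hA := (LinearIsometryEquiv.neg ℝ (E := 𝔼)).measurePreserving.quasiMeasurePreserving
  filter_upwards [orthOp_ae (LinearIsometryEquiv.neg ℝ) (modOp β (fourierE d ψ)),
    hA.ae (modOp_ae β (fourierE d ψ)), orthOp_ae (LinearIsometryEquiv.neg ℝ) (fourierE d ψ),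
    modOp_ae (-β) (orthOp (LinearIsometryEquiv.neg ℝ) (fourierE d ψ))] with x h1 h2 h3 h4
  rw [h1, h2, h4, h3, inner_neg_right]
  simp

end Fourier

/-! ### Jacobi coordinates -/

section Jacobi

variable {N : ℕ} (m : Mass N)

/-- The matrix of the change to centre-of-mass and Jacobi coordinates. -/
noncomputable def jacobiCoeff : Option (Fin (N - 1)) → Fin N → ℝ
  | none, k => m k / tailMass m 0
  | some j, k => (if k = idx j then 1 else 0) -
      if (j : ℕ) + 1 ≤ k then m k / tailMass m (j + 1) else 0

/-- The total mass and the reduced masses. -/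
noncomputable def jacobiMass : Option (Fin (N - 1)) → ℝ
  | none => tailMass m 0
  | some j => reducedMass m j

/-- The embedding of three-space as one of the Jacobi coordinates. -/
noncomputable def jacobiEmb (n : ℕ) : Option (Fin n) → E3 →L[ℝ] E3 × Config n
  | none => ContinuousLinearMap.inl ℝ E3 (Config n)
  | some j => (ContinuousLinearMap.inr ℝ E3 (Config n)).comp
      (ContinuousLinearMap.single ℝ (fun _ : Fin n => E3) j)

theorem tailMass_zero : tailMass m 0 = ∑ j, m j := by simp [tailMass]

theorem tailMass_succ (j : Fin (N - 1)) : m (idx j) + tailMass m (j + 1) = tailMass m j := by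
  have h : m (idx j) = ∑ k, if k = idx j then m k else 0 := by simp
  rw [h]
  simp only [tailMass, ← Finset.sum_add_distrib]
  refine Finset.sum_congr rfl fun k _ => ?_
  have e : k = idx j ↔ (k : ℕ) = j := Fin.ext_iff
  by_cases h1 : k = idx j
  · have := e.1 h1
    simp [h1, idx]
  · have h2 : (k : ℕ) ≠ j := fun h => h1 (e.2 h)
    have h3 : (j : ℕ) + 1 ≤ k ↔ (j : ℕ) ≤ k := by omega
    simp [h1, h3]

variable {m}

/-- Over a tail containing particle j' the coefficients sum to zero, since y_{j'} is a difference of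
a position and a weighted mean. Over a shorter tail only the weights of that mean remain. -/
theorem sum_tail_jacobiCoeff {j' : Fin (N - 1)} (hT : tailMass m (j' + 1) ≠ 0) (a : ℕ) :
    (∑ k : Fin N, if a ≤ (k : ℕ) then jacobiCoeff m (some j') k else 0) =
      if a ≤ (j' : ℕ) then 0 else -(tailMass m a / tailMass m (j' + 1)) := by
  have h : ∀ k : Fin N, (if a ≤ (k : ℕ) then jacobiCoeff m (some j') k else 0) =
      (if k = idx j' then (if a ≤ (j' : ℕ) then 1 else 0) else 0) -
        (if max a (j' + 1) ≤ (k : ℕ) then m k else 0) / tailMass m (j' + 1) := by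
    intro k
    have e : k = idx j' ↔ (k : ℕ) = j' := Fin.ext_iff
    simp only [jacobiCoeff, e, sup_le_iff]
    split_ifs <;> first | omega | simp
  simp only [h, Finset.sum_sub_distrib, ← Finset.sum_div, Finset.sum_ite_eq', Finset.mem_univ,
    if_true]
  change _ - tailMass m (max a (j' + 1)) / _ = _
  split_ifs with h1
  · rw [max_eq_right (by omega), div_self hT, sub_self]
  · rw [max_eq_left (by omega), zero_sub]

/-- The rows are orthogonal for the inverse mass form, with squared lengths the inverse total and
reduced masses. This diagonalises the kinetic energy; the centre row divided by m_k is constant, so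
it pairs to zero with each relative row. -/
theorem sum_jacobiCoeff (hm : ∀ k, m k ≠ 0) (hT : ∀ k, k < N → tailMass m k ≠ 0) (hN : 1 ≤ N)
    (o o' : Option (Fin (N - 1))) : ∑ k, 1 / m k * (jacobiCoeff m o k * jacobiCoeff m o' k) =
      if o = o' then 1 / jacobiMass m o else 0 := by
  have hT' : ∀ j : Fin (N - 1), tailMass m (j + 1) ≠ 0 := fun j => hT _ (by omega)
  have h0 := hT 0 hN
  have hnone : ∀ j : Fin (N - 1), ∑ k, 1 / m k * (jacobiCoeff m none k * jacobiCoeff m (some j) k)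
      = 0 := by
    intro j
    have h := sum_tail_jacobiCoeff (hT' j) 0
    simp only [Nat.zero_le, if_true] at h
    have e : ∀ k, 1 / m k * (jacobiCoeff m none k * jacobiCoeff m (some j) k) =
        1 / tailMass m 0 * jacobiCoeff m (some j) k := by
      intro k
      have := hm k
      simp only [jacobiCoeff]
      field_simp
    simp only [e, ← Finset.mul_sum, h, mul_zero]
  match o, o' with
  | none, none =>
    have e : ∀ k, 1 / m k * (jacobiCoeff m none k * jacobiCoeff m none k) =
        1 / tailMass m 0 ^ 2 * m k := by
      intro k
      have := hm k
      simp only [jacobiCoeff]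
      field_simp
    simp only [e, ← Finset.mul_sum, ← tailMass_zero, if_true, jacobiMass]
    field_simp
  | none, some j => simpa using hnone j
  | some j, none => simpa [mul_comm (jacobiCoeff m (some j) _)] using hnone j
  | some j, some j' =>
    -- Divided by m_k, row j is a point mass at particle j plus a constant on its tail, so its
    -- pairing with row j' reduces to tail sums of row j'.
    have e : ∀ k : Fin N, 1 / m k * (jacobiCoeff m (some j) k * jacobiCoeff m (some j') k) =
        (if k = idx j then 1 / m k * jacobiCoeff m (some j') k else 0) - 1 / tailMass m (j + 1) *
          if (j : ℕ) + 1 ≤ k then jacobiCoeff m (some j') k else 0 := by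
      intro k
      have := hm k
      have := hT' j
      conv_lhs => rw [jacobiCoeff]
      split_ifs <;> field_simp <;> simp
    simp only [e, Finset.sum_sub_distrib, ← Finset.mul_sum, sum_tail_jacobiCoeff (hT' j'),
      Finset.sum_ite_eq', Finset.mem_univ, if_true, Option.some_inj]
    have hi : idx j = idx j' ↔ j = j' := by simp [idx, Fin.ext_iff]
    have hv : ((idx j : Fin N) : ℕ) = j := rfl
    simp only [jacobiCoeff, hi, hv]
    have h1 := hm (idx j)
    have h2 := hT' j
    have h3 := hT' j'
    rcases lt_trichotomy (j : ℕ) j' with h | h | h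
    · rw [if_neg (by rw [Fin.ext_iff]; omega), if_neg (by omega), if_pos (by omega),
        if_neg (by rw [Fin.ext_iff]; omega)]
      simp
    · obtain rfl : j = j' := Fin.ext h
      have h4 : m (idx j) + tailMass m (j + 1) ≠ 0 := by
        rw [tailMass_succ]
        exact hT _ (by omega)
      rw [if_pos rfl, if_neg (by omega), if_neg (by omega), if_pos rfl]
      simp only [jacobiMass, reducedMass]
      field_simp
      ring
    · rw [if_neg (by rw [Fin.ext_iff]; omega), if_pos (by omega), if_neg (by omega),
        if_neg (by rw [Fin.ext_iff]; omega)]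
      field_simp
      ring

variable (m)

/-- The change to centre-of-mass and Jacobi coordinates. -/
noncomputable def jacobiMap : Config N →L[ℝ] E3 × Config (N - 1) :=
  ∑ o, (jacobiEmb (N - 1) o).comp
    (∑ k, jacobiCoeff m o k • ContinuousLinearMap.proj (R := ℝ) (φ := fun _ : Fin N => E3) k)

theorem jacobiMap_apply (x : Config N) : jacobiMap m x = (tailCentre m 0 x, jacobi m x) := by
  have h : jacobiMap m x = ∑ o, jacobiEmb (N - 1) o (∑ k, jacobiCoeff m o k • x k) := by
    simp [jacobiMap, sum_apply]
  rw [h, Fintype.sum_option]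
  refine Prod.ext ?_ ?_
  · simp [jacobiEmb, Prod.fst_sum, tailCentre, jacobiCoeff, Finset.smul_sum, smul_smul,
      div_eq_inv_mul]
  · funext j
    simp only [jacobiEmb, Prod.snd_add, Prod.snd_sum, ContinuousLinearMap.inl_apply, zero_add,
      ContinuousLinearMap.comp_apply, ContinuousLinearMap.inr_apply, Finset.sum_apply,
      ContinuousLinearMap.single_apply, Finset.sum_pi_single, Finset.mem_univ, if_true]
    simp only [jacobi, tailCentre, jacobiCoeff, sub_smul, Finset.sum_sub_distrib, ite_smul,
      one_smul, zero_smul, Finset.sum_ite_eq', Finset.mem_univ, if_true, Finset.smul_sum,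
      smul_ite, smul_zero, smul_smul, div_eq_inv_mul]

theorem jacobiMap_single (k : Fin N) (u : E3) : jacobiMap m (Pi.single k u) =
    ∑ o, jacobiCoeff m o k • jacobiEmb (N - 1) o u := by
  simp only [jacobiMap, sum_apply, ContinuousLinearMap.comp_apply, smul_apply,
    ContinuousLinearMap.proj_apply]
  refine Finset.sum_congr rfl fun o _ => ?_
  rw [← map_smul]
  congr 1
  rw [Finset.sum_eq_single k]
  · simp
  · intro j _ hj
    simp [hj]
  · simp

theorem jacobiMap_eq_sum (x : Config N) :
    jacobiMap m x = ∑ o, jacobiEmb (N - 1) o (∑ k, jacobiCoeff m o k • x k) := by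
  simp [jacobiMap, sum_apply]

variable {m}

theorem jacobiMass_ne_zero (hm : ∀ k, m k ≠ 0) (hT : ∀ k, k < N → tailMass m k ≠ 0) (hN : 1 ≤ N)
    (o : Option (Fin (N - 1))) : jacobiMass m o ≠ 0 := by
  match o with
  | none => exact hT 0 hN
  | some j =>
    refine div_ne_zero (mul_ne_zero (hm _) (hT _ (by omega))) ?_
    rw [tailMass_succ]
    exact hT _ (by omega)

theorem jacobiMap_surjective (hm : ∀ k, m k ≠ 0) (hT : ∀ k, k < N → tailMass m k ≠ 0)
    (hN : 1 ≤ N) : Function.Surjective (jacobiMap m) := by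
  intro p
  let c : Option (Fin (N - 1)) → E3 := fun o => o.elim p.1 p.2
  -- The preimage is the inverse that orthogonality dictates: transpose, weighted by 1/m_k on one
  -- side and the reduced mass on the other.
  refine ⟨fun k => ∑ o, (1 / m k * jacobiCoeff m o k * jacobiMass m o) • c o, ?_⟩
  have h : ∀ o, ∑ k, jacobiCoeff m o k • ∑ o', (1 / m k * jacobiCoeff m o' k * jacobiMass m o') •
      c o' = c o := by
    intro o
    simp only [Finset.smul_sum, smul_smul]
    rw [Finset.sum_comm]
    have e : ∀ o', ∑ k, (jacobiCoeff m o k * (1 / m k * jacobiCoeff m o' k * jacobiMass m o')) •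
        c o' = if o = o' then c o else 0 := by
      intro o'
      rw [← Finset.sum_smul]
      have e1 : ∑ k, jacobiCoeff m o k * (1 / m k * jacobiCoeff m o' k * jacobiMass m o') =
          (∑ k, 1 / m k * (jacobiCoeff m o k * jacobiCoeff m o' k)) * jacobiMass m o' := by
        rw [Finset.sum_mul]
        exact Finset.sum_congr rfl fun k _ => by ring
      rw [e1, sum_jacobiCoeff hm hT hN]
      split_ifs with ho
      · rw [← ho, one_div, inv_mul_cancel₀ (jacobiMass_ne_zero hm hT hN o), one_smul]
      · simp
    simp only [e, Finset.sum_ite_eq, Finset.mem_univ, if_true]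
  rw [jacobiMap_eq_sum]
  simp only [h]
  rw [Fintype.sum_option]
  refine Prod.ext ?_ ?_
  · simp [jacobiEmb, Prod.fst_sum, c]
  · funext j
    simp [jacobiEmb, Prod.snd_sum, c]

theorem jacobiMap_bijective (hm : ∀ k, m k ≠ 0) (hT : ∀ k, k < N → tailMass m k ≠ 0)
    (hN : 1 ≤ N) : Function.Bijective (jacobiMap m) := by
  refine ⟨?_, jacobiMap_surjective hm hT hN⟩
  have h : Module.finrank ℝ (Config N) = Module.finrank ℝ (E3 × Config (N - 1)) := by
    simp only [Module.finrank_pi_fintype, Module.finrank_prod, finrank_euclideanSpace_fin,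
      Finset.sum_const, Finset.card_univ, Fintype.card_fin, smul_eq_mul]
    omega
  exact (LinearMap.injective_iff_surjective_of_finrank_eq_finrank (f := (jacobiMap m).toLinearMap)
    h).2 (jacobiMap_surjective hm hT hN)

/-- The change to centre-of-mass and Jacobi coordinates as an isomorphism. -/
noncomputable def jacobiEquiv (hm : ∀ k, m k ≠ 0) (hT : ∀ k, k < N → tailMass m k ≠ 0)
    (hN : 1 ≤ N) : Config N ≃L[ℝ] E3 × Config (N - 1) :=
  (LinearEquiv.ofBijective (jacobiMap m).toLinearMap
    (jacobiMap_bijective hm hT hN)).toContinuousLinearEquiv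

theorem jacobiEquiv_apply (hm : ∀ k, m k ≠ 0) (hT : ∀ k, k < N → tailMass m k ≠ 0)
    (hN : 1 ≤ N) (x : Config N) : jacobiEquiv hm hT hN x = (tailCentre m 0 x, jacobi m x) :=
  jacobiMap_apply m x

/-- Uniqueness of Haar measure gives a constant Jacobian. Its value is never needed, as it cancels
in every linear identity. -/
theorem exists_map_volume_eq_smul {X Y : Type*} [NormedAddCommGroup X] [NormedSpace ℝ X]
    [MeasureSpace X] [BorelSpace X] [NormedAddCommGroup Y] [NormedSpace ℝ Y] [MeasureSpace Y]
    [BorelSpace Y] [FiniteDimensional ℝ X] [FiniteDimensional ℝ Y]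
    [(volume : Measure X).IsAddHaarMeasure] [(volume : Measure Y).IsAddHaarMeasure]
    (J : X ≃L[ℝ] Y) : ∃ κ : ℝ, 0 < κ ∧ Measure.map J.toHomeomorph.toMeasurableEquiv volume =
      ENNReal.ofReal (κ ^ 2) • (volume : Measure Y) := by
  have h : (Measure.map J (volume : Measure X)).IsAddHaarMeasure :=
    J.isAddHaarMeasure_map volume
  let c : NNReal := Measure.addHaarScalarFactor (Measure.map J (volume : Measure X))
    (volume : Measure Y)
  have hc : 0 < c := Measure.addHaarScalarFactor_pos_of_isAddHaarMeasure _ _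
  refine ⟨Real.sqrt c, Real.sqrt_pos.2 hc, ?_⟩
  rw [Real.sq_sqrt c.coe_nonneg, ENNReal.ofReal_coe_nnreal]
  exact Measure.isAddLeftInvariant_eq_smul (Measure.map J (volume : Measure X)) _

/-- By the chain rule each Δ_k is a double sum of mixed derivatives over Jacobi directions; summing
over k with weights 1/(2m_k), orthogonality of the rows kills the mixed ones. -/
theorem sum_partialLaplacian_jacobi (hm : ∀ k, m k ≠ 0)
    (hT : ∀ k, k < N → tailMass m k ≠ 0) (hN : 1 ≤ N) {F : E3 × Config (N - 1) → ℂ}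
    (hF : ContDiff ℝ ∞ F) (x : Config N) :
    ∑ k, (1 / (2 * (m k : ℂ))) * partialLaplacian k (fun x => F (jacobiMap m x)) x =
      (1 / (2 * (tailMass m 0 : ℂ))) *
        Laplacian.laplacian (fun X => F (X, jacobi m x)) (tailCentre m 0 x) +
      ∑ j, (1 / (2 * (reducedMass m j : ℂ))) *
        partialLaplacian j (fun y => F (tailCentre m 0 x, y)) (jacobi m x) := by
  let b := stdOrthonormalBasis ℝ E3
  let D : Option (Fin (N - 1)) → Option (Fin (N - 1)) → Fin (Module.finrank ℝ E3) → ℂ :=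
    fun o o' i => dird (jacobiEmb (N - 1) o (b i)) (dird (jacobiEmb (N - 1) o' (b i)) F)
      (jacobiMap m x)
  have hf : ContDiff ℝ ∞ fun x => F (jacobiMap m x) := hF.comp (jacobiMap m).contDiff
  have hL : ∀ k, partialLaplacian k (fun x => F (jacobiMap m x)) x =
      ∑ i, ∑ o, ∑ o', (jacobiCoeff m o k : ℂ) * (jacobiCoeff m o' k : ℂ) * D o o' i := by
    intro k
    rw [partialLaplacian_eq b k hf]
    refine Finset.sum_congr rfl fun i _ => ?_
    have e1 : ∀ {G : E3 × Config (N - 1) → ℂ}, ContDiff ℝ ∞ G →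
        dird (Pi.single k (b i)) (fun x => G (jacobiMap m x)) = fun x =>
          dird (∑ o, jacobiCoeff m o k • jacobiEmb (N - 1) o (b i)) G (jacobiMap m x) := by
      intro G hG
      have := dird_comp_affine hG 0 (jacobiMap m) (Pi.single k (b i))
      simp only [zero_add] at this
      rw [this, jacobiMap_single]
    rw [e1 hF, e1 (ContDiff.dird hF _)]
    rw [dird_sum Finset.univ _ _ F, dird_finset_sum Finset.univ _ fun o => ContDiff.dird hF _]
    simp only [dird_sum, Finset.mul_sum, mul_assoc]
    rw [Finset.sum_comm]
    refine Finset.sum_congr rfl fun o _ => Finset.sum_congr rfl fun o' _ => ?_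
    simp only [D]
    ring
  have hS : ∑ k, (1 / (2 * (m k : ℂ))) * partialLaplacian k (fun x => F (jacobiMap m x)) x =
      ∑ o, (1 / (2 * (jacobiMass m o : ℂ))) * ∑ i, D o o i := by
    have e : ∀ o o', ∑ k, (1 / (2 * (m k : ℂ))) * ((jacobiCoeff m o k : ℂ) *
        (jacobiCoeff m o' k : ℂ)) = if o = o' then 1 / (2 * (jacobiMass m o : ℂ)) else 0 := by
      intro o o'
      have := congrArg (fun r : ℝ => (1 / 2 : ℂ) * (r : ℂ)) (sum_jacobiCoeff hm hT hN o o')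
      simp only at this
      rw [Complex.ofReal_sum, Finset.mul_sum] at this
      refine Eq.trans (Finset.sum_congr rfl fun k _ => ?_) (this.trans ?_)
      · push_cast
        ring
      · split_ifs
        · push_cast
          ring
        · simp
    simp only [hL, Finset.mul_sum]
    rw [Finset.sum_comm]
    simp only [Finset.sum_comm (s := (Finset.univ : Finset (Fin N)))]
    rw [Finset.sum_comm]
    refine Finset.sum_congr rfl fun o _ => Finset.sum_congr rfl fun i _ => ?_
    have e' : ∀ o', ∑ k, (1 / (2 * (m k : ℂ))) * ((jacobiCoeff m o k : ℂ) *
        (jacobiCoeff m o' k : ℂ) * D o o' i) =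
          (if o = o' then 1 / (2 * (jacobiMass m o : ℂ)) else 0) * D o o' i := by
      intro o'
      rw [← e, Finset.sum_mul]
      exact Finset.sum_congr rfl fun k _ => by ring
    simp only [e', ite_mul, zero_mul, Finset.sum_ite_eq, Finset.mem_univ, if_true]
  rw [hS, Fintype.sum_option]
  congr 1
  · have h := laplacian_comp_affine b hF (0, jacobi m x)
      (ContinuousLinearMap.inl ℝ E3 (Config (N - 1))) (tailCentre m 0 x)
    simp only [ContinuousLinearMap.inl_apply, Prod.mk_add_mk, zero_add, add_zero] at h
    rw [h]
    simp only [D, jacobiMap_apply]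
    rfl
  · refine Finset.sum_congr rfl fun j _ => ?_
    have hg : ContDiff ℝ ∞ fun y => F (tailCentre m 0 x, y) :=
      hF.comp (contDiff_const.prodMk contDiff_id)
    rw [partialLaplacian_eq b j hg]
    refine congrArg (_ * ·) (Finset.sum_congr rfl fun i _ => ?_)
    have e1 : ∀ {G : E3 × Config (N - 1) → ℂ}, ContDiff ℝ ∞ G →
        dird (Pi.single j (b i)) (fun y => G (tailCentre m 0 x, y)) = fun y =>
          dird (jacobiEmb (N - 1) (some j) (b i)) G (tailCentre m 0 x, y) := by
      intro G hG
      have := dird_comp_affine hG (tailCentre m 0 x, 0)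
        (ContinuousLinearMap.inr ℝ E3 (Config (N - 1))) (Pi.single j (b i))
      simp only [ContinuousLinearMap.inr_apply, Prod.mk_add_mk, zero_add, add_zero] at this
      rw [this]
      rfl
    rw [e1 hF, e1 (ContDiff.dird hF _)]
    simp only [D, jacobiMap_apply]

end Jacobi

/-! ### Tensor products -/

section Tensor

variable {α β : Type*} [MeasureSpace α] [MeasureSpace β]

theorem inner_toL2 {f g : α → ℂ} (hf : MemLp f 2 (volume : Measure α))
    (hg : MemLp g 2 (volume : Measure α)) :
    inner ℂ (toL2 f) (toL2 g) = ∫ x, inner ℂ (f x) (g x) := by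
  rw [L2.inner_def]
  refine integral_congr_ae ?_
  filter_upwards [coeFn_toL2 hf, coeFn_toL2 hg] with x h1 h2
  rw [h1, h2]

theorem integrable_inner_of_memLp {f g : α → ℂ} (hf : MemLp f 2 (volume : Measure α))
    (hg : MemLp g 2 (volume : Measure α)) : Integrable (fun x => inner ℂ (f x) (g x)) := by
  refine (L2.integrable_inner (𝕜 := ℂ) (toL2 f) (toL2 g)).congr ?_
  filter_upwards [coeFn_toL2 hf, coeFn_toL2 hg] with x h1 h2
  rw [h1, h2]

theorem ae_fst {p : α → Prop} (h : ∀ᵐ x, p x) : ∀ᵐ q : α × β, p q.1 :=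
  Measure.quasiMeasurePreserving_fst.ae h

theorem ae_snd {p : β → Prop} (h : ∀ᵐ x, p x) : ∀ᵐ q : α × β, p q.2 :=
  Measure.quasiMeasurePreserving_snd.ae h

variable [SFinite (volume : Measure β)]

theorem eLpNorm_tensor (a : L2 α) (b : L2 β) :
    eLpNorm (fun p : α × β => a p.1 * b p.2) 2 volume = ‖a‖ₑ * ‖b‖ₑ := by
  have h : eLpNorm (fun p : α × β => a p.1 * b p.2) 2 volume ^ 2 = (‖a‖ₑ * ‖b‖ₑ) ^ 2 := by
    rw [eLpNorm_two_sq, mul_pow, enorm_L2_sq, enorm_L2_sq]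
    simp only [enorm_mul, mul_pow]
    exact lintegral_prod_mul ((Lp.aestronglyMeasurable a).enorm.pow_const 2)
      ((Lp.aestronglyMeasurable b).enorm.pow_const 2)
  exact (ENNReal.pow_right_strictMono two_ne_zero).injective h

theorem memLp_tensor (a : L2 α) (b : L2 β) :
    MemLp (fun p : α × β => a p.1 * b p.2) 2 (volume : Measure (α × β)) := by
  refine ⟨(Lp.aestronglyMeasurable a).comp_fst.mul (Lp.aestronglyMeasurable b).comp_snd, ?_⟩
  rw [eLpNorm_tensor]
  exact ENNReal.mul_lt_top enorm_lt_top enorm_lt_top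

variable (α β) in
/-- The tensor product `(a ⊗ b)(x, y) = a(x) b(y)`. -/
noncomputable def tens : L2 α →L[ℂ] L2 β →L[ℂ] L2 (α × β) :=
  LinearMap.mkContinuous₂
    (LinearMap.mk₂ ℂ (fun a b => toL2 fun p : α × β => a p.1 * b p.2)
      (fun a a' b => by
        rw [← toL2_add (memLp_tensor a b) (memLp_tensor a' b)]
        refine toL2_congr ?_
        filter_upwards [ae_fst (β := β) (Lp.coeFn_add a a')] with p hp
        rw [hp, Pi.add_apply, add_mul])
      (fun c a b => by
        rw [← toL2_const_mul c (memLp_tensor a b)]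
        refine toL2_congr ?_
        filter_upwards [ae_fst (β := β) (Lp.coeFn_smul c a)] with p hp
        rw [hp, Pi.smul_apply, smul_eq_mul, mul_assoc])
      (fun a b b' => by
        rw [← toL2_add (memLp_tensor a b) (memLp_tensor a b')]
        refine toL2_congr ?_
        filter_upwards [ae_snd (α := α) (Lp.coeFn_add b b')] with p hp
        rw [hp, Pi.add_apply, mul_add])
      (fun c a b => by
        rw [← toL2_const_mul c (memLp_tensor a b)]
        refine toL2_congr ?_
        filter_upwards [ae_snd (α := α) (Lp.coeFn_smul c b)] with p hp
        rw [hp, Pi.smul_apply, smul_eq_mul, mul_left_comm])) 1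
    (fun a b => by
      change ‖toL2 fun p : α × β => a p.1 * b p.2‖ ≤ _
      rw [toL2_of_memLp (memLp_tensor a b), Lp.norm_toLp, eLpNorm_tensor, one_mul,
        ENNReal.toReal_mul, toReal_enorm, toReal_enorm])

theorem tens_apply (a : L2 α) (b : L2 β) : tens α β a b = toL2 fun p => a p.1 * b p.2 := rfl

theorem tens_ae (a : L2 α) (b : L2 β) : tens α β a b =ᵐ[volume] fun p => a p.1 * b p.2 :=
  coeFn_toL2 (memLp_tensor a b)

variable [SFinite (volume : Measure α)]

theorem inner_tens_left {g : α × β → ℂ} (hg : MemLp g 2 (volume : Measure (α × β)))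
    (hs : ∀ x, MemLp (fun y => g (x, y)) 2 (volume : Measure β)) (a : L2 α) (b : L2 β) :
    inner ℂ (toL2 g) (tens α β a b) = ∫ x, a x * inner ℂ (toL2 fun y => g (x, y)) b := by
  have hi := integrable_inner_of_memLp hg (memLp_tensor a b)
  rw [tens_apply, inner_toL2 hg (memLp_tensor a b)]
  refine (integral_prod _ hi).trans ?_
  congr 1
  funext x
  have e := inner_toL2 (hs x) (Lp.memLp b)
  rw [toL2_coe] at e
  rw [e, ← integral_const_mul]
  congr 1
  funext y
  simp only [RCLike.inner_apply]
  ring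

theorem inner_tens_right {g : α × β → ℂ} (hg : MemLp g 2 (volume : Measure (α × β)))
    (hs : ∀ y, MemLp (fun x => g (x, y)) 2 (volume : Measure α)) (a : L2 α) (b : L2 β) :
    inner ℂ (toL2 g) (tens α β a b) = ∫ y, b y * inner ℂ (toL2 fun x => g (x, y)) a := by
  have hi := integrable_inner_of_memLp hg (memLp_tensor a b)
  rw [tens_apply, inner_toL2 hg (memLp_tensor a b)]
  refine (integral_prod_symm _ hi).trans ?_
  congr 1
  funext y
  have e := inner_toL2 (hs y) (Lp.memLp a)
  rw [toL2_coe] at e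
  rw [e, ← integral_const_mul]
  congr 1
  funext x
  simp only [RCLike.inner_apply]
  ring

end Tensor

/-! ### Multiplication groups -/

section Multiplication

open Filter Topology

variable {α : Type*} [MeasureSpace α] {θ : α → ℝ}

/-- The unitary group `e^{-itθ}` of multiplication operators. -/
noncomputable def mulGroup (θ : α → ℝ) (hθ : Measurable θ) (t : ℝ) : L2 α ≃ₗᵢ[ℂ] L2 α :=
  phaseMul (fun x => -(t * θ x)) (by fun_prop)

theorem mulGroup_ae (hθ : Measurable θ) (t : ℝ) (ψ : L2 α) : mulGroup θ hθ t ψ =ᵐ[volume]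
    fun x => Complex.exp (Complex.I * ((-(t * θ x) : ℝ) : ℂ)) * ψ x :=
  phaseMul_ae _ _ ψ

theorem mulGroup_add (hθ : Measurable θ) (s t : ℝ) :
    mulGroup θ hθ (s + t) = mulGroup θ hθ s * mulGroup θ hθ t := by
  refine LinearIsometryEquiv.ext fun ψ => Lp.ext ?_
  rw [LinearIsometryEquiv.coe_mul, Function.comp_apply]
  filter_upwards [mulGroup_ae hθ (s + t) ψ, mulGroup_ae hθ s (mulGroup θ hθ t ψ),
    mulGroup_ae hθ t ψ] with x h1 h2 h3
  rw [h1, h2, h3, ← mul_assoc, ← Complex.exp_add]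
  congr 2
  push_cast
  ring

theorem norm_exp_I_sub_le (u : ℝ) : ‖Complex.exp (Complex.I * (u : ℂ)) - 1 - Complex.I * u‖ ≤
    3 * u ^ 2 := by
  have hn : ‖Complex.I * (u : ℂ)‖ = |u| := by simp
  rcases le_total |u| 1 with h | h
  · have := Complex.norm_exp_sub_one_sub_id_le (x := Complex.I * (u : ℂ)) (by rw [hn]; exact h)
    rw [hn, sq_abs] at this
    nlinarith [sq_nonneg u]
  · refine (norm_sub_le _ _).trans ?_
    have h1 : ‖Complex.exp (Complex.I * (u : ℂ)) - 1‖ ≤ 2 := by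
      refine (norm_sub_le _ _).trans ?_
      rw [mul_comm, Complex.norm_exp_ofReal_mul_I, norm_one]
      norm_num
    rw [hn]
    nlinarith [sq_abs u]

theorem hasDerivAt_mulGroup (hθ : Measurable θ) {χ : α → ℂ} (h0 : MemLp χ 2 (volume : Measure α))
    (h1 : MemLp (fun x => (θ x : ℂ) * χ x) 2 (volume : Measure α))
    (h2 : MemLp (fun x => (θ x : ℂ) ^ 2 * χ x) 2 (volume : Measure α)) (t : ℝ) :
    HasDerivAt (fun t => mulGroup θ hθ t (toL2 χ))
      (-Complex.I • mulGroup θ hθ t (toL2 fun x => (θ x : ℂ) * χ x)) t := by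
  rw [← map_smul]
  refine hasDerivAt_group (mulGroup_add hθ) ?_ t
  refine hasDerivAt_iff_isLittleO.2 ?_
  -- The pointwise remainder is at most 3(tθ)²|χ|, which explains why θ²χ is required to be square
  -- integrable.
  have hO : (fun t : ℝ => mulGroup θ hθ t (toL2 χ) - mulGroup θ hθ 0 (toL2 χ) -
      (t - 0) • (-Complex.I • toL2 fun x => (θ x : ℂ) * χ x)) =O[𝓝 0] fun t : ℝ => t ^ 2 := by
    refine Asymptotics.IsBigO.of_bound (3 * ‖toL2 fun x => (θ x : ℂ) ^ 2 * χ x‖)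
      (Eventually.of_forall fun t => ?_)
    rw [group_zero (mulGroup_add hθ), sub_zero, LinearIsometryEquiv.coe_one, id]
    rw [Real.norm_of_nonneg (sq_nonneg t), mul_right_comm]
    refine Lp.norm_le_mul_norm_of_ae_le_mul ?_
    filter_upwards [mulGroup_ae hθ t (toL2 χ), coeFn_toL2 h0, coeFn_toL2 h1, coeFn_toL2 h2,
      Lp.coeFn_sub (mulGroup θ hθ t (toL2 χ) - toL2 χ)
        (t • (-Complex.I • toL2 fun x => (θ x : ℂ) * χ x)),
      Lp.coeFn_sub (mulGroup θ hθ t (toL2 χ)) (toL2 χ),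
      Lp.coeFn_smul t (-Complex.I • toL2 fun x => (θ x : ℂ) * χ x),
      Lp.coeFn_smul (-Complex.I) (toL2 fun x => (θ x : ℂ) * χ x)] with x e1 e2 e3 e4 e5 e6 e7 e8
    rw [e5, Pi.sub_apply, e6, Pi.sub_apply, e7, Pi.smul_apply, e8, Pi.smul_apply, e1, e2, e3, e4]
    have e : Complex.exp (Complex.I * ((-(t * θ x) : ℝ) : ℂ)) * χ x - χ x -
        t • (-Complex.I • ((θ x : ℂ) * χ x)) =
        (Complex.exp (Complex.I * ((-(t * θ x) : ℝ) : ℂ)) - 1 -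
          Complex.I * ((-(t * θ x) : ℝ) : ℂ)) * χ x := by
      rw [Complex.real_smul, smul_eq_mul]
      push_cast
      ring
    rw [e, norm_mul, norm_mul, ← mul_assoc]
    refine mul_le_mul_of_nonneg_right ((norm_exp_I_sub_le _).trans (le_of_eq ?_)) (norm_nonneg _)
    rw [norm_pow, Complex.norm_real, Real.norm_eq_abs, sq_abs]
    ring
  simpa using hO.trans_isLittleO (Asymptotics.isLittleO_pow_id one_lt_two)

end Multiplication

/-! ### The free particle -/

section Free

open SchwartzMap

/-- The kinetic energy `P² / 2M`. -/
noncomputable def kinetic (M : ℝ) (P : E3) : ℝ := ‖P‖ ^ 2 / (2 * M)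

theorem continuous_kinetic (M : ℝ) : Continuous (kinetic M) := by
  unfold kinetic
  fun_prop

/-- The free evolution on `L²(ℝ³)`. -/
noncomputable def freeGroup (M : ℝ) (t : ℝ) : L2 E3 ≃ₗᵢ[ℂ] L2 E3 :=
  (fourierE 3).trans ((mulGroup (kinetic M) (continuous_kinetic M).measurable t).trans
    (fourierInvE 3))

theorem freeGroup_apply (M t : ℝ) (ψ : L2 E3) : freeGroup M t ψ =
    fourierInvE 3 (mulGroup (kinetic M) (continuous_kinetic M).measurable t (fourierE 3 ψ)) := rfl

theorem fourier_laplacian (f : 𝓢(E3, ℂ)) (w : E3) :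
    𝓕 (Laplacian.laplacian (f : E3 → ℂ)) w =
      -((2 * Real.pi) ^ 2 * ‖w‖ ^ 2 : ℝ) * 𝓕 (f : E3 → ℂ) w := by
  have e1 : Laplacian.laplacian (f : E3 → ℂ) = (Laplacian.laplacian f : 𝓢(E3, ℂ)) :=
    funext fun x => (laplacian_apply f x).symm
  rw [e1, ← fourier_coe, laplacian_eq_fourierMultiplierCLM, fourierMultiplierCLM_apply,
    FourierTransform.fourier_smul, FourierTransform.fourier_fourierInv_eq, smul_apply,
    smulLeftCLM_apply_apply (by fun_prop), fourier_coe]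
  simp only [Complex.real_smul]
  push_cast
  ring

/-- The free Hamiltonian is used only weakly: unitarity moves the Fourier transform onto the test
function, where the Laplacian becomes multiplication by -‖P‖². -/
theorem inner_free {M : ℝ} {f : E3 → ℂ} (hf : ContDiff ℝ ∞ f) (hf' : HasCompactSupport f)
    {χ : E3 → ℂ} (h0 : MemLp χ 2 (volume : Measure E3))
    (h1 : MemLp (fun P => (kinetic M P : ℂ) * χ P) 2 (volume : Measure E3)) :
    inner ℂ (toL2 fun X => -((1 / (2 * (M : ℂ))) * Laplacian.laplacian f X))
      (fourierInvE 3 (toL2 χ)) =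
    inner ℂ (toL2 f) (fourierInvE 3 (toL2 fun P => (kinetic M P : ℂ) * χ P)) := by
  let s : 𝓢(E3, ℂ) := hf'.toSchwartzMap hf
  have hs : (s : E3 → ℂ) = f := rfl
  let s' : 𝓢(E3, ℂ) := (-(1 / (2 * (M : ℂ)))) • Laplacian.laplacian s
  have hs' : (s' : E3 → ℂ) = (-(1 / (2 * (M : ℂ)))) • Laplacian.laplacian f := by
    funext X
    change -(1 / (2 * (M : ℂ))) • (Laplacian.laplacian s) X = _
    rw [laplacian_apply]
    rfl
  have hs'' : (fun X => -((1 / (2 * (M : ℂ))) * Laplacian.laplacian f X)) = s' := by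
    rw [hs']
    funext X
    rw [Pi.smul_apply, smul_eq_mul, neg_mul]
  have hinv : ∀ φ ψ : L2 E3, inner ℂ φ (fourierInvE 3 ψ) = inner ℂ (fourierE 3 φ) ψ := by
    intro φ ψ
    conv_rhs => rw [← fourierE_fourierInvE ψ]
    rw [LinearIsometryEquiv.inner_map_map]
  have hm := memLp_dilate_fourier s
  have hm' := memLp_dilate_fourier s'
  rw [hs'', ← hs, hinv, hinv, fourierE_schwartz, fourierE_schwartz, inner_toL2 hm' h0,
    inner_toL2 hm h1]
  congr 1
  funext P
  rw [hs', fourier_const_smul, ← hs, fourier_laplacian]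
  simp only [RCLike.inner_apply, map_mul, map_neg, Complex.conj_ofReal, map_div₀, map_one,
    map_ofNat, kinetic, norm_smul]
  rw [Real.norm_of_nonneg (by positivity)]
  push_cast
  have : (Real.pi : ℂ) ≠ 0 := by exact_mod_cast Real.pi_ne_zero
  -- At M = 0 both sides vanish by the convention for division by zero, so no hypothesis on M is
  -- needed.
  by_cases hM : (M : ℂ) = 0
  · simp [hM]
  · field_simp

end Free

/-! ### Separation of the centre of mass -/

section Separation

open SchwartzMap

variable {N : ℕ} {m : Mass N} {V : Config N → ℝ} {v : Config (N - 1) → ℝ}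

theorem schrodingerFun_jacobi (hm : ∀ k, m k ≠ 0) (hT : ∀ k, k < N → tailMass m k ≠ 0)
    (hN : 1 ≤ N) (hv : ∀ x, V x = v (jacobi m x)) {F : E3 × Config (N - 1) → ℂ}
    (hF : ContDiff ℝ ∞ F) (p : E3 × Config (N - 1)) :
    schrodingerFun m V (fun x => F (jacobiEquiv hm hT hN x)) ((jacobiEquiv hm hT hN).symm p) =
      -((1 / (2 * (tailMass m 0 : ℂ))) * Laplacian.laplacian (fun X => F (X, p.2)) p.1) +
        schrodingerFun (reducedMass m) v (fun y => F (p.1, y)) p.2 := by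
  obtain ⟨x, rfl⟩ := (jacobiEquiv hm hT hN).surjective p
  rw [ContinuousLinearEquiv.symm_apply_apply]
  have h := sum_partialLaplacian_jacobi hm hT hN hF x
  have e : (fun x => F (jacobiEquiv hm hT hN x)) = fun x => F (jacobiMap m x) := rfl
  simp only [schrodingerFun]
  rw [e, h, jacobiEquiv_apply, hv]
  ring

theorem contDiff_slice_left {F : E3 × Config (N - 1) → ℂ} (hF : ContDiff ℝ ∞ F)
    (hF' : HasCompactSupport F) (y : Config (N - 1)) :
    ContDiff ℝ ∞ (fun X => F (X, y)) ∧ HasCompactSupport fun X => F (X, y) := by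
  refine ⟨hF.comp (contDiff_id.prodMk contDiff_const), ?_⟩
  refine HasCompactSupport.intro (hF'.image continuous_fst) fun X hX => ?_
  by_contra h
  exact hX ⟨(X, y), subset_tsupport _ h, rfl⟩

theorem isTest_slice_right {F : E3 × Config (N - 1) → ℂ} (hF : ContDiff ℝ ∞ F)
    (hF' : HasCompactSupport F) (X : E3) : IsTest fun y => F (X, y) := by
  refine ⟨hF.comp (contDiff_const.prodMk contDiff_id), ?_⟩
  refine HasCompactSupport.intro (hF'.image continuous_snd) fun y hy => ?_
  by_contra h
  exact hy ⟨(X, y), subset_tsupport _ h, rfl⟩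

theorem continuous_laplacian_slice {F : E3 × Config (N - 1) → ℂ} (hF : ContDiff ℝ ∞ F)
    (hF' : HasCompactSupport F) :
    Continuous (fun p : E3 × Config (N - 1) =>
      Laplacian.laplacian (fun X => F (X, p.2)) p.1) ∧
    HasCompactSupport (fun p : E3 × Config (N - 1) =>
      Laplacian.laplacian (fun X => F (X, p.2)) p.1) := by
  let b := stdOrthonormalBasis ℝ E3
  let L := ContinuousLinearMap.inl ℝ E3 (Config (N - 1))
  have e : (fun p : E3 × Config (N - 1) => Laplacian.laplacian (fun X => F (X, p.2)) p.1) =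
      fun p => ∑ i, dird (L (b i)) (dird (L (b i)) F) p := by
    funext p
    have := laplacian_comp_affine b hF (0, p.2) L p.1
    simpa [L] using this
  rw [e]
  refine ⟨(ContDiff.sum fun i _ => ContDiff.dird (ContDiff.dird hF _) _).continuous,
    HasCompactSupport.intro hF' fun p hp => ?_⟩
  refine Finset.sum_eq_zero fun i _ => image_eq_zero_of_notMem_tsupport fun h => hp ?_
  exact tsupport_dird_subset _ _ (tsupport_dird_subset _ _ h)

theorem memLp_slice_left {G : E3 × Config (N - 1) → ℂ} (hG : Continuous G)
    (hG' : HasCompactSupport G) (y : Config (N - 1)) :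
    MemLp (fun X => G (X, y)) 2 (volume : Measure E3) := by
  refine (hG.comp (by fun_prop : Continuous fun X : E3 => (X, y))).memLp_of_hasCompactSupport
    (HasCompactSupport.intro (hG'.image continuous_fst) fun X hX => ?_)
  by_contra h
  exact hX ⟨(X, y), subset_tsupport _ h, rfl⟩

theorem inner_scaled_comp {α β : Type*} [MeasureSpace α] [MeasureSpace β] (e : α ≃ᵐ β) {κ : ℝ}
    (hκ : 0 < κ) (he : Measure.map e volume = ENNReal.ofReal (κ ^ 2) • (volume : Measure β))
    {G : β → ℂ} (hG : MemLp G 2 (volume : Measure β)) (w : L2 β) :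
    inner ℂ (toL2 fun x => G (e x)) (scaledCompEquiv e hκ he w) = κ * inner ℂ (toL2 G) w := by
  have hκ' : (κ : ℂ) ≠ 0 := by exact_mod_cast hκ.ne'
  have h : (toL2 fun x => G (e x)) = scaledCompEquiv e hκ he ((κ : ℂ) • toL2 G) := by
    rw [← toL2_const_mul _ hG, scaledCompEquiv_apply]
    refine toL2_congr ?_
    filter_upwards [ae_comp_of_map_eq_smul e he (coeFn_toL2 (hG.const_mul (κ : ℂ)))] with x hx
    rw [hx]
    push_cast
    field_simp
  rw [h, LinearIsometryEquiv.inner_map_map, inner_smul_left, Complex.conj_ofReal]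

theorem inner_internal (h' : IsEssSelfAdjoint (reducedMass m) v) {b b' : L2 (Config (N - 1))}
    (hb : (b, b') ∈ (schrodinger (reducedMass m) v).closure.graph) {f : Config (N - 1) → ℂ}
    (hf : IsTest f) :
    inner ℂ (toL2 (schrodingerFun (reducedMass m) v f)) b = inner ℂ (toL2 f) b' :=
  (mem_graph_iff_inner h'.2 _ _).1 hb _ _ (mem_graph_closure h' hf)

/-- In Jacobi coordinates the Hamiltonian is a sum of a part in X and a part in y. By Fubini each
part is tested slice by slice against the factor of the tensor on which it acts. -/
theorem inner_tens_schrodinger (hm : ∀ k, m k ≠ 0) (hT : ∀ k, k < N → tailMass m k ≠ 0)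
    (hN : 1 ≤ N) (hv : ∀ x, V x = v (jacobi m x)) (h' : IsEssSelfAdjoint (reducedMass m) v)
    {a a' : L2 E3} (ha : ∀ f : E3 → ℂ, ContDiff ℝ ∞ f → HasCompactSupport f →
      inner ℂ (toL2 fun X => -((1 / (2 * (tailMass m 0 : ℂ))) * Laplacian.laplacian f X)) a =
        inner ℂ (toL2 f) a')
    {b b' : L2 (Config (N - 1))} (hb : (b, b') ∈ (schrodinger (reducedMass m) v).closure.graph)
    {F : E3 × Config (N - 1) → ℂ} (hF : ContDiff ℝ ∞ F) (hF' : HasCompactSupport F)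
    (mG : MemLp (fun p => schrodingerFun m V (fun x => F (jacobiEquiv hm hT hN x))
      ((jacobiEquiv hm hT hN).symm p)) 2 (volume : Measure (E3 × Config (N - 1)))) :
    inner ℂ (toL2 fun p => schrodingerFun m V (fun x => F (jacobiEquiv hm hT hN x))
      ((jacobiEquiv hm hT hN).symm p)) (tens E3 (Config (N - 1)) a b) =
    inner ℂ (toL2 F) (tens E3 (Config (N - 1)) a' b + tens E3 (Config (N - 1)) a b') := by
  let G₁ : E3 × Config (N - 1) → ℂ := fun p =>
    -((1 / (2 * (tailMass m 0 : ℂ))) * Laplacian.laplacian (fun X => F (X, p.2)) p.1)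
  let G₂ : E3 × Config (N - 1) → ℂ := fun p =>
    schrodingerFun (reducedMass m) v (fun y => F (p.1, y)) p.2
  have hG : (fun p => schrodingerFun m V (fun x => F (jacobiEquiv hm hT hN x))
      ((jacobiEquiv hm hT hN).symm p)) = fun p => G₁ p + G₂ p :=
    funext fun p => schrodingerFun_jacobi hm hT hN hv hF p
  rw [hG] at mG ⊢
  have mF : MemLp F 2 (volume : Measure (E3 × Config (N - 1))) :=
    hF.continuous.memLp_of_hasCompactSupport hF'
  have hc := continuous_laplacian_slice hF hF'
  have mG₁ : MemLp G₁ 2 (volume : Measure (E3 × Config (N - 1))) :=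
    ((hc.1.memLp_of_hasCompactSupport hc.2).const_mul _).neg
  -- Joint square integrability of the internal part, which contains the potential, follows by
  -- subtracting the kinetic part from the whole.
  have mG₂ : MemLp G₂ 2 (volume : Measure (E3 × Config (N - 1))) := by
    have h := mG.sub mG₁
    have e : ((fun p => G₁ p + G₂ p) - G₁) = G₂ := funext fun p => by simp
    rwa [e] at h
  have sG₁ : ∀ y, MemLp (fun X => G₁ (X, y)) 2 (volume : Measure E3) := fun y =>
    ((memLp_slice_left hc.1 hc.2 y).const_mul _).neg
  have sF := memLp_slice_left hF.continuous hF'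
  have sG₂ : ∀ X, MemLp (fun y => G₂ (X, y)) 2 (volume : Measure (Config (N - 1))) := fun X =>
    h'.1 (fun y => F (X, y)) (isTest_slice_right hF hF' X)
  rw [toL2_add mG₁ mG₂, inner_add_left, inner_add_right]
  congr 1
  · rw [inner_tens_right mG₁ sG₁, inner_tens_right mF sF]
    congr 1
    funext y
    congr 1
    exact ha (fun X => F (X, y)) (contDiff_slice_left hF hF' y).1 (contDiff_slice_left hF hF' y).2
  · rw [inner_tens_left mG₂ sG₂,
      inner_tens_left mF fun X => (isTest_slice_right hF hF' X).memLp]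
    congr 1
    funext X
    congr 1
    exact inner_internal h' hb (f := fun y => F (X, y)) (isTest_slice_right hF hF' X)

/-- Since H is self-adjoint, membership in its graph is tested against the test functions in its
core. Product states thus need no approximation by test functions, and `a` enters through a weak
equation only. -/
theorem tens_mem_graph (hm : ∀ k, m k ≠ 0) (hT : ∀ k, k < N → tailMass m k ≠ 0)
    (hN : 1 ≤ N) (hv : ∀ x, V x = v (jacobi m x)) (h : IsEssSelfAdjoint m V)
    (h' : IsEssSelfAdjoint (reducedMass m) v) {κ : ℝ} (hκ : 0 < κ)
    (he : Measure.map (jacobiEquiv hm hT hN).toHomeomorph.toMeasurableEquiv volume =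
      ENNReal.ofReal (κ ^ 2) • (volume : Measure (E3 × Config (N - 1))))
    {a a' : L2 E3} (ha : ∀ f : E3 → ℂ, ContDiff ℝ ∞ f → HasCompactSupport f →
      inner ℂ (toL2 fun X => -((1 / (2 * (tailMass m 0 : ℂ))) * Laplacian.laplacian f X)) a =
        inner ℂ (toL2 f) a')
    {b b' : L2 (Config (N - 1))} (hb : (b, b') ∈ (schrodinger (reducedMass m) v).closure.graph) :
    (scaledCompEquiv _ hκ he (tens E3 (Config (N - 1)) a b),
      scaledCompEquiv _ hκ he (tens E3 (Config (N - 1)) a' b + tens E3 (Config (N - 1)) a b')) ∈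
      (schrodinger m V).closure.graph := by
  rw [mem_graph_iff_inner h.2]
  intro φ η hφ
  rw [← SetLike.mem_coe, graph_closure_schrodinger h] at hφ
  let J := jacobiEquiv hm hT hN
  let e : Config N ≃ᵐ E3 × Config (N - 1) := J.toHomeomorph.toMeasurableEquiv
  let S : L2 (E3 × Config (N - 1)) ≃ₗᵢ[ℂ] L2 (Config N) := scaledCompEquiv e hκ he
  suffices hS : ∀ w w' : L2 (E3 × Config (N - 1)), (∀ F : E3 × Config (N - 1) → ℂ,
      ContDiff ℝ ∞ F → HasCompactSupport F →
      MemLp (fun p => schrodingerFun m V (fun x => F (J x)) (J.symm p)) 2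
        (volume : Measure (E3 × Config (N - 1))) →
      inner ℂ (toL2 fun p => schrodingerFun m V (fun x => F (J x)) (J.symm p)) w =
        inner ℂ (toL2 F) w') → inner ℂ η (S w) = inner ℂ φ (S w') from
    hS _ _ fun F hF hF' mG => inner_tens_schrodinger hm hT hN hv h' ha hb hF hF' mG
  intro w w' hw
  refine closure_minimal (t := {q : L2 (Config N) × L2 (Config N) |
    inner ℂ q.2 (S w) = inner ℂ q.1 (S w')}) ?_
    (isClosed_eq (by fun_prop) (by fun_prop)) hφ
  rintro ⟨φ, η⟩ ⟨f, hf, h1, h2⟩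
  simp only at h1 h2
  simp only [Set.mem_ofPred_eq]
  let F : E3 × Config (N - 1) → ℂ := fun p => f (J.symm p)
  have hF : ContDiff ℝ ∞ F := hf.1.comp J.symm.contDiff
  have hF' : HasCompactSupport F := hf.2.comp_homeomorph J.symm.toHomeomorph
  have hfF : (fun x => F (J x)) = f := funext fun x => congrArg f (J.symm_apply_apply x)
  let G : E3 × Config (N - 1) → ℂ := fun p => schrodingerFun m V f (J.symm p)
  have hGL : (fun x => G (e x)) = schrodingerFun m V f :=
    funext fun x => congrArg (schrodingerFun m V f) (J.symm_apply_apply x)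
  have mG : MemLp G 2 (volume : Measure (E3 × Config (N - 1))) := by
    rw [← memLp_comp_iff_of_map_eq_smul e hκ he, hGL]
    exact h.1 f hf
  have mF : MemLp F 2 (volume : Measure (E3 × Config (N - 1))) :=
    hF.continuous.memLp_of_hasCompactSupport hF'
  have eφ : φ = toL2 fun x => F (e x) := by
    rw [← toL2_coe φ, toL2_congr h1]
    exact congrArg toL2 hfF.symm
  have eη : η = toL2 fun x => G (e x) := by
    rw [← toL2_coe η, toL2_congr h2, hGL]
  have h3 := hw F hF hF' (by rw [hfF]; exact mG)
  rw [hfF] at h3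
  have h4 := inner_scaled_comp e hκ he mG w
  have h5 := inner_scaled_comp e hκ he mF w'
  rw [← eη] at h4
  rw [← eφ] at h5
  exact h4.trans ((congrArg ((κ : ℂ) * ·) h3).trans h5.symm)

theorem memLp_kinetic_mul (M : ℝ) (χ : 𝓢(E3, ℂ)) :
    ∃ χ' : 𝓢(E3, ℂ), (χ' : E3 → ℂ) = fun P => (kinetic M P : ℂ) * χ P := by
  have h : (kinetic M).HasTemperateGrowth := by
    have e : kinetic M = fun P : E3 => (2 * M)⁻¹ * ‖P‖ ^ 2 := by
      funext P
      rw [kinetic, div_eq_inv_mul]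
    rw [e]
    fun_prop
  refine ⟨smulLeftCLM ℂ (kinetic M) χ, funext fun P => ?_⟩
  rw [smulLeftCLM_apply_apply h, Complex.real_smul]

theorem hasDerivAt_bilinear {E₁ E₂ E₃ E₄ : Type*} [NormedAddCommGroup E₁] [NormedAddCommGroup E₂]
    [NormedAddCommGroup E₃] [NormedAddCommGroup E₄] [InnerProductSpace ℂ E₁]
    [InnerProductSpace ℂ E₂] [InnerProductSpace ℂ E₃] [InnerProductSpace ℂ E₄]
    (B : E₁ →L[ℂ] E₂ →L[ℂ] E₃) (S : E₃ ≃ₗᵢ[ℂ] E₄) {A : ℝ → E₁} {C : ℝ → E₂} {a : E₁} {c : E₂}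
    {t : ℝ} (hA : HasDerivAt A (-Complex.I • a) t) (hC : HasDerivAt C (-Complex.I • c) t) :
    HasDerivAt (fun t => S (B (A t) (C t))) (-Complex.I • S (B a (C t) + B (A t) c)) t := by
  have h2 := (B.bilinearRestrictScalars ℝ).hasDerivAt_of_bilinear (fun _ => hA) (fun _ => hC)
  have h3 := (S.toContinuousLinearEquiv.toContinuousLinearMap.restrictScalars
    ℝ).hasFDerivAt.comp_hasDerivAt t h2
  rw [← map_smul]
  refine h3.congr_deriv (congrArg S ?_)
  change B (A t) (-Complex.I • _) + B (-Complex.I • a) _ = _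
  rw [map_smul, map_smul, smul_apply, smul_add, add_comm]

theorem evolution_tens (hm : ∀ k, m k ≠ 0) (hT : ∀ k, k < N → tailMass m k ≠ 0)
    (hN : 1 ≤ N) (hv : ∀ x, V x = v (jacobi m x)) (h : IsEssSelfAdjoint m V)
    (h' : IsEssSelfAdjoint (reducedMass m) v) {κ : ℝ} (hκ : 0 < κ)
    (he : Measure.map (jacobiEquiv hm hT hN).toHomeomorph.toMeasurableEquiv volume =
      ENNReal.ofReal (κ ^ 2) • (volume : Measure (E3 × Config (N - 1)))) (t : ℝ)
    (a : L2 E3) (b : L2 (Config (N - 1))) :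
    evolution m V t (scaledCompEquiv _ hκ he (tens E3 (Config (N - 1)) a b)) =
      scaledCompEquiv _ hκ he (tens E3 (Config (N - 1)) (freeGroup (tailMass m 0) t a)
        (evolution (reducedMass m) v t b)) := by
  let S : L2 (E3 × Config (N - 1)) ≃ₗᵢ[ℂ] L2 (Config N) :=
    scaledCompEquiv (jacobiEquiv hm hT hN).toHomeomorph.toMeasurableEquiv hκ he
  change evolution m V t (S (tens E3 (Config (N - 1)) a b)) = S (tens E3 (Config (N - 1))
    (freeGroup (tailMass m 0) t a) (evolution (reducedMass m) v t b))
  have hS : ∀ (a a' : L2 E3) (b b' : L2 (Config (N - 1))), (∀ f : E3 → ℂ, ContDiff ℝ ∞ f →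
      HasCompactSupport f →
      inner ℂ (toL2 fun X => -((1 / (2 * (tailMass m 0 : ℂ))) * Laplacian.laplacian f X)) a =
        inner ℂ (toL2 f) a') → (b, b') ∈ (schrodinger (reducedMass m) v).closure.graph →
      (S (tens E3 (Config (N - 1)) a b),
        S (tens E3 (Config (N - 1)) a' b + tens E3 (Config (N - 1)) a b')) ∈
      (schrodinger m V).closure.graph := fun a a' b b' ha hb =>
    tens_mem_graph hm hT hN hv h h' hκ he ha hb
  clear_value S
  set M := tailMass m 0
  let K := mulGroup (kinetic M) (continuous_kinetic M).measurable
  have hu := isUnitaryGroupOf_evolution h'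
  -- For a Schwartz momentum profile and b in the internal domain, the product of the two evolutions
  -- is differentiable and stays in the graph of H, so it is the evolution of the product.
  have key : ∀ (χ : 𝓢(E3, ℂ)) (b b' : L2 (Config (N - 1))),
      (b, b') ∈ (schrodinger (reducedMass m) v).closure.graph →
      evolution m V t (S (tens E3 (Config (N - 1)) (fourierInvE 3 (toL2 χ)) b)) =
      S (tens E3 (Config (N - 1)) (freeGroup M t (fourierInvE 3 (toL2 χ)))
        (evolution (reducedMass m) v t b)) := by
    intro χ b b' hb
    -- Schwartz functions absorb two factors of kinetic energy, as differentiating the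
    -- multiplication group requires.
    obtain ⟨χ₁, hχ₁⟩ := memLp_kinetic_mul M χ
    obtain ⟨χ₂, hχ₂⟩ := memLp_kinetic_mul M χ₁
    have m0 := χ.memLp 2 (volume : Measure E3)
    have m1 := χ₁.memLp 2 (volume : Measure E3)
    have m2 := χ₂.memLp 2 (volume : Measure E3)
    rw [hχ₂, hχ₁] at m2
    rw [hχ₁] at m1
    simp only [← mul_assoc, ← sq] at m2
    let A : ℝ → L2 E3 := fun t => fourierInvE 3 (K t (toL2 χ))
    let A' : ℝ → L2 E3 := fun t =>
      fourierInvE 3 (K t (toL2 fun P => (kinetic M P : ℂ) * χ P))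
    have hA : ∀ t, HasDerivAt A (-Complex.I • A' t) t := by
      intro t
      have h1 := hasDerivAt_mulGroup (continuous_kinetic M).measurable m0 m1 m2 t
      have h2 := ((fourierInvE 3).toContinuousLinearEquiv.toContinuousLinearMap.restrictScalars
        ℝ).hasFDerivAt.comp_hasDerivAt t h1
      have e : -Complex.I • A' t = fourierInvE 3
        (-Complex.I • K t (toL2 fun P => (kinetic M P : ℂ) * χ P)) := (map_smul _ _ _).symm
      rw [e]
      exact h2
    have hA' : ∀ t, ∀ f : E3 → ℂ, ContDiff ℝ ∞ f → HasCompactSupport f →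
        inner ℂ (toL2 fun X => -((1 / (2 * (M : ℂ))) * Laplacian.laplacian f X)) (A t) =
          inner ℂ (toL2 f) (A' t) := by
      intro t f hf hf'
      let θ : E3 → ℝ := fun P => -(t * kinetic M P)
      have hθ : Measurable θ := by
        have := (continuous_kinetic M).measurable
        fun_prop
      have e0 : K t (toL2 χ) = toL2 fun P => Complex.exp (Complex.I * (θ P : ℂ)) * χ P :=
        phaseMul_toL2 θ hθ m0
      have e1 : K t (toL2 fun P => (kinetic M P : ℂ) * χ P) = toL2 fun P =>
          (kinetic M P : ℂ) * (Complex.exp (Complex.I * (θ P : ℂ)) * χ P) := by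
        refine (phaseMul_toL2 θ hθ m1).trans ?_
        congr 1
        funext P
        ring
      have m1' : MemLp (fun P => (kinetic M P : ℂ) *
          (Complex.exp (Complex.I * (θ P : ℂ)) * χ P)) 2 (volume : Measure E3) := by
        have := memLp_phase_mul hθ m1
        simp only [mul_left_comm _ (kinetic M _ : ℂ)] at this
        exact this
      simp only [A, A', e0, e1]
      exact inner_free hf hf' (memLp_phase_mul hθ m0) m1'
    have hB : ∀ t, HasDerivAt (fun t => evolution (reducedMass m) v t b)
        (-Complex.I • evolution (reducedMass m) v t b') t := by
      intro t
      rw [← map_smul]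
      exact hasDerivAt_group hu.1 ((hu.2.2 _ _).1 hb) t
    have h1 := (isUnitaryGroupOf_evolution h).eq_of_hasDerivAt h.2
      (Φ := fun t => S (tens E3 (Config (N - 1)) (A t) (evolution (reducedMass m) v t b)))
      (η := fun t => S (tens E3 (Config (N - 1)) (A' t) (evolution (reducedMass m) v t b) +
        tens E3 (Config (N - 1)) (A t) (evolution (reducedMass m) v t b')))
      (fun t => by
        exact hasDerivAt_bilinear (tens E3 (Config (N - 1))) S (hA t) (hB t))
      (fun t => hS _ _ _ _ (hA' t) (hu.graph_map hb t)) t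
    have hA0 : A 0 = fourierInvE 3 (toL2 χ) := by
      simp only [A, K, group_zero (mulGroup_add _), LinearIsometryEquiv.coe_one, id]
    have hAt : freeGroup M t (fourierInvE 3 (toL2 χ)) = A t := by
      rw [freeGroup_apply, fourierE_fourierInvE]
    simp only [hA0, group_zero hu.1, LinearIsometryEquiv.coe_one, id] at h1
    rw [hAt]
    exact h1.symm
  -- Density is used one factor at a time: first the internal domain for b, then Schwartz profiles
  -- for a.
  have key2 : ∀ (χ : 𝓢(E3, ℂ)), (fun b =>
      evolution m V t (S (tens E3 (Config (N - 1)) (fourierInvE 3 (toL2 χ)) b))) = fun b =>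
      S (tens E3 (Config (N - 1)) (freeGroup M t (fourierInvE 3 (toL2 χ)))
        (evolution (reducedMass m) v t b)) := by
    intro χ
    refine Continuous.ext_on (dense_graph_fst h'.2) ?_ ?_ ?_
    · fun_prop
    · fun_prop
    · rintro b ⟨b', hb⟩
      exact key χ b b' hb
  have key3 : (fun χ => evolution m V t (S (tens E3 (Config (N - 1)) (fourierInvE 3 χ) b))) =
      fun χ => S (tens E3 (Config (N - 1)) (freeGroup M t (fourierInvE 3 χ))
        (evolution (reducedMass m) v t b)) := by
    refine Continuous.ext_on dense_schwartz ?_ ?_ ?_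
    · fun_prop
    · fun_prop
    · rintro _ ⟨χ, rfl⟩
      exact congrFun (key2 χ) b
  have := congrFun key3 (fourierE 3 a)
  simpa only [fourierInvE_fourierE] using this

end Separation

/-! ### Fibre operators in centre-of-mass and Jacobi coordinates -/

section Separated

variable {N : ℕ} {m : Mass N} {V : Config N → ℝ} {v : Config (N - 1) → ℝ}

theorem fourierE_modOp {d : ℕ} (α : EuclideanSpace ℝ (Fin d)) (ψ : L2 (EuclideanSpace ℝ (Fin d))) :
    fourierE d (modOp α ψ) = shiftOp (-α) (fourierE d ψ) := by
  apply (fourierInvE d).injective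
  rw [fourierInvE_shiftOp, fourierInvE_fourierE, fourierInvE_fourierE, neg_neg]

/-- In position space this is the one-particle fibre operator: rigid motion, free evolution for time
-c, then the boost phase. The Fourier transform exchanges translations with characters and commutes
with rotations. -/
theorem centreOp_eq (γ : Galilei → ℝ) (M : ℝ) (g : Galilei) (a : L2 E3) : centreOp γ M g a =
    Complex.exp (Complex.I * ((M * γ g : ℝ) : ℂ)) • modOp (M • g.boost) (freeGroup M (-g.time)
      (shiftOp (g.time • g.boost - g.shift) (orthOp (rotE g.R⁻¹) a))) := by
  let s := g.time • g.boost - g.shift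
  let F := fourierE 3 a
  let hk := (continuous_kinetic M).measurable
  unfold centreOp
  rw [← fourierInvE_apply]
  apply (fourierE 3).injective
  rw [fourierE_fourierInvE, map_smul, fourierE_modOp, freeGroup_apply, fourierE_fourierInvE,
    fourierE_shiftOp, fourierE_orthOp, ← fourierE_apply]
  refine toL2_eq_of_ae ?_
  have hq := (measurePreserving_add_right (volume : Measure E3)
    (-(M • g.boost))).quasiMeasurePreserving
  filter_upwards [Lp.coeFn_smul (Complex.exp (Complex.I * ((M * γ g : ℝ) : ℂ)))
      (shiftOp (-(M • g.boost)) (mulGroup (kinetic M) hk (-g.time)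
        (modOp s (orthOp (rotE g.R⁻¹) F)))),
    shiftOp_ae (-(M • g.boost)) (mulGroup (kinetic M) hk (-g.time)
        (modOp s (orthOp (rotE g.R⁻¹) F))),
    hq.ae (mulGroup_ae hk (-g.time) (modOp s (orthOp (rotE g.R⁻¹) F))),
    hq.ae (modOp_ae s (orthOp (rotE g.R⁻¹) F)), hq.ae (orthOp_ae (rotE g.R⁻¹) F)]
    with P h1 h2 h3 h4 h5
  refine Eq.symm (h1.trans ?_)
  rw [Pi.smul_apply, h2, h3, h4, h5, smul_eq_mul, ← sub_eq_add_neg, rotE_apply,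
    ← mul_assoc, ← mul_assoc, ← Complex.exp_add, ← Complex.exp_add, ← Complex.exp_add]
  congr 2
  rw [real_inner_comm, kinetic]
  push_cast
  ring

theorem exists_map_jacobiEquiv (hm : ∀ k, m k ≠ 0) (hT : ∀ k, k < N → tailMass m k ≠ 0)
    (hN : 1 ≤ N) : ∃ κ : ℝ, 0 < κ ∧
      Measure.map (jacobiEquiv hm hT hN).toHomeomorph.toMeasurableEquiv volume =
        ENNReal.ofReal (κ ^ 2) • (volume : Measure (E3 × Config (N - 1))) := by
  have h1 : (volume : Measure (Config N)).IsAddHaarMeasure :=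
    inferInstanceAs (Measure.pi fun _ => (volume : Measure E3)).IsAddHaarMeasure
  have h2 : (volume : Measure (Config (N - 1))).IsAddHaarMeasure :=
    inferInstanceAs (Measure.pi fun _ => (volume : Measure E3)).IsAddHaarMeasure
  have h3 : (volume : Measure (E3 × Config (N - 1))).IsAddHaarMeasure :=
    inferInstanceAs ((volume : Measure E3).prod
      (volume : Measure (Config (N - 1)))).IsAddHaarMeasure
  exact exists_map_volume_eq_smul _

theorem ae_jacobi (hm : ∀ k, m k ≠ 0) (hT : ∀ k, k < N → tailMass m k ≠ 0)
    (hN : 1 ≤ N) {p : E3 × Config (N - 1) → Prop} (h : ∀ᵐ q, p q) :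
    ∀ᵐ x, p (tailCentre m 0 x, jacobi m x) := by
  obtain ⟨κ, -, he⟩ := exists_map_jacobiEquiv hm hT hN
  filter_upwards [ae_comp_of_map_eq_smul _ he h] with x hx
  rw [← jacobiEquiv_apply hm hT hN]
  exact hx

theorem memLp_jacobi (hm : ∀ k, m k ≠ 0) (hT : ∀ k, k < N → tailMass m k ≠ 0)
    (hN : 1 ≤ N) (a : L2 E3) (b : L2 (Config (N - 1))) :
    MemLp (fun x => a (tailCentre m 0 x) * b (jacobi m x)) 2 (volume : Measure (Config N)) := by
  obtain ⟨κ, hκ, he⟩ := exists_map_jacobiEquiv hm hT hN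
  have := (memLp_comp_iff_of_map_eq_smul _ hκ he).2 (memLp_tensor a b)
  refine (memLp_congr_ae (.of_forall fun x => ?_)).1 this
  have e := jacobiEquiv_apply hm hT hN x
  have e' : (jacobiEquiv hm hT hN).toHomeomorph.toMeasurableEquiv x =
    (tailCentre m 0 x, jacobi m x) := e
  simp only [e']

/-- The unnormalised product is κ times the unitary image of the tensor; linearity disposes of κ. -/
theorem evolution_jacobi (hm : ∀ k, m k ≠ 0) (hT : ∀ k, k < N → tailMass m k ≠ 0)
    (hN : 1 ≤ N) (hv : ∀ x, V x = v (jacobi m x)) (h : IsEssSelfAdjoint m V)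
    (h' : IsEssSelfAdjoint (reducedMass m) v) (t : ℝ) (a : L2 E3) (b : L2 (Config (N - 1))) :
    evolution m V t (toL2 fun x => a (tailCentre m 0 x) * b (jacobi m x)) =
      toL2 fun x => freeGroup (tailMass m 0) t a (tailCentre m 0 x) *
        evolution (reducedMass m) v t b (jacobi m x) := by
  obtain ⟨κ, hκ, he⟩ := exists_map_jacobiEquiv hm hT hN
  have hκ' : (κ : ℂ) ≠ 0 := by exact_mod_cast hκ.ne'
  have e : ∀ (a : L2 E3) (b : L2 (Config (N - 1))),
      (toL2 fun x => a (tailCentre m 0 x) * b (jacobi m x)) =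
        (κ : ℂ) • scaledCompEquiv _ hκ he (tens E3 (Config (N - 1)) a b) := by
    intro a b
    refine toL2_eq_of_ae ?_
    filter_upwards [Lp.coeFn_smul (κ : ℂ) (scaledCompEquiv _ hκ he (tens E3 (Config (N - 1)) a b)),
      scaledCompEquiv_ae _ hκ he (tens E3 (Config (N - 1)) a b),
      ae_comp_of_map_eq_smul _ he (tens_ae a b)] with x h1 h2 h3
    have e' : (jacobiEquiv hm hT hN).toHomeomorph.toMeasurableEquiv x =
      (tailCentre m 0 x, jacobi m x) := jacobiEquiv_apply hm hT hN x
    rw [h1, Pi.smul_apply, h2, h3, e', smul_eq_mul]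
    push_cast
    field_simp
  rw [e, e, map_smul, evolution_tens hm hT hN hv h h']

theorem tailCentre_rigid (R : SO3) (s : E3) (x : Config N) {k : ℕ}
    (hk : tailMass m k ≠ 0) :
    tailCentre m k (fun j => rot R (x j) + s) = rot R (tailCentre m k x) + s := by
  have e1 : ∀ j : Fin N, (if k ≤ (j : ℕ) then m j • (rot R (x j) + s) else 0) =
      rot R (if k ≤ (j : ℕ) then m j • x j else 0) + (if k ≤ (j : ℕ) then m j else 0) • s := by
    intro j
    split_ifs
    · rw [smul_add, rot_smul]
    · rw [rot_zero, zero_smul, add_zero]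
  have e2 : ∀ f : Fin N → E3, ∑ j, rot R (f j) = rot R (∑ j, f j) := fun f =>
    (map_sum (rotE R) f Finset.univ).symm
  simp only [tailCentre]
  rw [Finset.sum_congr rfl fun j _ => e1 j, Finset.sum_add_distrib, e2, ← Finset.sum_smul,
    smul_add, rot_smul]
  change _ + (tailMass m k)⁻¹ • tailMass m k • s = _
  rw [inv_smul_smul₀ hk]

theorem jacobi_rigid (hT : ∀ k, k < N → tailMass m k ≠ 0) (R : SO3) (s : E3)
    (x : Config N) :
    jacobi m (fun j => rot R (x j) + s) = fun k => rot R (jacobi m x k) := by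
  funext k
  simp only [jacobi, tailCentre_rigid R s x (hT (k + 1) (by omega)), rot_sub]
  abel

/-- The rigid motion moves the centre of mass rigidly but only rotates the relative coordinates, the
evolution factorises, and the boost phase ∑ m_j 𝐯·x_j = M 𝐯·X involves the centre alone. -/
theorem fibreOp_jacobi (hm : ∀ k, m k ≠ 0) (hT : ∀ k, k < N → tailMass m k ≠ 0)
    (hN : 1 ≤ N) (hv : ∀ x, V x = v (jacobi m x)) (h : IsEssSelfAdjoint m V)
    (h' : IsEssSelfAdjoint (reducedMass m) v) (γ : Galilei → ℝ) (g : Galilei)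
    (a : L2 E3) (b : L2 (Config (N - 1))) :
    fibreOp V γ m 0 g (toL2 fun x => a (tailCentre m 0 x) * b (jacobi m x)) =
      toL2 fun x => centreOp γ (∑ j, m j) g a (tailCentre m 0 x) *
        internalOp m v g.time g.R b (jacobi m x) := by
  have hM := hT 0 hN
  let s := g.time • g.boost - g.shift
  let a₁ := shiftOp s (orthOp (rotE g.R⁻¹) a)
  let b₁ := moveOp (N - 1) g.R⁻¹ 0 b
  have hb₁ : (toL2 fun y : Config (N - 1) => b fun k => rot g.R⁻¹ (y k)) = b₁ := by
    refine toL2_eq_of_ae ?_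
    filter_upwards [moveOp_ae g.R⁻¹ 0 b] with y hy
    rw [hy]
    simp only [add_zero]
  have e1 : (toL2 fun y : Config N => (toL2 fun x => a (tailCentre m 0 x) * b (jacobi m x))
      fun k => rot g.R⁻¹ (y k + g.time • g.boost - g.shift)) =
      toL2 fun x => a₁ (tailCentre m 0 x) * b₁ (jacobi m x) := by
    refine toL2_congr ?_
    have ha : ∀ᵐ X, a₁ X = a (rot g.R⁻¹ (X + s)) := by
      filter_upwards [shiftOp_ae s (orthOp (rotE g.R⁻¹) a),
        (measurePreserving_add_right (volume : Measure E3) s).quasiMeasurePreserving.ae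
          (orthOp_ae (rotE g.R⁻¹) a)] with X h1 h2
      rw [h1, h2]
      rfl
    filter_upwards [ae_rigid g.R⁻¹ (rot g.R⁻¹ s) (coeFn_toL2 (memLp_jacobi hm hT hN a b)),
      ae_jacobi hm hT hN (ae_fst ha), ae_jacobi hm hT hN (ae_snd (moveOp_ae g.R⁻¹ 0 b))]
      with x h1 h2 h3
    have e : (fun k => rot g.R⁻¹ (x k + g.time • g.boost - g.shift)) =
        fun k => rot g.R⁻¹ (x k) + rot g.R⁻¹ s := by
      funext k
      rw [← rot_add, add_sub_assoc]
    rw [e, h1, tailCentre_rigid _ _ _ hM, jacobi_rigid hT, ← rot_add, ← h2]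
    refine congrArg (_ * ·) (Eq.trans ?_ h3.symm)
    simp only [add_zero]
  unfold fibreOp internalOp
  rw [e1, hb₁, evolution_jacobi hm hT hN hv h h', ← tailMass_zero, centreOp_eq]
  refine toL2_congr ?_
  let c := freeGroup (tailMass m 0) (-g.time) a₁
  filter_upwards [coeFn_toL2 (memLp_jacobi hm hT hN c (evolution (reducedMass m) v (-g.time) b₁)),
    ae_jacobi hm hT hN (ae_fst (Lp.coeFn_smul (Complex.exp (Complex.I *
      ((tailMass m 0 * γ g : ℝ) : ℂ))) (modOp (tailMass m 0 • g.boost) c))),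
    ae_jacobi hm hT hN (ae_fst (modOp_ae (tailMass m 0 • g.boost) c))] with x h1 h2 h3
  rw [h1]
  refine Eq.trans ?_ (congrArg (· * _) h2).symm
  rw [Pi.smul_apply, h3, smul_eq_mul, ← mul_assoc, ← mul_assoc, ← Complex.exp_add]
  refine congrArg (fun z => Complex.exp z * _ * _) ?_
  rw [← mul_add, ← Complex.ofReal_add]
  congr 2
  have e2 : tailMass m 0 • tailCentre m 0 x = ∑ j, m j • x j := by
    simp only [tailCentre, Nat.zero_le, if_true]
    rw [smul_inv_smul₀ hM]
  rw [inner_smul_right, ← real_inner_smul_left, e2, sum_inner, tailMass_zero, Finset.sum_mul,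
    ← Finset.sum_add_distrib]
  refine Finset.sum_congr rfl fun j _ => ?_
  rw [real_inner_smul_left, real_inner_comm]
  ring

end Separated

/-! ### The extended Hilbert space -/

section Extended

open Filter

variable {N : ℕ}

theorem isInvariant_of {V : Config N → ℝ} (ht : ∀ (a : E3) (x : Config N), V (fun k => x k + a) = V x)
    (hr : ∀ (R : SO3) (x : Config N), V (fun k => rot R (x k)) = V x) : IsInvariant V :=
  fun R a x => (ht a fun k => rot R (x k)).trans (hr R x)

/-- Coordinate hyperplanes are null, so the fibrewise composition law holds at almost all masses. -/
theorem ae_mass_ne_zero : ∀ᵐ m : Mass N, ∀ k, m k ≠ 0 := by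
  refine ae_all_iff.2 fun k => ?_
  let L : Mass N →ₗ[ℝ] ℝ := (EuclideanSpace.proj k : Mass N →L[ℝ] ℝ).toLinearMap
  have h : (volume : Measure (Mass N)) (LinearMap.ker L : Set (Mass N)) = 0 := by
    refine Measure.addHaar_submodule _ _ fun h => ?_
    have h1 : EuclideanSpace.single k (1 : ℝ) ∈ LinearMap.ker L := h ▸ Submodule.mem_top
    have h2 : L (EuclideanSpace.single k (1 : ℝ)) = 1 := by simp [L]
    rw [LinearMap.mem_ker, h2] at h1
    exact one_ne_zero h1
  exact measure_mono_null (fun m hm => not_not.1 hm) h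

variable (γ : Galilei → ℝ)

theorem measurable_galPhase_uncurry (r : ℝ) (g : Galilei) (t : ℝ) :
    Measurable fun q : Mass N × Config N => galPhase γ q.1 r g t q.2 := by
  unfold galPhase phase
  fun_prop

/-- The operators `galOp` on the extended space. -/
noncomputable def galExt (N : ℕ) (r : ℝ) (g : Galilei) (t : ℝ) :
    ExtendedSpace N ≃ₗᵢ[ℂ] ExtendedSpace N :=
  phaseMul (fun q : Mass N × Config N => galPhase γ q.1 r g t q.2)
      (measurable_galPhase_uncurry γ r g t) *
    compEquiv ((MeasurableEquiv.refl (Mass N)).prodCongr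
      (rigid N g.R⁻¹ (invShift g t)).toMeasurableEquiv)
      ((MeasurePreserving.id _).prod (measurePreserving_rigid g.R⁻¹ (invShift g t)))

theorem galExt_ae (r : ℝ) (g : Galilei) (t : ℝ) (Ψ : ExtendedSpace N) :
    galExt γ N r g t Ψ =ᵐ[volume] fun q =>
      Complex.exp (Complex.I * (galPhase γ q.1 r g t q.2 : ℂ)) *
        Ψ (q.1, fun k => (g⁻¹.act (t, q.2 k)).2) := by
  let C := compEquiv ((MeasurableEquiv.refl (Mass N)).prodCongr
      (rigid N g.R⁻¹ (invShift g t)).toMeasurableEquiv)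
      ((MeasurePreserving.id _).prod (measurePreserving_rigid g.R⁻¹ (invShift g t))) Ψ
  have e : galExt γ N r g t Ψ = phaseMul (fun q : Mass N × Config N => galPhase γ q.1 r g t q.2)
      (measurable_galPhase_uncurry γ r g t) C := rfl
  filter_upwards [phaseMul_ae (fun q : Mass N × Config N => galPhase γ q.1 r g t q.2)
      (measurable_galPhase_uncurry γ r g t) C, compEquiv_ae
      ((MeasurableEquiv.refl (Mass N)).prodCongr
      (rigid N g.R⁻¹ (invShift g t)).toMeasurableEquiv)
      ((MeasurePreserving.id _).prod (measurePreserving_rigid g.R⁻¹ (invShift g t))) Ψ]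
    with q h1 h2
  rw [e, h1, h2]
  simp only [act_inv_snd]
  rfl

theorem fibre_galExt (r : ℝ) (g : Galilei) (t : ℝ) (Ψ : ExtendedSpace N) :
    ∀ᵐ m : Mass N, fibre (galExt γ N r g t Ψ) m = galOp γ m r g t (fibre Ψ m) := by
  filter_upwards [slice_congr (galExt_ae γ r g t Ψ), coeFn_slice Ψ] with m h1 h2
  refine h1.trans (toL2_eq_of_ae ?_)
  filter_upwards [galOp_ae γ m r g t (fibre Ψ m), ae_rigid g.R⁻¹ (invShift g t) h2] with x h3 h4
  rw [h3]
  simp only [act_inv_snd]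
  exact congrArg (_ * ·) h4.symm

theorem ext_fibre {Ψ Φ : ExtendedSpace N} (h : ∀ᵐ m, fibre Ψ m = fibre Φ m) : Ψ = Φ := ext_slice h

variable {V : Mass N → Config N → ℝ} {T : ℝ → (ExtendedSpace N ≃ₗᵢ[ℂ] ExtendedSpace N)}

theorem isDirectIntegral_galExt (hV : ∀ m, IsInvariant (V m))
    (hH : ∀ᵐ m : Mass N, IsEssSelfAdjoint m (V m))
    (hT : ∀ t, IsDirectIntegral (fun m => evolution m (V m) t) (T t)) (r : ℝ) (g : Galilei) :
    IsDirectIntegral (fun m => fibreOp (V m) γ m r g) (galExt γ N r g 0 * T (-g.time)) := by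
  intro Ψ
  filter_upwards [hH, hT (-g.time) Ψ, fibre_galExt γ r g 0 (T (-g.time) Ψ)] with m h h1 h2
  rw [LinearIsometryEquiv.coe_mul, Function.comp_apply, h2, h1, fibreOp_eq γ h (hV m)]

/-- The representation of the central extension on the extended Hilbert space. -/
theorem exists_representation (hV : ∀ m, IsInvariant (V m))
    (hH : ∀ᵐ m : Mass N, IsEssSelfAdjoint m (V m))
    (hT : ∀ t, IsDirectIntegral (fun m => evolution m (V m) t) (T t)) :
    ∃ U : Ext γ →* (ExtendedSpace N ≃ₗᵢ[ℂ] ExtendedSpace N),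
      ∀ ρ : Ext γ, IsDirectIntegral (fun m => fibreOp (V m) γ m ρ.r ρ.g) (U ρ) := by
  have hU := isDirectIntegral_galExt γ hV hH hT
  refine ⟨MonoidHom.mk' (fun ρ => galExt γ N ρ.r ρ.g 0 * T (-ρ.g.time)) fun ρ' ρ => ?_,
    fun ρ => hU ρ.r ρ.g⟩
  refine LinearIsometryEquiv.ext fun Ψ => ext_fibre ?_
  filter_upwards [hH, ae_mass_ne_zero, hU ρ.r ρ.g Ψ, hU (ρ' * ρ).r (ρ' * ρ).g Ψ,
    hU ρ'.r ρ'.g ((galExt γ N ρ.r ρ.g 0 * T (-ρ.g.time)) Ψ)] with m h hm h1 h2 h3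
  rw [h2]
  refine Eq.trans ?_ h3.symm
  rw [h1, fibreOp_fibreOp γ h (hV m) hm]
  rfl

theorem evolution_representation (hV : ∀ m, IsInvariant (V m))
    (hH : ∀ᵐ m : Mass N, IsEssSelfAdjoint m (V m))
    (hT : ∀ t, IsDirectIntegral (fun m => evolution m (V m) t) (T t)) {r : ℝ} {g : Galilei}
    {A : ExtendedSpace N → ExtendedSpace N}
    (hA : IsDirectIntegral (fun m => fibreOp (V m) γ m r g) A) (t : ℝ) (Ψ : ExtendedSpace N) :
    T t (A Ψ) = galExt γ N r g t (T (t - g.time) Ψ) := by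
  refine ext_fibre ?_
  filter_upwards [hH, ae_mass_ne_zero, hT t (A Ψ), hA Ψ, hT (t - g.time) Ψ,
    fibre_galExt γ r g t (T (t - g.time) Ψ)] with m h hm h1 h2 h3 h4
  rw [h1, h2, h4, h3, evolution_fibreOp γ h (hV m) hm]

/-! ### The `ζ`-picture -/

/-- The exchange of the two variables. -/
noncomputable def swapOp (α β : Type*) [MeasureSpace α] [MeasureSpace β]
    [SFinite (volume : Measure α)] [SFinite (volume : Measure β)] :
    L2 (α × β) ≃ₗᵢ[ℂ] L2 (β × α) :=
  compEquiv (α := β × α) (β := α × β) (MeasurableEquiv.prodComm (α := β) (β := α))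
    (Measure.measurePreserving_swap (μ := (volume : Measure β)) (ν := (volume : Measure α)))

theorem swapOp_ae {α β : Type*} [MeasureSpace α] [MeasureSpace β]
    [SFinite (volume : Measure α)] [SFinite (volume : Measure β)] (Ψ : L2 (α × β)) :
    swapOp α β Ψ =ᵐ[volume] fun q => Ψ q.swap := by
  unfold swapOp
  exact compEquiv_ae _ _ Ψ

theorem slice_swapOp {α β : Type*} [MeasureSpace α] [MeasureSpace β]
    [SFinite (volume : Measure α)] [SFinite (volume : Measure β)] (Ψ : L2 (α × β)) :
    ∀ᵐ b, slice (swapOp α β Ψ) b = toL2 fun a => Ψ (a, b) :=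
  slice_congr (swapOp_ae Ψ)

theorem exists_zetaPicture (N : ℕ) :
    ∃ Z : ExtendedSpace N ≃ₗᵢ[ℂ] ExtendedSpace N, IsZetaPicture Z := by
  -- With positions as base, the transform in the masses is a constant field of unitaries;
  -- exchanging the variables before and after returns to the original order.
  obtain ⟨D, hD⟩ := exists_directIntegral (α := Config N) (β := Mass N) (fun _ => fourierInvE N)
    (fun _ => stronglyMeasurable_const) (fun _ => stronglyMeasurable_const)
  refine ⟨((swapOp _ _).trans D).trans (swapOp _ _), fun Ψ => ?_⟩
  have h : ∀ᵐ x, slice (swapOp (Mass N) (Config N) (swapOp _ _ (D (swapOp _ _ Ψ)))) x =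
      slice (D (swapOp _ _ Ψ)) x := by
    have e : swapOp (Mass N) (Config N) (swapOp _ _ (D (swapOp _ _ Ψ))) = D (swapOp _ _ Ψ) := by
      refine Lp.ext ?_
      filter_upwards [swapOp_ae (swapOp _ _ (D (swapOp _ _ Ψ))),
        (Measure.measurePreserving_swap (μ := (volume : Measure (Config N)))
          (ν := (volume : Measure (Mass N)))).quasiMeasurePreserving.ae
          (swapOp_ae (D (swapOp _ _ Ψ)))] with q h1 h2
      exact h1.trans h2
    rw [e]
    exact .of_forall fun _ => rfl
  filter_upwards [h, hD (swapOp _ _ Ψ), slice_swapOp Ψ,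
    slice_swapOp (swapOp _ _ (D (swapOp _ _ Ψ)))] with x h1 h2 h3 h4
  rw [← fourierInvE_apply, ← h3, ← h2, ← h1, h4]
  rfl

/-- At fixed positions the phase is a character of the masses, and the inverse transform turns a
character into a translation of ζ. -/
theorem zetaPicture_galExt {Z : ExtendedSpace N ≃ₗᵢ[ℂ] ExtendedSpace N} (hZ : IsZetaPicture Z)
    (r : ℝ) (g : Galilei) (t : ℝ) (Φ : ExtendedSpace N) : ∀ᵐ q : Mass N × Config N,
    Z (galExt γ N r g t Φ) q = Z Φ (q.1 + WithLp.toLp 2 fun k => phase γ g (t, q.2 k) + r,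
      fun k => (g⁻¹.act (t, q.2 k)).2) := by
  let α : Config N → Mass N := fun x => WithLp.toLp 2 fun k => phase γ g (t, x k) + r
  have hα : Measurable α := by
    unfold α phase
    fun_prop
  let y : Config N → Config N := fun x k => (g⁻¹.act (t, x k)).2
  have hy : y = rigid N g.R⁻¹ (invShift g t) := by
    funext x k
    exact act_inv_snd g t (x k)
  have hym : Measurable y := by
    rw [hy]
    exact (rigid N g.R⁻¹ (invShift g t)).continuous.measurable
  have hyae : ∀ {p : Config N → Prop}, (∀ᵐ x, p x) → ∀ᵐ x, p (y x) := by
    intro p hp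
    rw [hy]
    exact ae_rigid g.R⁻¹ (invShift g t) hp
  -- Measurability of the set of equality allows the exceptional set to be checked position by
  -- position, where the ζ-picture is defined.
  have hs : MeasurableSet {q : Mass N × Config N |
      Z (galExt γ N r g t Φ) q = Z Φ (q.1 + α q.2, y q.2)} :=
    measurableSet_eq_fun (Lp.stronglyMeasurable _).measurable
      ((Lp.stronglyMeasurable _).measurable.comp (by fun_prop))
  refine (Measure.ae_prod_mem_iff_ae_ae_mem hs).2 ?_
  refine (Measure.ae_ae_comm (p := fun (ζ : Mass N) (x : Config N) =>
    Z (galExt γ N r g t Φ) (ζ, x) = Z Φ (ζ + α x, y x)) hs).2 ?_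
  have hslice : ∀ Ψ : ExtendedSpace N, ∀ᵐ x, MemLp (fun m => Ψ (m, x)) 2
      (volume : Measure (Mass N)) := by
    intro Ψ
    filter_upwards [ae_memLp_slice (swapOp _ _ Ψ), ae_ae_of_ae_volume_prod (swapOp_ae Ψ)]
      with x h1 h2
    exact (memLp_congr_ae h2).1 h1
  have hgal : ∀ᵐ x, (fun m => galExt γ N r g t Φ (m, x)) =ᵐ[volume] fun m =>
      Complex.exp (Complex.I * (galPhase γ m r g t x : ℂ)) * Φ (m, y x) := by
    have := (Measure.measurePreserving_swap (μ := (volume : Measure (Config N)))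
      (ν := (volume : Measure (Mass N)))).quasiMeasurePreserving.ae (galExt_ae γ r g t Φ)
    exact ae_ae_of_ae_volume_prod this
  filter_upwards [hZ (galExt γ N r g t Φ), hgal, hyae (hZ Φ), hyae (hslice Φ),
    hslice (Z (galExt γ N r g t Φ)), hyae (hslice (Z Φ))] with x h1 h2 h3 h4 h5 h6
  have e1 : (toL2 fun m => galExt γ N r g t Φ (m, x)) =
      modOp (α x) (toL2 fun m => Φ (m, y x)) := by
    rw [toL2_congr h2, modOp, phaseMul_toL2 _ _ h4]
    congr 1
  rw [e1, ← fourierInvE_apply, fourierInvE_modOp, fourierInvE_apply, ← h3] at h1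
  filter_upwards [coeFn_toL2 h5, shiftOp_ae (α x) (toL2 fun ζ => Z Φ (ζ, y x)),
    (measurePreserving_add_right (volume : Measure (Mass N)) (α x)).quasiMeasurePreserving.ae
      (coeFn_toL2 h6)] with ζ k1 k2 k3
  rw [← k1, h1, k2, k3]

/-! ### The classical maps -/

theorem xi_inv_comm (g : Galilei) : xi γ g g⁻¹ = xi γ g⁻¹ g := by
  have h := xi_cocycle γ g⁻¹ g g⁻¹
  rw [inv_mul_cancel, mul_inv_cancel, xi_one_left, xi_one_right] at h
  linarith

/-- The cocycle correction in the extension element cancels the one built into the classical map,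
because ξ(g, g⁻¹) = ξ(g⁻¹, g). What remains is the translation of ζ by φ_g + r. -/
theorem classicalMap_inv (r : ℝ) (g : Galilei) (t : ℝ) (q : Mass N × Config N) :
    classicalMap (⟨-r - xi γ g⁻¹ g, g⁻¹⟩ : Ext γ) (t, q) =
      (t - g.time, q.1 + WithLp.toLp 2 fun k => phase γ g (t, q.2 k) + r,
        fun k => (g⁻¹.act (t, q.2 k)).2) := by
  unfold classicalMap
  refine Prod.ext (sub_eq_add_neg _ _).symm (Prod.ext ?_ rfl)
  ext k
  simp only [inv_inv, xi_inv_comm, PiLp.add_apply]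
  ring

theorem Ext.inv_eq (hγ : γ 1 = 0) (ρ : Ext γ) : ρ⁻¹ = ⟨-ρ.r - xi γ ρ.g⁻¹ ρ.g, ρ.g⁻¹⟩ := by
  rw [Ext.inv_def, hγ, sub_zero]

theorem classicalMap_leftInverse (hγ : γ 1 = 0) (ρ : Ext γ) :
    Function.LeftInverse (classicalMap (N := N) ρ⁻¹) (classicalMap ρ) := by
  rintro ⟨t, ζ, x⟩
  rw [Ext.inv_eq γ hγ]
  have h0 : ∀ p : ℝ × E3, ρ.g⁻¹.act (ρ.g.act p) = p := fun p => by
    rw [← Galilei.act_mul, inv_mul_cancel, Galilei.act_one]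
  have h1 : ∀ k, ((t + ρ.g.time, (ρ.g.act (t, x k)).2) : ℝ × E3) = ρ.g.act (t, x k) := fun k => rfl
  -- This is the cocycle identity for g⁻¹g = e. The normalisation at the unit element makes the
  -- phase of e vanish, so the two shifts of ζ cancel.
  have h2 : ∀ p, phase γ ρ.g (ρ.g.act p) + phase γ ρ.g⁻¹ p = xi γ ρ.g⁻¹ ρ.g := by
    intro p
    have := phase_central γ ρ.g⁻¹ ρ.g p
    rw [inv_inv, inv_mul_cancel] at this
    rw [this]
    simp [phase, Galilei.one_def]
    exact hγ
  change classicalMap _ (t + ρ.g.time, _, _) = _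
  rw [classicalMap_inv]
  refine Prod.ext (by simp) (Prod.ext ?_ ?_)
  · ext k
    simp only [PiLp.add_apply, h1]
    linarith [h2 (t, x k)]
  · funext k
    simp only [h1, h0]

end Extended

end GalileiMass

/-! ### The proposition -/

theorem mainTheorem9 (N : ℕ) (hN : 1 ≤ N)
    (V : Mass N → Config N → ℝ) (hVmeas : Measurable (Function.uncurry V))
    (hVtrans : ∀ (m : Mass N) (a : E3) (x : Config N), V m (fun k => x k + a) = V m x)
    (hVrot : ∀ (m : Mass N) (R : SO3) (x : Config N), V m (fun k => rot R (x k)) = V m x)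
    (hH : ∀ᵐ m : Mass N, IsEssSelfAdjoint m (V m))
    (γ : Galilei → ℝ) :
    -- the fibre operators `U_g^{(m)}` form a unitary projective representation of the
    -- Galileian group with multiplier `e^{iMξ}`, ...
    (∀ m : Mass N, (∀ k, m k ≠ 0) → IsEssSelfAdjoint m (V m) →
      (∀ g : Galilei, ∃ W : L2 (Config N) ≃ₗᵢ[ℂ] L2 (Config N),
        ∀ ψ, W ψ = fibreOp (V m) γ m 0 g ψ) ∧
      (∀ (g' g : Galilei) (ψ : L2 (Config N)),
        fibreOp (V m) γ m 0 g' (fibreOp (V m) γ m 0 g ψ) =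
          Complex.exp (Complex.I * (((∑ j, m j) * xi γ g' g : ℝ) : ℂ)) •
            fibreOp (V m) γ m 0 (g' * g) ψ)) ∧
    -- ... namely `Z_g^{(M)} ⊗ T_{(c,R)}` in centre-of-mass and Jacobi coordinates
    (∀ m : Mass N, (∀ k, m k ≠ 0) → (∀ k, k < N → tailMass m k ≠ 0) →
      IsEssSelfAdjoint m (V m) →
      ∀ v : Config (N - 1) → ℝ, (∀ x, V m x = v (jacobi m x)) →
        IsEssSelfAdjoint (reducedMass m) v →
        ∀ (g : Galilei) (a : L2 E3) (b : L2 (Config (N - 1))),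
          fibreOp (V m) γ m 0 g (toL2 fun x => a (tailCentre m 0 x) * b (jacobi m x)) =
            toL2 fun x => centreOp γ (∑ j, m j) g a (tailCentre m 0 x) *
              internalOp m v g.time g.R b (jacobi m x)) ∧
    ∃ (U : Ext γ →* (ExtendedSpace N ≃ₗᵢ[ℂ] ExtendedSpace N))
      (T : ℝ → (ExtendedSpace N ≃ₗᵢ[ℂ] ExtendedSpace N))
      (Z : ExtendedSpace N ≃ₗᵢ[ℂ] ExtendedSpace N),
      -- (i) the operators `U_{(r,g)}` given by the fibre formula are well defined, and form a
      -- unitary representation of the central extension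
      (∀ ρ : Ext γ, IsDirectIntegral (fun m => fibreOp (V m) γ m ρ.r ρ.g) (U ρ)) ∧
      -- the time evolution and the passage to the `ζ`-picture
      (∀ t : ℝ, IsDirectIntegral (fun m => evolution m (V m) t) (T t)) ∧
      IsZetaPicture Z ∧
      -- (ii) for arbitrary constants `γ`
      (∀ (ρ : Ext γ) (t : ℝ) (Ψ : ExtendedSpace N), ∀ᵐ q : Mass N × Config N,
        Z (T t (U ρ Ψ)) q =
          let w := classicalMap (⟨-ρ.r - xi γ ρ.g⁻¹ ρ.g, ρ.g⁻¹⟩ : Ext γ) (t, q)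
          Z (T w.1 Ψ) w.2) ∧
      -- (ii) in terms of inverses, for constants normalised at the unit element
      (γ 1 = 0 → ∀ ρ : Ext γ,
        Function.LeftInverse (classicalMap (N := N) ρ⁻¹) (classicalMap ρ) ∧
        Function.RightInverse (classicalMap (N := N) ρ⁻¹) (classicalMap ρ) ∧
        ∀ (t : ℝ) (Ψ : ExtendedSpace N), ∀ᵐ q : Mass N × Config N,
          Z (T t (U ρ Ψ)) q =
            let w := classicalMap ρ⁻¹ (t, q)
            Z (T w.1 Ψ) w.2) := by
  have hV : ∀ m, IsInvariant (V m) := fun m => isInvariant_of (hVtrans m) (hVrot m)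
  refine ⟨fun m hm h => ⟨fun g => ⟨galOp γ m 0 g 0 * evolution m (V m) (-g.time),
    fun ψ => (fibreOp_eq γ h (hV m) 0 g ψ).symm⟩, fun g' g ψ =>
      fibreOp_projective γ h (hV m) hm g' g ψ⟩,
    fun m hm hT h v hv h' g a b => fibreOp_jacobi hm hT hN hv h h' γ g a b, ?_⟩
  obtain ⟨T, hT⟩ := exists_evolution hVmeas hH
  obtain ⟨U, hU⟩ := exists_representation γ hV hH hT
  obtain ⟨Z, hZ⟩ := exists_zetaPicture N
  have key : ∀ (ρ : Ext γ) (t : ℝ) (Ψ : ExtendedSpace N), ∀ᵐ q : Mass N × Config N,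
      Z (T t (U ρ Ψ)) q =
        let w := classicalMap (⟨-ρ.r - xi γ ρ.g⁻¹ ρ.g, ρ.g⁻¹⟩ : Ext γ) (t, q)
        Z (T w.1 Ψ) w.2 := by
    intro ρ t Ψ
    rw [evolution_representation γ hV hH hT (hU ρ) t Ψ]
    filter_upwards [zetaPicture_galExt γ hZ ρ.r ρ.g t (T (t - ρ.g.time) Ψ)] with q hq
    rw [hq, classicalMap_inv]
  refine ⟨U, T, Z, hU, hT, hZ, key, fun hγ ρ => ⟨classicalMap_leftInverse γ hγ ρ, ?_, ?_⟩⟩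
  -- The right inverse is the left inverse property for ρ⁻¹, the extension being a group.
  · have := classicalMap_leftInverse (N := N) γ hγ ρ⁻¹
    rwa [inv_inv] at this
  · intro t Ψ
    rw [Ext.inv_eq γ hγ]
    exact key ρ t Ψ
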